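/- **Setting.** Let $F,G:\mathbb R^m\times\mathbb R^n\to\mathbb R$, write $\omega_\lambda=\arg\min_\omega G(\lambda,\omega)$, $f(\lambda)=F(\lambda,\omega_\lambda)$, $v_\lambda=\partial_{\omega^2}G(\lambda,\omega_\lambda)^{-1}\partial_\omega F(\lambda,\omega_\lambda)$. Let $\partial_{\omega\lambda}G(\lambda,\omega)$ be the $m\times n$ matrix that is the transpose of the Jacobian of $\lambda\mapsto\partial_\omega G(\lambda,\omega)$. Matrix norms are operator norms, and "Lipschitz" means jointly in $(\lambda,\omega)$ for the Euclidean norm of $\mathbb R^{m+n}$. Let $\mu_G,L_{F,\lambda},L_{F,\omega},C_{F,\lambda},C_{F,\omega},L_{G,\omega},C_{G,\omega\lambda},L_{G,\omega\lambda},L_{G,\omega\omega}>0$. **(A)** $F$ is differentiable, $\partial_\lambda F$ and $\partial_\omega F$ are Lipschitz with constants $L_{F,\lambda}$, $L_{F,\omega}$, and $\|\partial_\lambda F\|\le C_{F,\lambda}$, $\|\partial_\omega F\|\le C_{F,\omega}$. **(B)** $G$ is $C^2$ and $\mu_G$-strongly convex in $\omega$ for every $\lambda$; $\partial_\omega G$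 is $L_{G,\omega}$-Lipschitz, $\|\partial_{\omega\lambda}G\|\le C_{G,\omega\lambda}$, and $\partial_{\omega\lambda}G$, $\partial_{\omega^2}G$ are Lipschitz with constants $L_{G,\omega\lambda}$, $L_{G,\omega\omega}$. **(C)** For a random sample $\xi$ there are random functions $F(\cdot,\cdot;\xi)$, $G(\cdot,\cdot;\xi)$ that satisfy (A) and (B) with the same constants for every $\xi$, and $\partial_\lambda F(\lambda,\omega;\xi)$, $\partial_\omega F(\lambda,\omega;\xi)$, $\partial_\omega G(\lambda,\omega;\xi)$, $\partial_{\omega^2}G(\lambda,\omega;\xi)$, $\partial_{\omega\lambda}G(\lambda,\omega;\xi)$ are unbiased estimates of the corresponding derivatives of $F$, $G$ with $\mathbb E\|\text{estimate}-\text{mean}\|^2\le\sigma^2$. **Constants.** Put $M=\frac{C_{F,\omega}}{\mu_G}$, $C_\omega=\frac{C_{G,\omega\lambda}}{\mu_G}$, $C_v=\bigl(\frac{C_{F,\omega}L_{G,\omega\omega}}{\mu_G^2}+\frac{L_{F,\omega}}{\mu_G}\bigr)(1+C_\omega)$, $L_f=(L_{F,\lambda}+ML_{G,\omega\lambda})(1+C_\omega)+C_{G,\omega\lambda}C_v$,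 $\Gamma_1^2=C_{G,\omega\lambda}^2$, $\Gamma_2^2=2L_{F,\lambda}^2+4L_{G,\omega\lambda}^2M^2$, $\gamma_v=32\Gamma_1^2C_v^2$, $\gamma_\omega=8\Gamma_2^2C_\omega^2$, $c_\eta=\frac{4\Gamma_2^2}{L_f}$, $c_\beta=\frac{2(3\gamma_v+1)}{\mu_G}$, $$c_\tau=\frac{2\gamma_v\Gamma_2^2\gamma_\omega+2\gamma_v\Gamma_2^2+4\Gamma_1^2c_\beta^2(L_{F,\omega}^2+M^2L_{G,\omega\omega}^2)}{\gamma_v\Gamma_2^2\mu_G},\qquad \bar C=\frac{C_{d,n}}{c_\eta}+4\Gamma_1^2c_\beta^2(1+M^2)+\Gamma_2^2c_\tau^2,$$ where $C_{d,n}=2\bigl(c_\tau^2\Gamma_2^2+4c_\beta^2(1+M^2)\Gamma_1^2+c_\eta^2(1+M^2)\bigr)$. **Algorithm (FSLA).** Let $\lambda_0,\omega_0$ be arbitrary, $\|v_0\|\le M$, and let $d_0$ be square integrable and independent of all samples. Put $\alpha_k=\delta/\sqrt{k+1}$ and $\tau_{k}=c_\tau\alpha_{k-1}$, $\beta_{k}=c_\beta\alpha_{k-1}$,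 $\eta_{k}=c_\eta\alpha_{k-1}$ for $k\ge1$. With independent samples $\xi_{k,1},\dots,\xi_{k,5}$ ($k\ge1$), each with the law of $\xi$, and $g_j(\xi_k)=\partial_\lambda F(\lambda_j,\omega_j;\xi_{k,4})-\partial_{\omega\lambda}G(\lambda_j,\omega_j;\xi_{k,5})v_j$, set for $k\ge0$ $$\lambda_{k+1}=\lambda_k-\alpha_kd_k,\qquad \omega_{k+1}=\omega_k-\tau_{k+1}\partial_\omega G(\lambda_{k+1},\omega_k;\xi_{k+1,1}),$$ $$v_{k+1}=\beta_{k+1}\partial_\omega F(\lambda_{k+1},\omega_k;\xi_{k+1,2})+\bigl(I-\beta_{k+1}\partial_{\omega^2}G(\lambda_{k+1},\omega_k;\xi_{k+1,3})\bigr)v_k,$$ $$d_{k+1}=g_{k+1}(\xi_{k+1})+(1-\eta_{k+1})\bigl(d_k-g_k(\xi_{k+1})\bigr).$$ **Theorem.** There is $\delta_0>0$, depending only on the nine constants $\mu_G,\dots,L_{G,\omega\omega}$, such that the following holds for all $m,n$, all $F,G$ and random samples as in (A)–(C), all $\sigma$ and all $\delta\in(0,\delta_0]$. If $f\ge f_{\rm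 low}$ for a real number $f_{\rm low}$, then $f$ is differentiable, every $\mathbb E\|\nabla f(\lambda_k)\|^2$ is finite, and for every $K\ge1$ $$\frac1K\sum_{k=0}^{K-1}\mathbb E\|\nabla f(\lambda_k)\|^2\le\frac{2(\Phi_0-f_{\rm low})}{\delta\sqrt K}+\frac{2\delta\bar C\sigma^2\ln(K+1)}{\sqrt K},$$ where $\Phi_0=f(\lambda_0)+\Gamma_2^2\|\omega_0-\omega_{\lambda_0}\|^2+4\Gamma_1^2\|v_0-v_{\lambda_0}\|^2+\frac1{c_\eta}\mathbb E\bigl\|\partial_\lambda F(\lambda_0,\omega_0)-\partial_{\omega\lambda}G(\lambda_0,\omega_0)v_0-d_0\bigr\|^2$. In particular, for $f\ge0$ the first term may be taken to be $\frac{2\Phi_0}{\delta\sqrt K}$, and the average is $O(\ln(K+1)/\sqrt K)$. -/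

import Mathlib

open MeasureTheory ProbabilityTheory

noncomputable section

namespace FSLA

/-! ## Partial derivatives, the inner solution and the hyper-objective -/

section Calculus

variable {E W V : Type*}
  [NormedAddCommGroup E] [InnerProductSpace ℝ E] [CompleteSpace E]
  [NormedAddCommGroup W] [InnerProductSpace ℝ W] [CompleteSpace W]
  [NormedAddCommGroup V]

/-- Partial gradient `∂_λ F(λ, ω)`. -/
def gradOuter (F : E → W → ℝ) (l : E) (w : W) : E := gradient (fun l' => F l' w) l

/-- Partial gradient `∂_ω F(λ, ω)`. -/
def gradInner (F : E → W → ℝ) (l : E) (w : W) : W := gradient (F l) w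

/-- The Hessian `∂_{ω²} G(λ, ω)` in the inner variable. -/
def hessInner (G : E → W → ℝ) (l : E) (w : W) : W →L[ℝ] W := fderiv ℝ (gradInner G l) w

/-- The mixed second derivative `∂_{ωλ} G(λ, ω)`, as the linear map from the inner to the outer
space that is the transpose of the Jacobian of `λ ↦ ∂_ω G(λ, ω)`. -/
def hessMixed (G : E → W → ℝ) (l : E) (w : W) : W →L[ℝ] E :=
  ContinuousLinearMap.adjoint (fderiv ℝ (fun l' => gradInner G l' w) l)

/-- `ω_λ = argmin_ω G(λ, ω)`. -/
def innerSol (G : E → W → ℝ) (l : E) : W :=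
  Classical.epsilon fun w => IsMinOn (G l) Set.univ w

/-- `f(λ) = F(λ, ω_λ)`. -/
def hyperObj (F G : E → W → ℝ) (l : E) : ℝ := F l (innerSol G l)

/-- `v_λ = ∂_{ω²} G(λ, ω_λ)⁻¹ ∂_ω F(λ, ω_λ)`. -/
def linSol (F G : E → W → ℝ) (l : E) : W :=
  (hessInner G l (innerSol G l)).inverse (gradInner F l (innerSol G l))

/-- `∂_λ F(λ, ω) - ∂_{ωλ} G(λ, ω) v`. -/
def hyperGrad (F G : E → W → ℝ) (l : E) (w v : W) : E :=
  gradOuter F l w - hessMixed G l w v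

/-- Lipschitz continuity with constant `L`, jointly in both variables, for the Euclidean norm
of the pair `(λ, ω)`. -/
def JointLipschitz (L : ℝ) (g : E → W → V) : Prop :=
  ∀ l l' w w', ‖g l w - g l' w'‖ ≤ L * √(‖l - l'‖ ^ 2 + ‖w - w'‖ ^ 2)

end Calculus

/-! ## Problem constants and the constants derived from them -/

/-- The constants of the assumptions: `μ_G, L_{F,λ}, L_{F,ω}, C_{F,λ}, C_{F,ω}, L_{G,ω}, C_{G,ωλ},
L_{G,ωλ}, L_{G,ωω}`. -/
structure Constants where
  μG : ℝ
  LFl : ℝ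
  LFw : ℝ
  CFl : ℝ
  CFw : ℝ
  LGw : ℝ
  CGwl : ℝ
  LGwl : ℝ
  LGww : ℝ

namespace Constants

structure Positive (c : Constants) : Prop where
  μG : 0 < c.μG
  LFl : 0 < c.LFl
  LFw : 0 < c.LFw
  CFl : 0 < c.CFl
  CFw : 0 < c.CFw
  LGw : 0 < c.LGw
  CGwl : 0 < c.CGwl
  LGwl : 0 < c.LGwl
  LGww : 0 < c.LGww

variable (c : Constants)

/-- `M = C_{F,ω} / μ_G`. -/
def M : ℝ := c.CFw / c.μG

/-- `C_ω`, the Lipschitz constant of `λ ↦ ω_λ`. -/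
def Cω : ℝ := c.CGwl / c.μG

/-- `C_v`, the Lipschitz constant of `λ ↦ v_λ`. -/
def Cv : ℝ := (c.CFw * c.LGww / c.μG ^ 2 + c.LFw / c.μG) * (1 + c.Cω)

/-- `L_f`, the Lipschitz constant of `∇f`. -/
def Lf : ℝ := (c.LFl + c.M * c.LGwl) * (1 + c.Cω) + c.CGwl * c.Cv

/-- `Γ₁²`. -/
def Γ₁sq : ℝ := c.CGwl ^ 2

/-- `Γ₂²`. -/
def Γ₂sq : ℝ := 2 * c.LFl ^ 2 + 4 * c.LGwl ^ 2 * c.M ^ 2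

def γv : ℝ := 32 * c.Γ₁sq * c.Cv ^ 2

def γω : ℝ := 8 * c.Γ₂sq * c.Cω ^ 2

def cη : ℝ := 4 * c.Γ₂sq / c.Lf

def cβ : ℝ := 2 * (3 * c.γv + 1) / c.μG

def cτ : ℝ :=
  (2 * c.γv * c.Γ₂sq * c.γω + 2 * c.γv * c.Γ₂sq
    + 4 * c.Γ₁sq * c.cβ ^ 2 * (c.LFw ^ 2 + c.M ^ 2 * c.LGww ^ 2)) / (c.γv * c.Γ₂sq * c.μG)

/-- `C_{d,n}`. -/
def Cdn : ℝ :=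
  2 * (c.cτ ^ 2 * c.Γ₂sq + 4 * c.cβ ^ 2 * (1 + c.M ^ 2) * c.Γ₁sq + c.cη ^ 2 * (1 + c.M ^ 2))

/-- `C_{v,n}`. -/
def Cvn : ℝ := c.cβ ^ 2 * (1 + c.M ^ 2)

/-- `C_{ω,n}`. -/
def Cωn : ℝ := c.cτ ^ 2

/-- `C̄`. -/
def Cbar : ℝ := c.Cdn / c.cη + 4 * c.Γ₁sq * c.Cvn + c.Γ₂sq * c.Cωn

end Constants

/-! ## Assumptions -/

section Assumptions

variable {E W V Ξ : Type*}
  [NormedAddCommGroup E] [InnerProductSpace ℝ E] [CompleteSpace E]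
  [NormedAddCommGroup W] [InnerProductSpace ℝ W] [CompleteSpace W]
  [NormedAddCommGroup V] [NormedSpace ℝ V] [MeasurableSpace Ξ]

/-- Assumption on an outer function. -/
structure OuterAssumption (c : Constants) (F : E → W → ℝ) : Prop where
  differentiable : Differentiable ℝ (fun p : E × W => F p.1 p.2)
  lipschitz_outer : JointLipschitz c.LFl (gradOuter F)
  lipschitz_inner : JointLipschitz c.LFw (gradInner F)
  bound_outer : ∀ l w, ‖gradOuter F l w‖ ≤ c.CFl
  bound_inner : ∀ l w, ‖gradInner F l w‖ ≤ c.CFw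

/-- Assumption on an inner function. -/
structure InnerAssumption (c : Constants) (G : E → W → ℝ) : Prop where
  contDiff : ContDiff ℝ 2 (fun p : E × W => G p.1 p.2)
  strongConvex : ∀ l, StrongConvexOn Set.univ c.μG (G l)
  lipschitz_grad : JointLipschitz c.LGw (gradInner G)
  bound_mixed : ∀ l w, ‖hessMixed G l w‖ ≤ c.CGwl
  lipschitz_mixed : JointLipschitz c.LGwl (hessMixed G)
  lipschitz_hess : JointLipschitz c.LGww (hessInner G)

/-- `oracle ξ λ ω`, with `ξ` of law `D`, is an unbiased estimate of `target λ ω` with variance at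
most `σ²`. -/
structure UnbiasedOracle (D : Measure Ξ) (σ : ℝ) (oracle : Ξ → E → W → V) (target : E → W → V) :
    Prop where
  measurable : ∀ l w, StronglyMeasurable (fun ξ => oracle ξ l w)
  memLp : ∀ l w, MemLp (fun ξ => oracle ξ l w) 2 D
  unbiased : ∀ l w, ∫ ξ, oracle ξ l w ∂D = target l w
  variance : ∀ l w, ∫ ξ, ‖oracle ξ l w - target l w‖ ^ 2 ∂D ≤ σ ^ 2

/-- The five derivative oracles are unbiased with variance at most `σ²`. -/
structure NoiseAssumption (D : Measure Ξ) (σ : ℝ) (F G : E → W → ℝ) (Fs Gs : Ξ → E → W → ℝ) :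
    Prop where
  outerGradF : UnbiasedOracle D σ (fun ξ => gradOuter (Fs ξ)) (gradOuter F)
  innerGradF : UnbiasedOracle D σ (fun ξ => gradInner (Fs ξ)) (gradInner F)
  innerGradG : UnbiasedOracle D σ (fun ξ => gradInner (Gs ξ)) (gradInner G)
  hessG : UnbiasedOracle D σ (fun ξ => hessInner (Gs ξ)) (hessInner G)
  mixedG : UnbiasedOracle D σ (fun ξ => hessMixed (Gs ξ)) (hessMixed G)

end Assumptions

/-! ## The algorithm -/

/-- The state `(λ_k, ω_k, v_k, d_k)`. -/
structure State (E W : Type*) where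
  lam : E
  om : W
  v : W
  d : E

/-- `α_k = δ / √(k + 1)`. -/
def stepSize (δ : ℝ) (k : ℕ) : ℝ := δ / √((k : ℝ) + 1)

section Algorithm

variable {E W Ξ : Type*}
  [NormedAddCommGroup E] [InnerProductSpace ℝ E] [CompleteSpace E]
  [NormedAddCommGroup W] [InnerProductSpace ℝ W] [CompleteSpace W]

/-- `∂_λ F(λ, ω; ξ) - ∂_{ωλ} G(λ, ω; ξ') v`. -/
def stochHyperGrad (Fs Gs : Ξ → E → W → ℝ) (ξ ξ' : Ξ) (l : E) (w v : W) : E :=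
  gradOuter (Fs ξ) l w - hessMixed (Gs ξ') l w v

/-- The passage from iterate `k` to iterate `k + 1`, with outer step size `α = α_k`, where
`ξ 0, …, ξ 4` are the samples `ξ_{k+1,1}, …, ξ_{k+1,5}`. -/
def step (c : Constants) (Fs Gs : Ξ → E → W → ℝ) (α : ℝ) (ξ : Fin 5 → Ξ) (s : State E W) :
    State E W :=
  let τ := c.cτ * α
  let β := c.cβ * α
  let η := c.cη * α
  let lam' := s.lam - α • s.d
  let om' := s.om - τ • gradInner (Gs (ξ 0)) lam' s.om
  let v' := β • gradInner (Fs (ξ 1)) lam' s.om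
    + (s.v - β • hessInner (Gs (ξ 2)) lam' s.om s.v)
  let d' := stochHyperGrad Fs Gs (ξ 3) (ξ 4) lam' om' v'
    + (1 - η) • (s.d - stochHyperGrad Fs Gs (ξ 3) (ξ 4) s.lam s.om s.v)
  ⟨lam', om', v', d'⟩

/-- The iterates, where `ξ (k, i)` is the `i`-th sample drawn in iteration `k`. -/
def iterate (c : Constants) (Fs Gs : Ξ → E → W → ℝ) (δ : ℝ) (ξ : ℕ × Fin 5 → Ξ)
    (s₀ : State E W) : ℕ → State E W
  | 0 => s₀
  | k + 1 => step c Fs Gs (stepSize δ k) (fun i => ξ (k, i)) (iterate c Fs Gs δ ξ s₀ k)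

/-- The potential `f(λ) + Γ₂² ‖ω - ω_λ‖² + 4 Γ₁² ‖v - v_λ‖² + ‖∇f_k - d‖² / c_η`, where
`∇f_k = ∂_λ F(λ, ω) - ∂_{ωλ} G(λ, ω) v`. -/
def potential (c : Constants) (F G : E → W → ℝ) (s : State E W) : ℝ :=
  hyperObj F G s.lam + c.Γ₂sq * ‖s.om - innerSol G s.lam‖ ^ 2
    + 4 * c.Γ₁sq * ‖s.v - linSol F G s.lam‖ ^ 2
    + ‖hyperGrad F G s.lam s.om s.v - s.d‖ ^ 2 / c.cη

end Algorithm

end FSLA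

end

/-! By implicit differentiation `∇f(λ) = ∂_λF - ∂_{ωλ}G v_λ`, evaluated at `ω_λ`. The algorithm
tracks three moving targets on one time scale `α`: `ω` follows `ω_λ` by stochastic gradient descent,
`v` follows `v_λ` by a stochastic Richardson iteration for the system `∂_{ω²}G v = ∂_ωF`, and `d`
follows the resulting gradient estimate by recursive momentum.

The descent lemma for `f` yields the gains `α/2 ‖∇f‖²` and `α/2 ‖d‖²` at the price `α/2 ‖∇f - d‖²`,
and `∇f - d` is controlled by the three tracking errors. Each error contracts at a rate proportional
to `α`. The errors of `ω` and `v` are disturbed because `ω_λ` and `v_λ` move, by Lipschitz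
continuity, at most proportionally to `α‖d‖`; the gain `α/2 ‖d‖²` pays for this. The error of `ω`
also feeds that of `v`, which accounts for the last summand of `cτ`. Hence the weighted sum
`lyapunov` decreases by `α/2 ‖∇f‖²` along the noiseless iteration (`mean_decrease`, resting on
`scalar_decrease`).

The noise adds only order `α²`. It is centred given everything else, so second moments just add
(`integral_norm_add_sq_le`). Since every sample satisfies the assumptions, `‖v_k‖ ≤ M` holds surely,
so operator noise applied to `v_k` has variance at most `σ²M²`. In the recursion for `d` the noise
is a difference of one sample at two consecutive points plus `η` times fresh noise; the former is
bounded by the increments of the iterates (`integral_momentum_step_le`).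

Together these give `expected_decrease`, which is telescoped. The Lyapunov function carries half of
the error weights of `potential`: this halves the noise constant to `C̄/2` and makes up for the
factor two in `∑ 1/(k+1) ≤ 2 ln(K+1)`. -/

noncomputable section
set_option linter.unusedSectionVars false

namespace FSLA

/-! ### Convexity and smoothness in Hilbert space. -/

section General

variable {H : Type*} [NormedAddCommGroup H] [InnerProductSpace ℝ H] [CompleteSpace H]

/-- The quadratic upper bound for functions with Lipschitz gradient. -/
theorem le_quadratic_of_lipschitz_gradient {f : H → ℝ} {g : H → H} {L : ℝ}
    (hf : ∀ x, HasGradientAt f (g x) x) (hg : ∀ x y, ‖g x - g y‖ ≤ L * ‖x - y‖) (x y : H) :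
    f y ≤ f x + inner ℝ (g x) (y - x) + L / 2 * ‖y - x‖ ^ 2 := by
  set v := y - x with hv
  let φ : ℝ → ℝ := fun t => f (x + t • v) - t * inner ℝ (g x) v - L / 2 * ‖v‖ ^ 2 * t ^ 2
  have hφ : ∀ t, HasDerivAt φ
      (inner ℝ (g (x + t • v)) v - inner ℝ (g x) v - L * ‖v‖ ^ 2 * t) t := by
    intro t
    have h1 : HasDerivAt (fun t : ℝ => x + t • v) v t := by
      simpa using ((hasDerivAt_id t).smul_const v).const_add x
    have h2 : HasDerivAt (fun t : ℝ => f (x + t • v)) (inner ℝ (g (x + t • v)) v) t := by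
      have := (hf (x + t • v)).hasFDerivAt.comp_hasDerivAt t h1
      rwa [InnerProductSpace.toDual_apply_apply] at this
    have h3 : HasDerivAt (fun t : ℝ => t * inner ℝ (g x) v) (inner ℝ (g x) v) t := by
      simpa using (hasDerivAt_id t).mul_const (inner ℝ (g x) v)
    have h4 : HasDerivAt (fun t : ℝ => L / 2 * ‖v‖ ^ 2 * t ^ 2) (L * ‖v‖ ^ 2 * t) t := by
      refine ((hasDerivAt_pow 2 t).const_mul (L / 2 * ‖v‖ ^ 2)).congr_deriv ?_
      norm_num
      ring
    exact (h2.sub h3).sub h4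
  have hanti : AntitoneOn φ (Set.Icc 0 1) := by
    apply antitoneOn_of_deriv_nonpos (convex_Icc 0 1)
    · exact fun t _ => (hφ t).continuousAt.continuousWithinAt
    · exact fun t _ => (hφ t).differentiableAt.differentiableWithinAt
    · intro t ht
      rw [interior_Icc] at ht
      rw [(hφ t).deriv, ← inner_sub_left]
      have h1 := real_inner_le_norm (g (x + t • v) - g x) v
      have h2 := hg (x + t • v) x
      rw [add_sub_cancel_left, norm_smul, Real.norm_of_nonneg ht.1.le] at h2
      nlinarith [norm_nonneg v]
  have := hanti (by simp : (0 : ℝ) ∈ Set.Icc (0 : ℝ) 1) (by simp : (1 : ℝ) ∈ Set.Icc (0 : ℝ) 1)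
    zero_le_one
  simp only [φ, hv] at this
  simp at this
  rw [← hv] at this
  linarith

/-- The subgradient inequality for convex functions. -/
theorem convex_gradient_le {h : H → ℝ} (hh : ConvexOn ℝ Set.univ h) {x g : H}
    (hg : HasGradientAt h g x) (y : H) : h x + inner ℝ g (y - x) ≤ h y := by
  have hline : ConvexOn ℝ Set.univ (fun t : ℝ => h (x + t • (y - x))) := by
    have := hh.comp_affineMap (AffineMap.lineMap x y : ℝ →ᵃ[ℝ] H)
    rw [Set.preimage_univ] at this
    refine this.congr fun t _ => ?_
    simp [AffineMap.lineMap_apply, add_comm]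
  have hd : HasDerivAt (fun t : ℝ => h (x + t • (y - x))) (inner ℝ g (y - x)) 0 := by
    have h1 : HasDerivAt (fun t : ℝ => x + t • (y - x)) (y - x) 0 := by
      simpa using ((hasDerivAt_id (0 : ℝ)).smul_const (y - x)).const_add x
    have h2 : HasFDerivAt h (InnerProductSpace.toDual ℝ H g) (x + (0 : ℝ) • (y - x)) := by
      simpa using hg.hasFDerivAt
    have h3 := h2.comp_hasDerivAt 0 h1
    rwa [InnerProductSpace.toDual_apply_apply] at h3
  have := hline.le_slope_of_hasDerivAt (Set.mem_univ 0) (Set.mem_univ 1) zero_lt_one hd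
  simp [slope_def_field] at this
  linarith

theorem hasGradientAt_half_norm_sq (μ : ℝ) (x : H) :
    HasGradientAt (fun x : H => μ / 2 * ‖x‖ ^ 2) (μ • x) x := by
  rw [hasGradientAt_iff_hasFDerivAt]
  refine ((hasStrictFDerivAt_norm_sq x).hasFDerivAt.const_mul (μ / 2)).congr_fderiv ?_
  ext y
  simp
  ring

/-- The quadratic lower bound for strongly convex functions. -/
theorem strongConvex_gradient_le {h : H → ℝ} {μ : ℝ} (hh : StrongConvexOn Set.univ μ h) {x g : H}
    (hg : HasGradientAt h g x) (y : H) :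
    h x + inner ℝ g (y - x) + μ / 2 * ‖y - x‖ ^ 2 ≤ h y := by
  have h1 := convex_gradient_le (strongConvexOn_iff_convex.1 hh)
    (g := g - μ • x) (x := x) (by
      rw [hasGradientAt_iff_hasFDerivAt, map_sub]
      exact hg.hasFDerivAt.sub (hasGradientAt_half_norm_sq μ x).hasFDerivAt) y
  have h2 : ‖y - x‖ ^ 2 = ‖y‖ ^ 2 - 2 * inner ℝ x (y - x) - ‖x‖ ^ 2 := by
    rw [norm_sub_sq_real, inner_sub_right, real_inner_self_eq_norm_sq, real_inner_comm]
    ring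
  rw [inner_sub_left, real_inner_smul_left] at h1
  rw [h2]
  linarith

theorem strongConvex_monotone {h : H → ℝ} {μ : ℝ} (hh : StrongConvexOn Set.univ μ h) {g : H → H}
    (hg : ∀ x, HasGradientAt h (g x) x) (x y : H) :
    μ * ‖x - y‖ ^ 2 ≤ inner ℝ (g x - g y) (x - y) := by
  have h1 := strongConvex_gradient_le hh (hg x) y
  have h2 := strongConvex_gradient_le hh (hg y) x
  rw [← neg_sub x y, inner_neg_right, norm_neg] at h1
  rw [inner_sub_left]
  linarith

/-- A symmetric operator whose quadratic form lies between `0` and `r‖u‖²` has norm at most `r`. -/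
theorem norm_apply_le_of_quadratic_form {A : H →L[ℝ] H} {r : ℝ} (hr : 0 < r)
    (hsymm : ∀ u v, inner ℝ (A u) v = inner ℝ u (A v))
    (h0 : ∀ u, 0 ≤ inner ℝ (A u) u) (h1 : ∀ u, inner ℝ (A u) u ≤ r * ‖u‖ ^ 2) (u : H) :
    ‖A u‖ ≤ r * ‖u‖ := by
  -- Expanding the form at `ru - Au` and bounding both remaining forms from above by `h1` gives `0 ≤
  -- r³‖u‖² - 2r‖Au‖² + r‖Au‖²`. This avoids any spectral theory.
  have h2 := h0 (r • u - A u)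
  have h3 : inner ℝ (A (r • u - A u)) (r • u - A u)
      = r ^ 2 * inner ℝ (A u) u - 2 * r * ‖A u‖ ^ 2 + inner ℝ (A (A u)) (A u) := by
    rw [map_sub, map_smul, inner_sub_left, inner_sub_right, inner_sub_right]
    simp only [real_inner_smul_left, real_inner_smul_right, real_inner_self_eq_norm_sq]
    rw [hsymm (A u) u, real_inner_self_eq_norm_sq]
    ring
  have h4 := h1 u
  have h5 := h1 (A u)
  have h6 : r * ‖A u‖ ^ 2 ≤ r * (r * ‖u‖) ^ 2 := by nlinarith [sq_nonneg r]
  exact abs_le_of_sq_le_sq' (le_of_mul_le_mul_left h6 hr) (by positivity) |>.2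

end General

/-! ### The inner problem: minimizer, Hessian, implicit differentiation. -/

section Inner

variable {E W : Type*}
  [NormedAddCommGroup E] [InnerProductSpace ℝ E] [CompleteSpace E]
  [NormedAddCommGroup W] [InnerProductSpace ℝ W] [CompleteSpace W]
  {c : Constants} {F G : E → W → ℝ}

theorem JointLipschitz.norm_sub_right_le {V : Type*} [NormedAddCommGroup V] {L : ℝ}
    {g : E → W → V} (h : JointLipschitz L g) (l : E) (w w' : W) :
    ‖g l w - g l w'‖ ≤ L * ‖w - w'‖ := by simpa using h l l w w'

theorem JointLipschitz.continuous {V : Type*} [NormedAddCommGroup V] {L : ℝ}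
    {g : E → W → V} (h : JointLipschitz L g) : Continuous fun p : E × W => g p.1 p.2 := by
  rw [continuous_iff_continuousAt]
  intro p
  rw [ContinuousAt, tendsto_iff_norm_sub_tendsto_zero]
  have h1 : Filter.Tendsto (fun q : E × W => L * √(‖q.1 - p.1‖ ^ 2 + ‖q.2 - p.2‖ ^ 2)) (nhds p)
      (nhds (L * √(‖p.1 - p.1‖ ^ 2 + ‖p.2 - p.2‖ ^ 2))) :=
    Continuous.tendsto (by fun_prop) p
  refine squeeze_zero (fun _ => norm_nonneg _) (fun q => h q.1 p.1 q.2 p.2) ?_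
  simpa using h1

theorem JointLipschitz.sq_le {V : Type*} [NormedAddCommGroup V] {L : ℝ}
    {g : E → W → V} (h : JointLipschitz L g) (l l' : E) (w w' : W) :
    ‖g l w - g l' w'‖ ^ 2 ≤ L ^ 2 * (‖l - l'‖ ^ 2 + ‖w - w'‖ ^ 2) := by
  have := pow_le_pow_left₀ (norm_nonneg _) (h l l' w w') 2
  rwa [mul_pow, Real.sq_sqrt (by positivity)] at this

theorem OuterAssumption.hasGradientAt_inner (hF : OuterAssumption c F) (l : E) (w : W) :
    HasGradientAt (F l) (gradInner F l w) w :=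
  DifferentiableAt.hasGradientAt
    ((hF.differentiable (l, w)).comp w ((differentiableAt_const l).prodMk differentiableAt_id))

theorem OuterAssumption.hasGradientAt_outer (hF : OuterAssumption c F) (l : E) (w : W) :
    HasGradientAt (fun l' => F l' w) (gradOuter F l w) l :=
  DifferentiableAt.hasGradientAt (DifferentiableAt.comp (f := fun l' => (l', w)) l
    (hF.differentiable (l, w)) (differentiableAt_id.prodMk (differentiableAt_const w)))

/-- The joint derivative exists by assumption, and restricting it to the two coordinate slices
identifies its components. The joint form is needed for the chain rule along `λ ↦ (λ, ω_λ)`. -/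
theorem OuterAssumption.hasFDerivAt (hF : OuterAssumption c F) (l : E) (w : W) :
    HasFDerivAt (fun p : E × W => F p.1 p.2)
      ((InnerProductSpace.toDual ℝ E (gradOuter F l w)).coprod
        (InnerProductSpace.toDual ℝ W (gradInner F l w))) (l, w) := by
  have hd := (hF.differentiable (l, w)).hasFDerivAt
  have h1 := HasFDerivAt.comp (f := fun l' => (l', w)) l hd
    ((hasFDerivAt_id l).prodMk (hasFDerivAt_const w l))
  have h2 := HasFDerivAt.comp (f := fun w' => (l, w')) w hd
    ((hasFDerivAt_const l w).prodMk (hasFDerivAt_id w))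
  have e1 := h1.unique (hF.hasGradientAt_outer l w).hasFDerivAt
  have e2 := h2.unique (hF.hasGradientAt_inner l w).hasFDerivAt
  refine hd.congr_fderiv ?_
  ext p
  · rw [← e1]; simp
  · rw [← e2]; simp

theorem InnerAssumption.differentiable (hG : InnerAssumption c G) :
    Differentiable ℝ (fun p : E × W => G p.1 p.2) :=
  hG.contDiff.differentiable (by norm_num)

theorem InnerAssumption.hasGradientAt (hG : InnerAssumption c G) (l : E) (w : W) :
    HasGradientAt (G l) (gradInner G l w) w :=
  DifferentiableAt.hasGradientAt
    ((hG.differentiable (l, w)).comp w ((differentiableAt_const l).prodMk differentiableAt_id))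

/-- The partial gradient is the Riesz image of the joint derivative restricted to the second factor,
hence loses just one order of smoothness. -/
theorem InnerAssumption.contDiff_gradInner (hG : InnerAssumption c G) :
    ContDiff ℝ 1 (fun p : E × W => gradInner G p.1 p.2) := by
  have h1 : ContDiff ℝ 1 (fderiv ℝ (fun p : E × W => G p.1 p.2)) :=
    hG.contDiff.fderiv_right (by norm_num)
  have h2 : (fun p : E × W => gradInner G p.1 p.2) = fun p : E × W =>
      (InnerProductSpace.toDual ℝ W).symm
        ((fderiv ℝ (fun p : E × W => G p.1 p.2) p).comp (ContinuousLinearMap.inr ℝ E W)) := by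
    ext1 p
    have := HasFDerivAt.comp (f := fun w => (p.1, w)) p.2 (hG.differentiable p).hasFDerivAt
      ((hasFDerivAt_const p.1 p.2).prodMk (hasFDerivAt_id p.2))
    rw [gradInner, gradient]
    exact congrArg _ this.fderiv
  rw [h2]
  exact (LinearIsometryEquiv.contDiff _).comp (h1.clm_comp contDiff_const)

theorem InnerAssumption.adjoint_hessMixed (l : E) (w : W) :
    ContinuousLinearMap.adjoint (hessMixed G l w) = fderiv ℝ (fun l' => gradInner G l' w) l := by
  rw [hessMixed, ContinuousLinearMap.adjoint_adjoint]

theorem InnerAssumption.hasFDerivAt_gradInner_left (hG : InnerAssumption c G) (l : E) (w : W) :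
    HasFDerivAt (fun l' => gradInner G l' w) (ContinuousLinearMap.adjoint (hessMixed G l w)) l := by
  rw [adjoint_hessMixed]
  exact DifferentiableAt.hasFDerivAt (DifferentiableAt.comp (f := fun l' => (l', w)) l
    (hG.contDiff_gradInner.differentiable (by norm_num) (l, w))
    (differentiableAt_id.prodMk (differentiableAt_const w)))

theorem InnerAssumption.hasFDerivAt_gradInner_right (hG : InnerAssumption c G) (l : E) (w : W) :
    HasFDerivAt (gradInner G l) (hessInner G l w) w :=
  DifferentiableAt.hasFDerivAt (DifferentiableAt.comp (f := fun w' => (l, w')) w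
    (hG.contDiff_gradInner.differentiable (by norm_num) (l, w))
    ((differentiableAt_const l).prodMk differentiableAt_id))

theorem InnerAssumption.hasFDerivAt_gradInner (hG : InnerAssumption c G) (l : E) (w : W) :
    HasFDerivAt (fun p : E × W => gradInner G p.1 p.2)
      ((ContinuousLinearMap.adjoint (hessMixed G l w)).coprod (hessInner G l w)) (l, w) := by
  have hd := (hG.contDiff_gradInner.differentiable (by norm_num) (l, w)).hasFDerivAt
  have h1 := HasFDerivAt.comp (f := fun l' => (l', w)) l hd
    ((hasFDerivAt_id l).prodMk (hasFDerivAt_const w l))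
  have h2 := HasFDerivAt.comp (f := fun w' => (l, w')) w hd
    ((hasFDerivAt_const l w).prodMk (hasFDerivAt_id w))
  have e1 := h1.unique (hG.hasFDerivAt_gradInner_left l w)
  have e2 := h2.unique (hG.hasFDerivAt_gradInner_right l w)
  refine hd.congr_fderiv ?_
  ext p
  · rw [← e1]; simp
  · rw [← e2]; simp

theorem InnerAssumption.monotone (hG : InnerAssumption c G) (l : E) (w w' : W) :
    c.μG * ‖w - w'‖ ^ 2 ≤ inner ℝ (gradInner G l w - gradInner G l w') (w - w') :=
  strongConvex_monotone (hG.strongConvex l) (hG.hasGradientAt l) w w'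

theorem InnerAssumption.hess_symm (hG : InnerAssumption c G) (l : E) (w u v : W) :
    inner ℝ (hessInner G l w u) v = inner ℝ u (hessInner G l w v) := by
  have hGl : ContDiff ℝ 2 (G l) := hG.contDiff.comp (contDiff_const.prodMk contDiff_id)
  have hs : IsSymmSndFDerivAt ℝ (G l) w := hGl.contDiffAt.isSymmSndFDerivAt (by simp)
  have hfd : fderiv ℝ (fderiv ℝ (G l)) w
      = ((InnerProductSpace.toDual ℝ W).toContinuousLinearEquiv.toContinuousLinearMap).comp
        (hessInner G l w) := by
    have h1 : fderiv ℝ (G l) = fun w' => InnerProductSpace.toDual ℝ W (gradInner G l w') := by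
      ext1 w'
      exact (hG.hasGradientAt l w').hasFDerivAt.fderiv
    rw [h1]
    exact (((InnerProductSpace.toDual ℝ W).toContinuousLinearEquiv.hasFDerivAt).comp w
      (hG.hasFDerivAt_gradInner_right l w)).fderiv
  have := hs u v
  rw [hfd] at this
  simp at this
  rw [this, real_inner_comm]

/-- Strong monotonicity of the gradient bounds the difference quotients along the ray `w + tu`; the
bound survives the limit `t → 0+`. -/
theorem InnerAssumption.hess_lower (hG : InnerAssumption c G) (l : E) (w u : W) :
    c.μG * ‖u‖ ^ 2 ≤ inner ℝ (hessInner G l w u) u := by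
  have h1 : HasDerivAt (fun t : ℝ => inner ℝ (gradInner G l (w + t • u)) u)
      (inner ℝ (hessInner G l w u) u) 0 := by
    have h2 : HasDerivAt (fun t : ℝ => w + t • u) u 0 := by
      simpa using ((hasDerivAt_id (0 : ℝ)).smul_const u).const_add w
    have h3 : HasFDerivAt (gradInner G l) (hessInner G l w) (w + (0 : ℝ) • u) := by
      simpa using hG.hasFDerivAt_gradInner_right l w
    simpa using (h3.comp_hasDerivAt 0 h2).inner ℝ (hasDerivAt_const 0 u)
  have h4 := h1.tendsto_slope_zero_right
  refine ge_of_tendsto h4 ?_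
  filter_upwards [self_mem_nhdsWithin] with t ht
  have ht : 0 < t := ht
  have := hG.monotone l (w + t • u) w
  rw [add_sub_cancel_left, norm_smul, Real.norm_of_nonneg ht.le, real_inner_smul_right,
    inner_sub_left] at this
  simp only [zero_add, zero_smul, add_zero, smul_eq_mul]
  rw [le_inv_mul_iff₀ ht]
  nlinarith

theorem InnerAssumption.norm_hess_le (hc : c.Positive) (hG : InnerAssumption c G) (l : E) (w : W) :
    ‖hessInner G l w‖ ≤ c.LGw := by
  have h : LipschitzWith ⟨c.LGw, hc.LGw.le⟩ (gradInner G l) :=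
    LipschitzWith.of_dist_le_mul fun w w' => by
      rw [dist_eq_norm, dist_eq_norm]
      exact hG.lipschitz_grad.norm_sub_right_le l w w'
  exact norm_fderiv_le_of_lipschitz ℝ h

/-- `I - β ∂_{ω²}G` is symmetric with form between `0`, by `β L ≤ 1`, and `(1 - βμ)‖u‖²`. This is
the contraction of the iteration for `v`. Strictness of `βμ < 1` keeps the radius positive. -/
theorem InnerAssumption.norm_sub_smul_hess_le (hc : c.Positive) (hG : InnerAssumption c G)
    {β : ℝ} (hβ : 0 ≤ β) (hβL : β * c.LGw ≤ 1) (hβμ : β * c.μG < 1) (l : E) (w u : W) :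
    ‖u - β • hessInner G l w u‖ ≤ (1 - β * c.μG) * ‖u‖ := by
  have hin : ∀ u, inner ℝ (hessInner G l w u) u ≤ c.LGw * ‖u‖ ^ 2 := fun u => by
    have h1 := real_inner_le_norm (hessInner G l w u) u
    have h2 := (hessInner G l w).le_of_opNorm_le (hG.norm_hess_le hc l w) u
    nlinarith [norm_nonneg u]
  have := norm_apply_le_of_quadratic_form (A := ContinuousLinearMap.id ℝ W - β • hessInner G l w)
    (r := 1 - β * c.μG) (by linarith)
    (fun u v => by
      simp [inner_sub_left, inner_sub_right, real_inner_smul_left, real_inner_smul_right,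
        hG.hess_symm])
    (fun u => by
      simp only [sub_apply, smul_apply,
        ContinuousLinearMap.id_apply, inner_sub_left, real_inner_smul_left,
        real_inner_self_eq_norm_sq]
      nlinarith [hin u, sq_nonneg ‖u‖])
    (fun u => by
      simp only [sub_apply, smul_apply,
        ContinuousLinearMap.id_apply, inner_sub_left, real_inner_smul_left,
        real_inner_self_eq_norm_sq]
      nlinarith [hG.hess_lower l w u, sq_nonneg ‖u‖]) u
  simpa using this

theorem InnerAssumption.le_norm_hess (hG : InnerAssumption c G) (l : E) (w u : W) :
    c.μG * ‖u‖ ≤ ‖hessInner G l w u‖ := by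
  rcases (norm_nonneg u).eq_or_lt with h | h
  · rw [← h]; simp
  · have h1 := hG.hess_lower l w u
    have h2 := real_inner_le_norm (hessInner G l w u) u
    have : c.μG * ‖u‖ * ‖u‖ ≤ ‖hessInner G l w u‖ * ‖u‖ := by nlinarith
    exact le_of_mul_le_mul_right this h

variable [FiniteDimensional ℝ W]

/-- Strong convexity makes `G l` coercive, and bounded closed sets are compact in finite dimension.
Existence is what gives content to the choice in `innerSol`. -/
theorem InnerAssumption.exists_isMinOn (hc : c.Positive) (hG : InnerAssumption c G) (l : E) :
    ∃ w, IsMinOn (G l) Set.univ w := by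
  have hcont : Continuous (G l) :=
    hG.contDiff.continuous.comp (continuous_const.prodMk continuous_id)
  have hco : Filter.Tendsto (G l) (Filter.cocompact W) Filter.atTop := by
    have hlow : ∀ w, G l 0 - ‖gradInner G l 0‖ * ‖w‖ + c.μG / 2 * ‖w‖ ^ 2 ≤ G l w := fun w => by
      have h1 := strongConvex_gradient_le (hG.strongConvex l) (hG.hasGradientAt l 0) w
      have h2 := neg_le_of_abs_le (abs_real_inner_le_norm (gradInner G l 0) w)
      rw [sub_zero] at h1
      linarith
    refine Filter.tendsto_atTop_mono hlow ?_
    have hq : Filter.Tendsto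
        (fun t : ℝ => G l 0 + t * (c.μG / 2 * t - ‖gradInner G l 0‖)) Filter.atTop
        Filter.atTop := by
      apply Filter.tendsto_atTop_add_const_left
      apply Filter.Tendsto.atTop_mul_atTop₀ Filter.tendsto_id
      simp only [sub_eq_add_neg]
      apply Filter.tendsto_atTop_add_const_right
      exact Filter.tendsto_id.const_mul_atTop (by have := hc.μG; positivity)
    refine (hq.comp (tendsto_norm_cocompact_atTop (E := W))).congr fun w => ?_
    simp only [Function.comp]
    ring
  obtain ⟨w, hw⟩ := hcont.exists_forall_le hco
  exact ⟨w, fun w' _ => hw w'⟩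

theorem InnerAssumption.gradInner_innerSol (hc : c.Positive) (hG : InnerAssumption c G) (l : E) :
    gradInner G l (innerSol G l) = 0 := by
  have h : IsMinOn (G l) Set.univ (innerSol G l) :=
    Classical.epsilon_spec (hG.exists_isMinOn hc l)
  have h1 : IsLocalMin (G l) (innerSol G l) := h.isLocalMin Filter.univ_mem
  rw [gradInner, gradient, h1.fderiv_eq_zero, map_zero]

theorem InnerAssumption.isInvertible_hess (hc : c.Positive) (hG : InnerAssumption c G) (l : E) (w : W) :
    (hessInner G l w).IsInvertible := by
  have hinj : Function.Injective (hessInner G l w) := by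
    rw [injective_iff_map_eq_zero]
    intro u hu
    have := hG.le_norm_hess l w u
    rw [hu, norm_zero] at this
    have h2 := hc.μG
    exact norm_le_zero_iff.1 (by nlinarith [norm_nonneg u])
  exact ⟨(LinearEquiv.ofInjectiveEndo (hessInner G l w : W →ₗ[ℝ] W)
    hinj).toContinuousLinearEquiv, by ext u; rfl⟩

theorem InnerAssumption.hess_linSol (hc : c.Positive) (hG : InnerAssumption c G) (l : E) :
    hessInner G l (innerSol G l) (linSol F G l) = gradInner F l (innerSol G l) := by
  obtain ⟨e, he⟩ := hG.isInvertible_hess hc l (innerSol G l)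
  rw [linSol, ← he, ContinuousLinearMap.inverse_equiv]
  simp

theorem norm_linSol_le (hc : c.Positive) (hF : OuterAssumption c F) (hG : InnerAssumption c G)
    (l : E) : ‖linSol F G l‖ ≤ c.M := by
  have h1 := hG.le_norm_hess l (innerSol G l) (linSol F G l)
  rw [hG.hess_linSol hc] at h1
  rw [Constants.M, le_div_iff₀ hc.μG]
  linarith [hF.bound_inner l (innerSol G l)]

/-- Strong monotonicity of `∂_ωG(l, ·)` is tested at the two minimizers. One gradient vanishes; the
other, `∂_ωG(l, ω_{l'})`, differs from `∂_ωG(l', ω_{l'}) = 0` by at most `C_{G,ωλ}‖l - l'‖`. -/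
theorem InnerAssumption.innerSol_lipschitz (hc : c.Positive) (hG : InnerAssumption c G) (l l' : E) :
    ‖innerSol G l - innerSol G l'‖ ≤ c.Cω * ‖l - l'‖ := by
  have h1 := hG.monotone l (innerSol G l) (innerSol G l')
  have h2 : ‖gradInner G l (innerSol G l') - gradInner G l' (innerSol G l')‖
      ≤ c.CGwl * ‖l - l'‖ := by
    refine Convex.norm_image_sub_le_of_norm_hasFDerivWithin_le (s := Set.univ)
      (f := fun l => gradInner G l (innerSol G l'))
      (fun x _ => (hG.hasFDerivAt_gradInner_left x (innerSol G l')).hasFDerivWithinAt)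
      (fun x _ => ?_) convex_univ (Set.mem_univ _) (Set.mem_univ _)
    rw [LinearIsometryEquiv.norm_map]
    exact hG.bound_mixed x _
  rw [hG.gradInner_innerSol hc l] at h1
  rw [hG.gradInner_innerSol hc l', sub_zero] at h2
  rw [zero_sub, inner_neg_left] at h1
  have h3 := neg_le_of_abs_le (abs_real_inner_le_norm (gradInner G l (innerSol G l'))
    (innerSol G l - innerSol G l'))
  rw [Constants.Cω, div_mul_eq_mul_div, le_div_iff₀ hc.μG]
  rcases (norm_nonneg (innerSol G l - innerSol G l')).eq_or_lt with h | h
  · rw [← h]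
    have := hc.CGwl
    simp; positivity
  · refine le_of_mul_le_mul_right ?_ h
    nlinarith

/-- Implicit differentiation of the inner solution. -/
theorem InnerAssumption.hasFDerivAt_innerSol (hc : c.Positive) (hG : InnerAssumption c G) (l : E) :
    HasFDerivAt (innerSol G)
      (-((hessInner G l (innerSol G l)).inverse.comp
        (ContinuousLinearMap.adjoint (hessMixed G l (innerSol G l))))) l := by
  obtain ⟨e, he⟩ := hG.isInvertible_hess hc l (innerSol G l)
  rw [hasFDerivAt_iff_isLittleO]
  -- As `ω_λ` is already known to be Lipschitz, the implicit function theorem is not needed: the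
  -- linearization error of `∂_ωG` between the points `(l', ω_{l'})` and `(l, ω_l)` is `o(l' - l)`,
  -- the gradient vanishes at both, and the inverse Hessian solves for `ω_{l'} - ω_l`.
  have hlip : Asymptotics.IsBigO (nhds l)
      (fun l' => ((l', innerSol G l') : E × W) - (l, innerSol G l)) (fun l' => l' - l) := by
    refine Asymptotics.IsBigO.of_bound (max 1 c.Cω) (Filter.Eventually.of_forall fun l' => ?_)
    rw [Prod.mk_sub_mk, Prod.norm_mk]
    refine max_le ?_ ?_
    · exact le_mul_of_one_le_left (norm_nonneg _) (le_max_left _ _)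
    · exact (hG.innerSol_lipschitz hc l' l).trans
        (mul_le_mul_of_nonneg_right (le_max_right _ _) (norm_nonneg _))
  have htend : Filter.Tendsto (fun l' => ((l', innerSol G l') : E × W)) (nhds l)
      (nhds (l, innerSol G l)) := by
    refine Filter.Tendsto.prodMk_nhds Filter.tendsto_id ?_
    rw [tendsto_iff_norm_sub_tendsto_zero]
    refine squeeze_zero (fun _ => norm_nonneg _) (fun l' => hG.innerSol_lipschitz hc l' l) ?_
    have : Filter.Tendsto (fun l' => c.Cω * ‖l' - l‖) (nhds l) (nhds (c.Cω * ‖l - l‖)) :=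
      Continuous.tendsto (by fun_prop) l
    simpa using this
  have h1 := ((hG.hasFDerivAt_gradInner l (innerSol G l)).isLittleO.comp_tendsto htend).trans_isBigO
    hlip
  have h2 := ((e.symm : W →L[ℝ] W).isBigO_comp
    (fun l' => (gradInner G l' (innerSol G l') - gradInner G l (innerSol G l)
      - ((ContinuousLinearMap.adjoint (hessMixed G l (innerSol G l))).coprod
        (hessInner G l (innerSol G l))) ((l', innerSol G l') - (l, innerSol G l)))) (nhds l)).trans_isLittleO h1
  refine h2.neg_left.congr_left fun l' => ?_
  rw [hG.gradInner_innerSol hc, hG.gradInner_innerSol hc, ← he, ContinuousLinearMap.inverse_equiv]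
  simp
  abel

/-- In the chain rule, symmetry of the Hessian moves its inverse from the derivative of `ω_λ` onto
`∂_ωF`, which produces `v_λ`. -/
theorem hasGradientAt_hyperObj (hc : c.Positive) (hF : OuterAssumption c F)
    (hG : InnerAssumption c G) (l : E) :
    HasGradientAt (hyperObj F G) (hyperGrad F G l (innerSol G l) (linSol F G l)) l := by
  obtain ⟨e, he⟩ := hG.isInvertible_hess hc l (innerSol G l)
  rw [hasGradientAt_iff_hasFDerivAt]
  have h := (hF.hasFDerivAt l (innerSol G l)).comp l
    ((hasFDerivAt_id l).prodMk (hG.hasFDerivAt_innerSol hc l))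
  refine h.congr_fderiv ?_
  ext u
  have h2 : inner ℝ (gradInner F l (innerSol G l)) ((hessInner G l (innerSol G l)).inverse
      (ContinuousLinearMap.adjoint (hessMixed G l (innerSol G l)) u))
      = inner ℝ (hessMixed G l (innerSol G l) (linSol F G l)) u := by
    rw [← hG.hess_linSol hc l, hG.hess_symm, ← ContinuousLinearMap.adjoint_inner_right, ← he,
      ContinuousLinearMap.inverse_equiv]
    simp
  simp [hyperGrad, h2]
  ring

end Inner

/-! ### Arithmetic of the constants and the scalar decrease inequality. -/

namespace Constants

variable {c : Constants}

theorem Positive.M_pos (hc : c.Positive) : 0 < c.M := div_pos hc.CFw hc.μG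

theorem Positive.Cω_pos (hc : c.Positive) : 0 < c.Cω := div_pos hc.CGwl hc.μG

theorem Positive.Cv_pos (hc : c.Positive) : 0 < c.Cv := by
  have := hc.Cω_pos
  have := hc.CFw
  have := hc.LGww
  have := hc.μG
  have := hc.LFw
  unfold Cv
  positivity

theorem Positive.Lf_pos (hc : c.Positive) : 0 < c.Lf := by
  have := hc.Cω_pos
  have := hc.Cv_pos
  have := hc.M_pos
  have := hc.LFl
  have := hc.LGwl
  have := hc.CGwl
  unfold Lf
  positivity

theorem Positive.Γ₁sq_pos (hc : c.Positive) : 0 < c.Γ₁sq := pow_pos hc.CGwl 2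

theorem Positive.Γ₂sq_pos (hc : c.Positive) : 0 < c.Γ₂sq := by
  have := hc.M_pos
  have := hc.LFl
  have := hc.LGwl
  unfold Γ₂sq
  positivity

theorem Positive.γv_pos (hc : c.Positive) : 0 < c.γv := by
  have := hc.Γ₁sq_pos
  have := hc.Cv_pos
  unfold γv
  positivity

theorem Positive.γω_pos (hc : c.Positive) : 0 < c.γω := by
  have := hc.Γ₂sq_pos
  have := hc.Cω_pos
  unfold γω
  positivity

theorem Positive.cη_pos (hc : c.Positive) : 0 < c.cη := by
  have := hc.Γ₂sq_pos
  have := hc.Lf_pos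
  unfold cη
  positivity

theorem Positive.cβ_pos (hc : c.Positive) : 0 < c.cβ := by
  have := hc.γv_pos
  have := hc.μG
  unfold cβ
  positivity

theorem Positive.cτ_pos (hc : c.Positive) : 0 < c.cτ := by
  have := hc.γv_pos
  have := hc.γω_pos
  have := hc.μG
  have := hc.Γ₂sq_pos
  have := hc.Γ₁sq_pos
  have := hc.cβ_pos
  have := hc.LFw
  have := hc.M_pos
  have := hc.LGww
  unfold cτ
  positivity

/-- The contraction rate of the error of `v`: the multiple of `γv` pays for the motion of `v_λ` and
the coupling with `ω`, the constant `2` for the bias of `d`. -/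
theorem Positive.cβ_mul (hc : c.Positive) : c.cβ * c.μG = 6 * c.γv + 2 := by
  have := hc.μG.ne'
  unfold cβ
  field_simp
  ring

/-- The rate for `ω` at the weight `Γ₂²`; the last summand is the reserve for the coupling of `ω`
into `v`. -/
theorem Positive.cτ_mul (hc : c.Positive) :
    c.Γ₂sq * (c.cτ * c.μG) = c.Γ₂sq * (2 * c.γω + 2)
      + 4 * c.Γ₁sq * c.cβ ^ 2 * (c.LFw ^ 2 + c.M ^ 2 * c.LGww ^ 2) / c.γv := by
  have := hc.μG.ne'
  have := hc.γv_pos.ne'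
  have := hc.Γ₂sq_pos.ne'
  unfold cτ
  field_simp

/-- Lipschitz constant in `ω` of the residual `∂_ω F - ∂_{ω²} G v` for `‖v‖ ≤ M`. -/
def resLip (c : Constants) : ℝ := c.LFw + c.M * c.LGww

/-- Lipschitz constant in `ω` of the hypergradient estimate for `‖v‖ ≤ M`. -/
def gradLip (c : Constants) : ℝ := c.LFl + c.M * c.LGwl

theorem Positive.resLip_pos (hc : c.Positive) : 0 < c.resLip := by
  have := hc.M_pos
  have := hc.LFw
  have := hc.LGww
  unfold resLip
  positivity

theorem Positive.gradLip_pos (hc : c.Positive) : 0 < c.gradLip := by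
  have := hc.M_pos
  have := hc.LFl
  have := hc.LGwl
  unfold gradLip
  positivity

theorem resLip_sq_le : c.resLip ^ 2 ≤ 2 * (c.LFw ^ 2 + c.M ^ 2 * c.LGww ^ 2) := by
  unfold resLip
  nlinarith [sq_nonneg (c.LFw - c.M * c.LGww)]

/-- Young's inequality in the form `(a + b)² ≤ 3/2 a² + 3b²`. The factor `3/4` offsets the weight
`4` which this term receives in `scalar_decrease`. -/
theorem gradLip_sq_le : c.gradLip ^ 2 ≤ 3 / 4 * c.Γ₂sq := by
  unfold gradLip Γ₂sq
  nlinarith [sq_nonneg (c.LFl - 2 * (c.M * c.LGwl))]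

/-- Step sizes for which the terms of second order are absorbed by those of first order. -/
structure SmallStep (c : Constants) (α : ℝ) : Prop where
  pos : 0 < α
  η_le : c.cη * α ≤ 1 / 2
  β_le : c.LGw * c.cβ * α ≤ 1
  ω_curv : (c.cτ ^ 2 * c.LGw ^ 2 * (1 + 1 / c.cη)
    + (4 * c.Γ₁sq * c.cβ ^ 2 * c.resLip ^ 2 * (1 + 2 / c.cη)) / c.Γ₂sq) * α
      ≤ (c.cτ * c.μG) / 5
  v_curv : (c.cβ ^ 2 * c.μG ^ 2 + 2 * c.cβ ^ 2 * c.LGw ^ 2 / c.cη) * α ≤ (c.cβ * c.μG) / 5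
  d_curv : (c.Lf / 2 + c.Γ₂sq * c.Cω ^ 2 / 2 + 2 * c.Γ₁sq * c.Cv ^ 2 + c.Γ₂sq / (2 * c.cη)) * α
    ≤ 1 / 4
  ω_rate : (18 / 5 * (c.γω + 1)) * α ≤ 1
  v_rate : (8 * c.γv + 18 / 5) * α ≤ 1

/-- Besides positivity, every condition reads `κ α ≤ ε` with `ε > 0`, so all hold on some interval
`(0, δ₀]`. Only the problem constants enter, which is the uniformity claimed for `δ₀`. -/
theorem Positive.exists_smallStep (hc : c.Positive) :
    ∃ δ₀ : ℝ, 0 < δ₀ ∧ ∀ α, 0 < α → α ≤ δ₀ → c.SmallStep α := by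
  have key : ∀ κ ε : ℝ, 0 < ε → ∀ᶠ α in nhdsWithin 0 (Set.Ioi 0), κ * α ≤ ε := fun κ ε hε => by
    have h : Filter.Tendsto (fun α => κ * α) (nhdsWithin (0 : ℝ) (Set.Ioi 0)) (nhds (κ * 0)) :=
      ((continuous_const.mul continuous_id).tendsto 0).mono_left nhdsWithin_le_nhds
    rw [mul_zero] at h
    exact (h.eventually (gt_mem_nhds hε)).mono fun _ => le_of_lt
  have hτ := mul_pos hc.cτ_pos hc.μG
  have hβ := mul_pos hc.cβ_pos hc.μG
  have hall : ∀ᶠ α in nhdsWithin 0 (Set.Ioi 0), c.SmallStep α := by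
    filter_upwards [self_mem_nhdsWithin, key c.cη (1 / 2) (by norm_num),
      key (c.LGw * c.cβ) 1 one_pos, key _ ((c.cτ * c.μG) / 5) (by positivity),
      key _ ((c.cβ * c.μG) / 5) (by positivity), key _ (1 / 4) (by norm_num),
      key _ 1 one_pos, key _ 1 one_pos] with α h0 h1 h2 h3 h4 h5 h6 h7
    exact ⟨h0, h1, h2, h3, h4, h5, h6, h7⟩
  obtain ⟨δ₀, hδ₀, h⟩ := mem_nhdsGT_iff_exists_Ioc_subset.1 hall
  exact ⟨δ₀, hδ₀, fun α h1 h2 => h ⟨h1, h2⟩⟩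

theorem SmallStep.βμ_lt_one {α : ℝ} (h : c.SmallStep α) (hc : c.Positive) :
    c.cβ * α * c.μG < 1 := by
  have h1 := h.v_rate
  have h2 := hc.cβ_mul
  have h3 := mul_pos hc.γv_pos h.pos
  have : c.cβ * α * c.μG = (c.cβ * c.μG) * α := by ring
  rw [this, h2]
  nlinarith [h.pos]

/-- Collects what depends on the distances `r`, `z` to the new targets: squared contraction factors,
the feed of `r` into `z`, and the increments of `ω` and `v` that disturb `d`. The second-order terms
consume a tenth of each first-order decrease. -/
theorem SmallStep.coupling_le {α : ℝ} (h : c.SmallStep α) (hc : c.Positive) {r z : ℝ} (hr : 0 ≤ r)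
    (hz : 0 ≤ z) :
    c.Γ₂sq / 2 * ((1 - 2 * (c.cτ * α) * c.μG + (c.cτ * α) ^ 2 * c.LGw ^ 2) * r ^ 2)
      + 2 * c.Γ₁sq * ((1 - c.cβ * α * c.μG) * z + c.cβ * α * (c.resLip * r)) ^ 2
      + (c.Γ₂sq * ((c.cτ * α) ^ 2 * (c.LGw * r) ^ 2)
        + 4 * c.Γ₁sq * ((c.cβ * α) ^ 2 * (c.LGw * z + c.resLip * r) ^ 2)) / (2 * c.cη)
      ≤ c.Γ₂sq / 2 * (1 - 18 / 5 * (c.γω + 1) * α) * r ^ 2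
        + 2 * c.Γ₁sq * (1 - (8 * c.γv + 18 / 5) * α) * z ^ 2 := by
  have hα := h.pos
  have g1 := hc.Γ₁sq_pos
  have g2 := hc.Γ₂sq_pos
  have hη := hc.cη_pos
  have hγ := hc.γv_pos
  have hβ := hc.cβ_pos
  have hμ := hc.μG
  have hP := hc.resLip_pos
  have hωc := mul_le_mul_of_nonneg_right h.ω_curv (show 0 ≤ α * (c.Γ₂sq / 2) * r ^ 2 by positivity)
  have hvc := mul_le_mul_of_nonneg_right h.v_curv (show 0 ≤ α * (2 * c.Γ₁sq) * z ^ 2 by positivity)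
  have e1 : (c.LGw * z + c.resLip * r) ^ 2 ≤ 2 * c.LGw ^ 2 * z ^ 2 + 2 * c.resLip ^ 2 * r ^ 2 := by
    nlinarith [sq_nonneg (c.LGw * z - c.resLip * r)]
  have e2 : 4 * c.Γ₁sq * ((c.cβ * α) ^ 2 * (c.LGw * z + c.resLip * r) ^ 2) / (2 * c.cη)
      ≤ 4 * c.Γ₁sq * ((c.cβ * α) ^ 2 * (2 * c.LGw ^ 2 * z ^ 2 + 2 * c.resLip ^ 2 * r ^ 2))
        / (2 * c.cη) := by gcongr
  have e3 : 0 ≤ 4 * c.Γ₁sq * (c.cβ * α * c.μG) * (c.cβ * α * c.resLip) * (z * r) := by positivity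
  -- Young's inequality weighted by `γv`: the `z²` part is covered by the rate of `v`, the `r²` part
  -- by the reserve in `cτ`.
  have e4 : 4 * c.Γ₁sq * c.cβ * c.resLip * (z * r) ≤ 4 * c.Γ₁sq * c.γv * z ^ 2
      + (c.Γ₁sq * c.cβ ^ 2 / c.γv) * c.resLip ^ 2 * r ^ 2 := by
    have : 0 ≤ c.Γ₁sq / c.γv * (2 * c.γv * z - c.cβ * c.resLip * r) ^ 2 := by positivity
    have e : c.Γ₁sq / c.γv * (2 * c.γv * z - c.cβ * c.resLip * r) ^ 2
        = 4 * c.Γ₁sq * c.γv * z ^ 2 + (c.Γ₁sq * c.cβ ^ 2 / c.γv) * c.resLip ^ 2 * r ^ 2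
          - 4 * c.Γ₁sq * c.cβ * c.resLip * (z * r) := by
      field_simp
      ring
    linarith
  have e5 : (c.Γ₁sq * c.cβ ^ 2 / c.γv) * c.resLip ^ 2 * r ^ 2
      ≤ (c.Γ₁sq * c.cβ ^ 2 / c.γv) * (2 * (c.LFw ^ 2 + c.M ^ 2 * c.LGww ^ 2)) * r ^ 2 := by
    have := c.resLip_sq_le
    gcongr
  have e45 := mul_le_mul_of_nonneg_left (e4.trans (add_le_add_right e5 _)) hα.le
  -- What remains is nine tenths. It gives `9/5 (γω + 1) = 1/2 · 18/5 (γω + 1)` for `ω`. For `v` it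
  -- gives `9/5 (6γv + 2)`, of which the coupling takes `2γv`, leaving at least `8γv + 18/5`.
  have hτ := congrArg (fun t => t * (9 / 10 * α * r ^ 2)) hc.cτ_mul
  have hβm := congrArg (fun t => t * (2 * c.Γ₁sq * (9 / 5) * α * z ^ 2)) hc.cβ_mul
  beta_reduce at hτ hβm
  have e6 : 0 ≤ (c.Γ₁sq * c.cβ ^ 2 / c.γv) * (c.LFw ^ 2 + c.M ^ 2 * c.LGww ^ 2) * r ^ 2 * α := by
    positivity
  have e7 : 0 ≤ c.Γ₁sq * c.γv * z ^ 2 * α := by positivity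
  have id1 : (c.cτ ^ 2 * c.LGw ^ 2 * (1 + 1 / c.cη)
    + (4 * c.Γ₁sq * c.cβ ^ 2 * c.resLip ^ 2 * (1 + 2 / c.cη)) / c.Γ₂sq) * α
      * (α * (c.Γ₂sq / 2) * r ^ 2) = c.Γ₂sq / 2 * (c.cτ * α) ^ 2 * c.LGw ^ 2 * r ^ 2
      + c.Γ₂sq * ((c.cτ * α) ^ 2 * (c.LGw * r) ^ 2) / (2 * c.cη)
      + 2 * c.Γ₁sq * (c.cβ * α * (c.resLip * r)) ^ 2
      + 4 * c.Γ₁sq * ((c.cβ * α) ^ 2 * (2 * c.resLip ^ 2 * r ^ 2)) / (2 * c.cη) := by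
    field_simp
    ring
  have id2 : (c.cβ ^ 2 * c.μG ^ 2 + 2 * c.cβ ^ 2 * c.LGw ^ 2 / c.cη) * α
      * (α * (2 * c.Γ₁sq) * z ^ 2) = 2 * c.Γ₁sq * (c.cβ * α * c.μG) ^ 2 * z ^ 2
      + 4 * c.Γ₁sq * ((c.cβ * α) ^ 2 * (2 * c.LGw ^ 2 * z ^ 2)) / (2 * c.cη) := by
    field_simp
    ring
  have id3 : 4 * c.Γ₁sq * ((c.cβ * α) ^ 2 * (2 * c.LGw ^ 2 * z ^ 2 + 2 * c.resLip ^ 2 * r ^ 2))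
        / (2 * c.cη) = 4 * c.Γ₁sq * ((c.cβ * α) ^ 2 * (2 * c.LGw ^ 2 * z ^ 2)) / (2 * c.cη)
        + 4 * c.Γ₁sq * ((c.cβ * α) ^ 2 * (2 * c.resLip ^ 2 * r ^ 2)) / (2 * c.cη) := by ring
  have id4 : 4 * c.Γ₁sq * c.cβ ^ 2 * (c.LFw ^ 2 + c.M ^ 2 * c.LGww ^ 2) / c.γv
      = 4 * ((c.Γ₁sq * c.cβ ^ 2 / c.γv) * (c.LFw ^ 2 + c.M ^ 2 * c.LGww ^ 2)) := by ring
  rw [id4] at hτ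
  rw [id1] at hωc
  rw [id2] at hvc
  rw [id3] at e2
  rw [add_div]
  linarith

/-- The scalar inequality behind the decrease of the potential. -/
theorem SmallStep.scalar_decrease {α : ℝ} (h : c.SmallStep α) (hc : c.Positive)
    {x y e u r z : ℝ} (hx : 0 ≤ x) (hy : 0 ≤ y) (hu : 0 ≤ u) (hr : 0 ≤ r) (hz : 0 ≤ z)
    (hrx : r ≤ x + c.Cω * (α * u)) (hzy : z ≤ y + c.Cv * (α * u)) :
    -(α / 2) * u ^ 2 + c.Lf / 2 * (α * u) ^ 2 + α / 2 * (c.gradLip * x + c.CGwl * y + e) ^ 2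
      + c.Γ₂sq / 2 * ((1 - 2 * (c.cτ * α) * c.μG + (c.cτ * α) ^ 2 * c.LGw ^ 2) * r ^ 2)
      + 2 * c.Γ₁sq * ((1 - c.cβ * α * c.μG) * z + c.cβ * α * (c.resLip * r)) ^ 2
      + ((1 - c.cη * α) ^ 2 * e ^ 2 + c.Γ₂sq * ((α * u) ^ 2 + (c.cτ * α) ^ 2 * (c.LGw * r) ^ 2)
        + 4 * c.Γ₁sq * ((c.cβ * α) ^ 2 * (c.LGw * z + c.resLip * r) ^ 2)) / (2 * c.cη)
      ≤ c.Γ₂sq / 2 * x ^ 2 + 2 * c.Γ₁sq * y ^ 2 + e ^ 2 / (2 * c.cη) := by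
  -- The weight `3/2` on `e²` is forced: after multiplication by `α/2` it equals the decrease `3/4 α
  -- e²` obtained in `he`.
  have hquad : ∀ A B e : ℝ, (A + B + e) ^ 2 ≤ 3 / 2 * e ^ 2 + 4 * A ^ 2 + 12 * B ^ 2 :=
    fun A B e => by nlinarith [sq_nonneg (e - 2 * (A + B)), sq_nonneg (A - 3 * B)]
  have hα := h.pos
  have g1 := hc.Γ₁sq_pos
  have g2 := hc.Γ₂sq_pos
  have hη := hc.cη_pos
  have hγ := hc.γv_pos
  have hγω := hc.γω_pos
  have hcω := hc.Cω_pos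
  have hcv := hc.Cv_pos
  have hcoup := h.coupling_le hc hr hz
  have hω1 : (1 - 18 / 5 * (c.γω + 1) * α) * r ^ 2 ≤ x ^ 2 - 18 / 5 * (c.γω + 1) * α * x ^ 2
      + 2 * (c.Cω * (α * u)) * x + (c.Cω * (α * u)) ^ 2 := by
    have h0 : 0 ≤ 1 - 18 / 5 * (c.γω + 1) * α := by linarith [h.ω_rate]
    have h1 : r ^ 2 ≤ (x + c.Cω * (α * u)) ^ 2 := pow_le_pow_left₀ hr hrx 2
    have h2 : 0 ≤ 18 / 5 * (c.γω + 1) * α * (2 * (c.Cω * (α * u)) * x + (c.Cω * (α * u)) ^ 2) := by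
      positivity
    linarith only [mul_le_mul_of_nonneg_left h1 h0, h2]
  have hv1 : (1 - (8 * c.γv + 18 / 5) * α) * z ^ 2 ≤ y ^ 2 - (8 * c.γv + 18 / 5) * α * y ^ 2
      + 2 * (c.Cv * (α * u)) * y + (c.Cv * (α * u)) ^ 2 := by
    have h0 : 0 ≤ 1 - (8 * c.γv + 18 / 5) * α := by linarith [h.v_rate]
    have h1 : z ^ 2 ≤ (y + c.Cv * (α * u)) ^ 2 := pow_le_pow_left₀ hz hzy 2
    have h2 : 0 ≤ (8 * c.γv + 18 / 5) * α * (2 * (c.Cv * (α * u)) * y + (c.Cv * (α * u)) ^ 2) := by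
      positivity
    linarith only [mul_le_mul_of_nonneg_left h1 h0, h2]
  have hω2 := mul_le_mul_of_nonneg_left hω1 (show 0 ≤ c.Γ₂sq / 2 by positivity)
  have hv2 := mul_le_mul_of_nonneg_left hv1 (show 0 ≤ 2 * c.Γ₁sq by positivity)
  -- The gain `α/2 u²` is shared out as `1/8` here, `1/8` in `hv3` and `1/4` for the second-order
  -- terms in `hd`. The definitions of `γω` and `γv` are exactly what Young's inequality needs for
  -- these shares.
  have hω3 : α * (c.Γ₂sq * c.Cω * (x * u)) ≤ α * (u ^ 2 / 8 + c.Γ₂sq * c.γω / 4 * x ^ 2) := by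
    refine mul_le_mul_of_nonneg_left ?_ hα.le
    unfold γω
    linarith only [sq_nonneg (u - 4 * c.Γ₂sq * c.Cω * x)]
  have hv3 : α * (4 * c.Γ₁sq * c.Cv * (y * u)) ≤ α * (u ^ 2 / 8 + c.Γ₁sq * c.γv * y ^ 2) := by
    refine mul_le_mul_of_nonneg_left ?_ hα.le
    unfold γv
    linarith only [sq_nonneg (u - 16 * c.Γ₁sq * c.Cv * y)]
  have hp : (c.gradLip * x + c.CGwl * y + e) ^ 2
      ≤ 3 / 2 * e ^ 2 + 3 * c.Γ₂sq * x ^ 2 + 12 * c.Γ₁sq * y ^ 2 := by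
    have h1 : c.gradLip ^ 2 * x ^ 2 ≤ 3 / 4 * c.Γ₂sq * x ^ 2 :=
      mul_le_mul_of_nonneg_right c.gradLip_sq_le (sq_nonneg x)
    have h2 : c.Γ₁sq * y ^ 2 = (c.CGwl * y) ^ 2 := by unfold Γ₁sq; ring
    have h3 := hquad (c.gradLip * x) (c.CGwl * y) e
    rw [mul_pow c.gradLip] at h3
    linarith only [h1, h2, h3]
  have hp2 := mul_le_mul_of_nonneg_left hp (show 0 ≤ α / 2 by positivity)
  have hd := mul_le_mul_of_nonneg_right h.d_curv (show 0 ≤ α * u ^ 2 by positivity)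
  have hd' : (c.Lf / 2 + c.Γ₂sq * c.Cω ^ 2 / 2 + 2 * c.Γ₁sq * c.Cv ^ 2 + c.Γ₂sq / (2 * c.cη)) * α
      * (α * u ^ 2) = c.Lf / 2 * (α * u) ^ 2 + c.Γ₂sq / 2 * (c.Cω * (α * u)) ^ 2
        + 2 * c.Γ₁sq * (c.Cv * (α * u)) ^ 2 + c.Γ₂sq * (α * u) ^ 2 / (2 * c.cη) := by ring
  rw [hd'] at hd
  have he : (1 - c.cη * α) ^ 2 * e ^ 2 / (2 * c.cη) ≤ e ^ 2 / (2 * c.cη) - 3 / 4 * α * e ^ 2 := by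
    have h1 : (1 - c.cη * α) ^ 2 * e ^ 2 / (2 * c.cη)
        = e ^ 2 / (2 * c.cη) - α * e ^ 2 + c.cη * α * (α * e ^ 2 / 2) := by
      field_simp
      ring
    have h2 := mul_le_mul_of_nonneg_right h.η_le (show 0 ≤ α * e ^ 2 / 2 by positivity)
    rw [h1]
    linarith
  have hsplit : ((1 - c.cη * α) ^ 2 * e ^ 2
        + c.Γ₂sq * ((α * u) ^ 2 + (c.cτ * α) ^ 2 * (c.LGw * r) ^ 2)
        + 4 * c.Γ₁sq * ((c.cβ * α) ^ 2 * (c.LGw * z + c.resLip * r) ^ 2)) / (2 * c.cη)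
      = (1 - c.cη * α) ^ 2 * e ^ 2 / (2 * c.cη) + c.Γ₂sq * (α * u) ^ 2 / (2 * c.cη)
        + (c.Γ₂sq * ((c.cτ * α) ^ 2 * (c.LGw * r) ^ 2)
        + 4 * c.Γ₁sq * ((c.cβ * α) ^ 2 * (c.LGw * z + c.resLip * r) ^ 2)) / (2 * c.cη) := by
    ring
  rw [hsplit]
  have p1 : 0 ≤ α * c.Γ₂sq * x ^ 2 := by positivity
  have p2 : 0 ≤ α * c.Γ₂sq * c.γω * x ^ 2 := by positivity
  have p3 : 0 ≤ α * c.Γ₁sq * y ^ 2 := by positivity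
  have p4 : 0 ≤ α * c.Γ₁sq * c.γv * y ^ 2 := by positivity
  linarith

end Constants

/-! ### Lipschitz estimates for the hyper-gradient and the noiseless decrease. -/

section Decrease

variable {E W : Type*}
  [NormedAddCommGroup E] [InnerProductSpace ℝ E] [CompleteSpace E]
  [NormedAddCommGroup W] [InnerProductSpace ℝ W] [CompleteSpace W]
  {c : Constants} {F G : E → W → ℝ}

/-- The residual `∂_ω F - ∂_{ω²} G v` of the linear system for `v_λ`. -/
def residual (F G : E → W → ℝ) (l : E) (w v : W) : W :=
  gradInner F l w - hessInner G l w v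

/-- The Lyapunov function: the potential with half of the weight on the three error terms. -/
def lyapunov (c : Constants) (F G : E → W → ℝ) (s : State E W) : ℝ :=
  hyperObj F G s.lam + c.Γ₂sq / 2 * ‖s.om - innerSol G s.lam‖ ^ 2
    + 2 * c.Γ₁sq * ‖s.v - linSol F G s.lam‖ ^ 2
    + ‖hyperGrad F G s.lam s.om s.v - s.d‖ ^ 2 / (2 * c.cη)

theorem lyapunov_le_potential (hc : c.Positive) (s : State E W) :
    lyapunov c F G s ≤ potential c F G s := by
  have h1 := hc.Γ₁sq_pos
  have h2 := hc.Γ₂sq_pos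
  have h3 := hc.cη_pos
  have h4 : 0 ≤ ‖hyperGrad F G s.lam s.om s.v - s.d‖ ^ 2 / c.cη := by positivity
  have h5 : ‖hyperGrad F G s.lam s.om s.v - s.d‖ ^ 2 / (2 * c.cη)
      = ‖hyperGrad F G s.lam s.om s.v - s.d‖ ^ 2 / c.cη / 2 := by field_simp
  have h6 : 0 ≤ c.Γ₂sq * ‖s.om - innerSol G s.lam‖ ^ 2 := by positivity
  have h7 : 0 ≤ c.Γ₁sq * ‖s.v - linSol F G s.lam‖ ^ 2 := by positivity
  rw [lyapunov, potential, h5]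
  linarith

theorem hyperObj_le_lyapunov (hc : c.Positive) (s : State E W) :
    hyperObj F G s.lam ≤ lyapunov c F G s := by
  have h1 := hc.Γ₁sq_pos
  have h2 := hc.Γ₂sq_pos
  have h3 := hc.cη_pos
  have h4 : 0 ≤ ‖hyperGrad F G s.lam s.om s.v - s.d‖ ^ 2 / (2 * c.cη) := by positivity
  have h6 : 0 ≤ c.Γ₂sq / 2 * ‖s.om - innerSol G s.lam‖ ^ 2 := by positivity
  have h7 : 0 ≤ 2 * c.Γ₁sq * ‖s.v - linSol F G s.lam‖ ^ 2 := by positivity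
  rw [lyapunov]
  linarith

theorem sqrt_add_sq_le {a b C : ℝ} (ha : 0 ≤ a) (hb : 0 ≤ b) (hC : 0 ≤ C) (h : b ≤ C * a) :
    √(a ^ 2 + b ^ 2) ≤ (1 + C) * a := by
  rw [Real.sqrt_le_left (by positivity)]
  nlinarith [mul_nonneg hC ha]

/-- The product `∂_{ωλ}G v` is split so that the change of the operator acts on `v'` and the change
of the vector meets the bounded operator. Hence only `v'` has to be bounded by `M`. -/
theorem norm_hyperGrad_sub_le (hc : c.Positive) (hF : OuterAssumption c F)
    (hG : InnerAssumption c G) (l l' : E) (w w' : W) (v : W) {v' : W} (hv' : ‖v'‖ ≤ c.M) :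
    ‖hyperGrad F G l w v - hyperGrad F G l' w' v'‖
      ≤ c.gradLip * √(‖l - l'‖ ^ 2 + ‖w - w'‖ ^ 2) + c.CGwl * ‖v - v'‖ := by
  have e : hyperGrad F G l w v - hyperGrad F G l' w' v' = (gradOuter F l w - gradOuter F l' w')
      - (hessMixed G l w - hessMixed G l' w') v' - hessMixed G l w (v - v') := by
    simp only [hyperGrad, sub_apply, map_sub]
    abel
  have h1 := hF.lipschitz_outer l l' w w'
  have h2 := (hessMixed G l w - hessMixed G l' w').le_of_opNorm_le (hG.lipschitz_mixed l l' w w') v'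
  have h3 := (hessMixed G l w).le_of_opNorm_le (hG.bound_mixed l w) (v - v')
  have h4 : c.LGwl * √(‖l - l'‖ ^ 2 + ‖w - w'‖ ^ 2) * ‖v'‖
      ≤ c.LGwl * √(‖l - l'‖ ^ 2 + ‖w - w'‖ ^ 2) * c.M :=
    mul_le_mul_of_nonneg_left hv' (mul_nonneg hc.LGwl.le (Real.sqrt_nonneg _))
  rw [e, Constants.gradLip]
  have h5 := norm_sub_le ((gradOuter F l w - gradOuter F l' w')
      - (hessMixed G l w - hessMixed G l' w') v') (hessMixed G l w (v - v'))
  have h6 := norm_sub_le (gradOuter F l w - gradOuter F l' w')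
    ((hessMixed G l w - hessMixed G l' w') v')
  linarith

theorem norm_hyperGrad_le (hF : OuterAssumption c F)
    (hG : InnerAssumption c G) (l : E) (w : W) {v : W} (hv : ‖v‖ ≤ c.M) :
    ‖hyperGrad F G l w v‖ ≤ c.CFl + c.CGwl * c.M := by
  have h3 := (hessMixed G l w).le_of_opNorm_le_of_le (hG.bound_mixed l w) hv
  exact (norm_sub_le _ _).trans (add_le_add (hF.bound_outer l w) h3)

/-- The difference of the residual at `(l, w, v)` from its value `0` at `(l', w', v')`, freed of
the contribution of `v - v'`. -/
theorem norm_residual_add_le (hc : c.Positive) (hF : OuterAssumption c F)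
    (hG : InnerAssumption c G) {l l' : E} {w w' : W} (v : W) {v' : W} (hv' : ‖v'‖ ≤ c.M)
    (h0 : hessInner G l' w' v' = gradInner F l' w') :
    ‖residual F G l w v + hessInner G l w (v - v')‖
      ≤ c.resLip * √(‖l - l'‖ ^ 2 + ‖w - w'‖ ^ 2) := by
  have e : residual F G l w v + hessInner G l w (v - v') = (gradInner F l w - gradInner F l' w')
      - (hessInner G l w - hessInner G l' w') v' := by
    simp only [residual, sub_apply, map_sub, h0]
    abel
  have h1 := hF.lipschitz_inner l l' w w'
  have h2 := (hessInner G l w - hessInner G l' w').le_of_opNorm_le (hG.lipschitz_hess l l' w w') v'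
  have h4 : c.LGww * √(‖l - l'‖ ^ 2 + ‖w - w'‖ ^ 2) * ‖v'‖
      ≤ c.LGww * √(‖l - l'‖ ^ 2 + ‖w - w'‖ ^ 2) * c.M :=
    mul_le_mul_of_nonneg_left hv' (mul_nonneg hc.LGww.le (Real.sqrt_nonneg _))
  rw [e, Constants.resLip]
  refine (norm_sub_le _ _).trans ?_
  linarith

/-- The ball of radius `M` is invariant because `(1 - βμ)M + βC_{F,ω} = M`. -/
theorem norm_add_residual_le (hc : c.Positive) (hF : OuterAssumption c F)
    (hG : InnerAssumption c G) {β : ℝ} (hβ : 0 ≤ β) (hβL : β * c.LGw ≤ 1) (hβμ : β * c.μG < 1)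
    (l : E) (w : W) {v : W} (hv : ‖v‖ ≤ c.M) : ‖v + β • residual F G l w v‖ ≤ c.M := by
  have e : v + β • residual F G l w v = (v - β • hessInner G l w v) + β • gradInner F l w := by
    rw [residual, smul_sub]
    abel
  have h1 := hG.norm_sub_smul_hess_le hc hβ hβL hβμ l w v
  have h2 : ‖β • gradInner F l w‖ ≤ β * c.CFw := by
    rw [norm_smul, Real.norm_of_nonneg hβ]
    exact mul_le_mul_of_nonneg_left (hF.bound_inner l w) hβ
  have h3 : c.CFw = c.μG * c.M := by
    rw [Constants.M, mul_div_cancel₀ _ hc.μG.ne']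
  have h4 : (1 - β * c.μG) * ‖v‖ ≤ (1 - β * c.μG) * c.M :=
    mul_le_mul_of_nonneg_left hv (by linarith)
  rw [e]
  refine (norm_add_le _ _).trans ?_
  rw [h3] at h2
  linarith

variable [FiniteDimensional ℝ W]

/-- The residual at `(l, ω_l, v_l)` vanishes, so the residual estimate bounds `∂_{ω²}G (v_l -
v_{l'})` itself; the Hessian is bounded below by `μ`, and `μ C_v = resLip (1 + C_ω)`. -/
theorem norm_linSol_sub_le (hc : c.Positive) (hF : OuterAssumption c F) (hG : InnerAssumption c G)
    (l l' : E) : ‖linSol F G l - linSol F G l'‖ ≤ c.Cv * ‖l - l'‖ := by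
  have h1 := norm_residual_add_le hc hF hG (l := l) (w := innerSol G l) (linSol F G l)
    (norm_linSol_le hc hF hG l') (hG.hess_linSol hc l')
  rw [residual, hG.hess_linSol hc l, sub_self, zero_add] at h1
  have h2 := hG.le_norm_hess l (innerSol G l) (linSol F G l - linSol F G l')
  have h3 := sqrt_add_sq_le (norm_nonneg (l - l')) (norm_nonneg _) hc.Cω_pos.le
    (hG.innerSol_lipschitz hc l l')
  have h4 := (h2.trans h1).trans (mul_le_mul_of_nonneg_left h3 hc.resLip_pos.le)
  have h5 : c.μG * c.Cv = c.resLip * (1 + c.Cω) := by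
    have := hc.μG.ne'
    rw [Constants.Cv, Constants.resLip, Constants.M]
    field_simp
    ring
  refine le_of_mul_le_mul_left ?_ hc.μG
  rw [← mul_assoc, h5]
  linarith

theorem gradient_hyperObj (hc : c.Positive) (hF : OuterAssumption c F) (hG : InnerAssumption c G)
    (l : E) : gradient (hyperObj F G) l = hyperGrad F G l (innerSol G l) (linSol F G l) :=
  (hasGradientAt_hyperObj hc hF hG l).gradient

theorem norm_gradient_hyperObj_sub_le (hc : c.Positive) (hF : OuterAssumption c F)
    (hG : InnerAssumption c G) (l l' : E) :
    ‖gradient (hyperObj F G) l - gradient (hyperObj F G) l'‖ ≤ c.Lf * ‖l - l'‖ := by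
  rw [gradient_hyperObj hc hF hG, gradient_hyperObj hc hF hG]
  refine (norm_hyperGrad_sub_le hc hF hG _ _ _ _ _ (norm_linSol_le hc hF hG l')).trans ?_
  have h3 := mul_le_mul_of_nonneg_left (sqrt_add_sq_le (norm_nonneg (l - l')) (norm_nonneg _)
    hc.Cω_pos.le (hG.innerSol_lipschitz hc l l')) hc.gradLip_pos.le
  have h4 := mul_le_mul_of_nonneg_left (norm_linSol_sub_le hc hF hG l l') hc.CGwl.le
  rw [Constants.Lf]
  rw [Constants.gradLip] at h3 ⊢
  linarith

theorem norm_gradient_hyperObj_le (hc : c.Positive) (hF : OuterAssumption c F)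
    (hG : InnerAssumption c G) (l : E) :
    ‖gradient (hyperObj F G) l‖ ≤ c.CFl + c.CGwl * c.M := by
  rw [gradient_hyperObj hc hF hG]
  exact norm_hyperGrad_le hF hG _ _ (norm_linSol_le hc hF hG l)

theorem norm_hyperObj_sub_le (hc : c.Positive) (hF : OuterAssumption c F)
    (hG : InnerAssumption c G) (l l' : E) :
    ‖hyperObj F G l - hyperObj F G l'‖ ≤ (c.CFl + c.CGwl * c.M) * ‖l - l'‖ := by
  refine Convex.norm_image_sub_le_of_norm_hasFDerivWithin_le (s := Set.univ)
    (fun x _ => (hasGradientAt_hyperObj hc hF hG x).hasFDerivAt.hasFDerivWithinAt)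
    (fun x _ => ?_) convex_univ (Set.mem_univ _) (Set.mem_univ _)
  rw [LinearIsometryEquiv.norm_map, ← gradient_hyperObj hc hF hG]
  exact norm_gradient_hyperObj_le hc hF hG x

theorem InnerAssumption.norm_gradInner_le (hc : c.Positive) (hG : InnerAssumption c G)
    (l : E) (w : W) : ‖gradInner G l w‖ ≤ c.LGw * ‖w - innerSol G l‖ := by
  have := hG.lipschitz_grad.norm_sub_right_le l w (innerSol G l)
  rwa [hG.gradInner_innerSol hc, sub_zero] at this

theorem InnerAssumption.norm_gradStep_sq_le (hc : c.Positive) (hG : InnerAssumption c G)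
    {τ : ℝ} (hτ : 0 ≤ τ) (l : E) (w : W) :
    ‖w - τ • gradInner G l w - innerSol G l‖ ^ 2
      ≤ (1 - 2 * τ * c.μG + τ ^ 2 * c.LGw ^ 2) * ‖w - innerSol G l‖ ^ 2 := by
  have h1 := hG.monotone l w (innerSol G l)
  rw [hG.gradInner_innerSol hc, sub_zero, real_inner_comm] at h1
  have h2 := pow_le_pow_left₀ (norm_nonneg _) (hG.norm_gradInner_le hc l w) 2
  rw [sub_right_comm, norm_sub_sq_real, real_inner_smul_right, norm_smul, mul_pow,
    Real.norm_of_nonneg hτ]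
  nlinarith [mul_le_mul_of_nonneg_left h1 hτ, mul_le_mul_of_nonneg_left h2 (sq_nonneg τ)]

/-- The decrease of the Lyapunov function along the noiseless iteration. The error of `d` enters
with the increments of `λ`, `ω` and `v`. -/
theorem mean_decrease (hc : c.Positive) (hF : OuterAssumption c F) (hG : InnerAssumption c G)
    {α : ℝ} (hα : c.SmallStep α) (l d : E) (w : W) {v : W} (hv : ‖v‖ ≤ c.M) :
    hyperObj F G (l - α • d)
      + c.Γ₂sq / 2 * ‖w - (c.cτ * α) • gradInner G (l - α • d) w - innerSol G (l - α • d)‖ ^ 2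
      + 2 * c.Γ₁sq
        * ‖v + (c.cβ * α) • residual F G (l - α • d) w v - linSol F G (l - α • d)‖ ^ 2
      + ((1 - c.cη * α) ^ 2 * ‖hyperGrad F G l w v - d‖ ^ 2
        + c.Γ₂sq * (‖α • d‖ ^ 2 + (c.cτ * α) ^ 2 * ‖gradInner G (l - α • d) w‖ ^ 2)
        + 4 * c.Γ₁sq * ((c.cβ * α) ^ 2 * ‖residual F G (l - α • d) w v‖ ^ 2)) / (2 * c.cη)
      ≤ lyapunov c F G ⟨l, w, v, d⟩ - α / 2 * ‖gradient (hyperObj F G) l‖ ^ 2 := by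
  have hα0 := hα.pos
  have g1 := hc.Γ₁sq_pos
  have g2 := hc.Γ₂sq_pos
  have hη := hc.cη_pos
  have hτ : 0 ≤ c.cτ * α := (mul_pos hc.cτ_pos hα0).le
  have hβ : 0 ≤ c.cβ * α := (mul_pos hc.cβ_pos hα0).le
  set l' := l - α • d with hl'
  have hll : ‖l - l'‖ = α * ‖d‖ := by
    rw [hl', sub_sub_cancel, norm_smul, Real.norm_of_nonneg hα0.le]
  set r := ‖w - innerSol G l'‖ with hr
  set z := ‖v - linSol F G l'‖ with hz
  have hrx : r ≤ ‖w - innerSol G l‖ + c.Cω * (α * ‖d‖) := by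
    have h1 := hG.innerSol_lipschitz hc l l'
    rw [hll] at h1
    exact (norm_sub_le_norm_sub_add_norm_sub w (innerSol G l) (innerSol G l')).trans (by gcongr)
  have hzy : z ≤ ‖v - linSol F G l‖ + c.Cv * (α * ‖d‖) := by
    have h1 := norm_linSol_sub_le hc hF hG l l'
    rw [hll] at h1
    exact (norm_sub_le_norm_sub_add_norm_sub v (linSol F G l) (linSol F G l')).trans (by gcongr)
  have hscal := hα.scalar_decrease hc (norm_nonneg (w - innerSol G l))
    (norm_nonneg (v - linSol F G l)) (e := ‖hyperGrad F G l w v - d‖) (norm_nonneg d)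
    (norm_nonneg _) (norm_nonneg _) hrx hzy
  have hω := hG.norm_gradStep_sq_le hc hτ l' w
  have hgr := pow_le_pow_left₀ (norm_nonneg _) (hG.norm_gradInner_le hc l' w) 2
  have hres := norm_residual_add_le hc hF hG (l := l') (w := w) v (norm_linSol_le hc hF hG l')
    (hG.hess_linSol hc l')
  simp only [sub_self, norm_zero, ne_eq, OfNat.ofNat_ne_zero, not_false_eq_true, zero_pow,
    zero_add, Real.sqrt_sq (norm_nonneg _)] at hres
  have hv1 : ‖v + (c.cβ * α) • residual F G l' w v - linSol F G l'‖
      ≤ (1 - c.cβ * α * c.μG) * z + c.cβ * α * (c.resLip * r) := by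
    -- The step is split into a contraction of `v - v_{l'}` and an error due only to `w ≠ ω_{l'}`,
    -- the latter linear in `r`.
    have e : v + (c.cβ * α) • residual F G l' w v - linSol F G l'
        = ((v - linSol F G l') - (c.cβ * α) • hessInner G l' w (v - linSol F G l'))
          + (c.cβ * α) • (residual F G l' w v + hessInner G l' w (v - linSol F G l')) := by
      rw [smul_add]
      abel
    rw [e]
    refine (norm_add_le _ _).trans (add_le_add ?_ ?_)
    · exact hG.norm_sub_smul_hess_le hc hβ (by linarith [hα.β_le]) (hα.βμ_lt_one hc) l' w _
    · rw [norm_smul, Real.norm_of_nonneg hβ]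
      exact mul_le_mul_of_nonneg_left hres hβ
  have hv2 := pow_le_pow_left₀ (norm_nonneg _) hv1 2
  have hR1 : ‖residual F G l' w v‖ ≤ c.LGw * z + c.resLip * r := by
    have h1 := (hessInner G l' w).le_of_opNorm_le (hG.norm_hess_le hc l' w) (v - linSol F G l')
    have h2 := norm_sub_le (residual F G l' w v + hessInner G l' w (v - linSol F G l'))
      (hessInner G l' w (v - linSol F G l'))
    rw [add_sub_cancel_right] at h2
    linarith
  have hR2 := pow_le_pow_left₀ (norm_nonneg _) hR1 2
  have hbias : ‖gradient (hyperObj F G) l - d‖ ≤ c.gradLip * ‖w - innerSol G l‖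
      + c.CGwl * ‖v - linSol F G l‖ + ‖hyperGrad F G l w v - d‖ := by
    have h1 := norm_hyperGrad_sub_le hc hF hG l l (innerSol G l) w (linSol F G l) hv
    simp only [sub_self, norm_zero, ne_eq, OfNat.ofNat_ne_zero, not_false_eq_true, zero_pow,
      zero_add, Real.sqrt_sq (norm_nonneg _)] at h1
    rw [norm_sub_rev (innerSol G l), norm_sub_rev (linSol F G l)] at h1
    have h2 := norm_sub_le_norm_sub_add_norm_sub
      (hyperGrad F G l (innerSol G l) (linSol F G l)) (hyperGrad F G l w v) d
    rw [gradient_hyperObj hc hF hG]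
    linarith
  have hbias2 := mul_le_mul_of_nonneg_left (pow_le_pow_left₀ (norm_nonneg _) hbias 2)
    (show 0 ≤ α / 2 by positivity)
  -- Polarization turns `-α⟨∇f, d⟩` into the two gains and the price `α/2 ‖∇f - d‖²`.
  have hdesc : hyperObj F G l' ≤ hyperObj F G l - α / 2 * ‖gradient (hyperObj F G) l‖ ^ 2
      + α / 2 * ‖gradient (hyperObj F G) l - d‖ ^ 2 - α / 2 * ‖d‖ ^ 2
      + c.Lf / 2 * (α * ‖d‖) ^ 2 := by
    have h1 := le_quadratic_of_lipschitz_gradient (f := hyperObj F G)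
      (g := gradient (hyperObj F G)) (L := c.Lf)
      (fun x => (hasGradientAt_hyperObj hc hF hG x).differentiableAt.hasGradientAt)
      (norm_gradient_hyperObj_sub_le hc hF hG) l l'
    rw [norm_sub_rev, hll, ← neg_sub l l', hl', sub_sub_cancel, inner_neg_right,
      real_inner_smul_right, ← hl'] at h1
    rw [norm_sub_sq_real (gradient (hyperObj F G) l) d]
    linarith
  have hω' := mul_le_mul_of_nonneg_left hω (show 0 ≤ c.Γ₂sq / 2 by positivity)
  have hv' := mul_le_mul_of_nonneg_left hv2 (show 0 ≤ 2 * c.Γ₁sq by positivity)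
  have hlast : ((1 - c.cη * α) ^ 2 * ‖hyperGrad F G l w v - d‖ ^ 2
        + c.Γ₂sq * (‖α • d‖ ^ 2 + (c.cτ * α) ^ 2 * ‖gradInner G l' w‖ ^ 2)
        + 4 * c.Γ₁sq * ((c.cβ * α) ^ 2 * ‖residual F G l' w v‖ ^ 2)) / (2 * c.cη)
      ≤ ((1 - c.cη * α) ^ 2 * ‖hyperGrad F G l w v - d‖ ^ 2
        + c.Γ₂sq * ((α * ‖d‖) ^ 2 + (c.cτ * α) ^ 2 * (c.LGw * r) ^ 2)
        + 4 * c.Γ₁sq * ((c.cβ * α) ^ 2 * (c.LGw * z + c.resLip * r) ^ 2)) / (2 * c.cη) := by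
    rw [norm_smul, Real.norm_of_nonneg hα0.le]
    gcongr
  simp only [lyapunov]
  linarith

end Decrease

/-! ### Independence of one sample from all others. -/

section Independence

variable {Ω : Type*} [mΩ : MeasurableSpace Ω] {P : Measure Ω} [IsProbabilityMeasure P]

/-- If `f` is independent of `(g, h)` and `g` of `h`, then `(f, g)` is independent of `h`. -/
theorem indepFun_prodMk_of_indepFun {α β γ : Type*} [MeasurableSpace α] [MeasurableSpace β]
    [MeasurableSpace γ] {f : Ω → α} {g : Ω → β} {h : Ω → γ} (hf : Measurable f)
    (hg : Measurable g) (hh : Measurable h) (h1 : IndepFun f (fun x => (g x, h x)) P)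
    (h2 : IndepFun g h P) : IndepFun (fun x => (f x, g x)) h P := by
  have : IsProbabilityMeasure (P.map f) := Measure.isProbabilityMeasure_map hf.aemeasurable
  have : IsProbabilityMeasure (P.map g) := Measure.isProbabilityMeasure_map hg.aemeasurable
  have : IsProbabilityMeasure (P.map h) := Measure.isProbabilityMeasure_map hh.aemeasurable
  have h3 : IndepFun f g P := h1.comp measurable_id measurable_fst
  rw [indepFun_iff_map_prod_eq_prod_map_map (by fun_prop) (by fun_prop)] at h1 h2 h3 ⊢
  rw [h3]
  have e : (fun x => ((f x, g x), h x)) = MeasurableEquiv.prodAssoc.symm ∘ fun x => (f x, g x, h x) :=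
    rfl
  rw [e, ← Measure.map_map (by fun_prop) (by fun_prop), h1, h2,
    ← Measure.prodAssoc_prod, Measure.map_map (by fun_prop) (by fun_prop)]
  simp

variable {ι Ξ α : Type*} [mΞ : MeasurableSpace Ξ] [MeasurableSpace α]

/-- The information contained in `d` and in all samples but the one with index `p`. -/
abbrev othersAlgebra (d : Ω → α) (ξ : ι → Ω → Ξ) (p : ι) : MeasurableSpace Ω :=
  MeasurableSpace.comap (fun x => (d x, fun q : {q // q ≠ p} => ξ q x)) Prod.instMeasurableSpace

theorem measurable_init_othersAlgebra (d : Ω → α) (ξ : ι → Ω → Ξ) (p : ι) :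
    Measurable[othersAlgebra d ξ p] d :=
  measurable_fst.comp (comap_measurable _)

theorem measurable_sample_othersAlgebra (d : Ω → α) (ξ : ι → Ω → Ξ) {p q : ι} (h : q ≠ p) :
    Measurable[othersAlgebra d ξ p] (ξ q) :=
  (((measurable_pi_apply (X := fun _ : {q // q ≠ p} => Ξ) ⟨q, h⟩).comp measurable_snd).comp
    (comap_measurable fun x => (d x, fun q : {q // q ≠ p} => ξ q x)) :)

theorem othersAlgebra_le {d : Ω → α} (hd : Measurable d) {ξ : ι → Ω → Ξ}
    (hξ : ∀ p, Measurable (ξ p)) (p : ι) : othersAlgebra d ξ p ≤ mΩ :=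
  (hd.prodMk (measurable_pi_lambda _ fun q : {q // q ≠ p} => hξ q)).comap_le

/-- Leaving out one sample, rather than conditioning on the past, lets the samples within one
iteration be averaged singly and in any order. -/
theorem indep_othersAlgebra {d : Ω → α} (hd : Measurable d) {ξ : ι → Ω → Ξ}
    (hξ : ∀ p, Measurable (ξ p)) (hind : iIndepFun ξ P)
    (hdξ : IndepFun d (fun x p => ξ p x) P) (p : ι) :
    Indep (othersAlgebra d ξ p) (MeasurableSpace.comap (ξ p) mΞ) P := by
  refine (IndepFun_iff_Indep _ _ _).1 (indepFun_prodMk_of_indepFun hd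
    (measurable_pi_lambda _ fun q : {q // q ≠ p} => hξ q) (hξ p) ?_ ?_)
  · exact hdξ.comp (ψ := fun y : ι → Ξ => (fun q : {q // q ≠ p} => y q, y p)) measurable_id
      (by fun_prop)
  · rw [IndepFun_iff_Indep]
    have h := indep_iSup_of_disjoint (fun q => (hξ q).comap_le)
      ((iIndepFun_iff_iIndep _ _ _).1 hind) (S := {q | q ≠ p}) (T := {p}) (by simp)
    refine indep_of_indep_of_le_left (indep_of_indep_of_le_right h ?_) ?_
    · exact le_iSup₂_of_le p rfl le_rfl
    · have key : ∀ m' : MeasurableSpace Ω, (∀ q, q ≠ p → MeasurableSpace.comap (ξ q) mΞ ≤ m') →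
          MeasurableSpace.comap (fun x => fun q : {q // q ≠ p} => ξ q x) MeasurableSpace.pi ≤ m' :=
        fun m' h => (measurable_pi_lambda _ fun q : {q // q ≠ p} =>
          Measurable.of_comap_le (h q q.2)).comap_le
      exact key _ fun q hq => le_iSup₂_of_le q hq le_rfl

end Independence

/-! ### Second moments of centred noise. -/

section Noise

variable {Ω Ξ S V : Type*} {m : MeasurableSpace Ω} [mΩ : MeasurableSpace Ω] {P : Measure Ω}
  [IsProbabilityMeasure P] [mΞ : MeasurableSpace Ξ] {D : Measure Ξ}
  [NormedAddCommGroup V] [InnerProductSpace ℝ V] [CompleteSpace V] [MeasurableSpace V]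
  [BorelSpace V] [SecondCountableTopology V]

theorem integrable_inner_of_memLp {f g : Ω → V} (hf : MemLp f 2 P) (hg : MemLp g 2 P) :
    Integrable (fun ω => inner ℝ (f ω) (g ω)) P := by
  refine ((hf.integrable_norm_pow (by norm_num)).add (hg.integrable_norm_pow (by norm_num))).mono'
    (hf.1.inner hg.1) (Filter.Eventually.of_forall fun ω => ?_)
  simp only [Pi.add_apply]
  have := norm_inner_le_norm (𝕜 := ℝ) (f ω) (g ω)
  norm_num
  norm_num at this
  nlinarith [sq_nonneg (‖f ω‖ - ‖g ω‖), sq_nonneg ‖f ω‖, sq_nonneg ‖g ω‖]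

/-- Adding noise that is centered given the past increases the second moment at most by the
conditional variance. -/
theorem integral_norm_add_sq_le [MeasurableSpace S] (hm : m ≤ mΩ)
    {Y : Ω → Ξ} (hY : Measurable Y) (hlaw : P.map Y = D)
    (hind : Indep m (MeasurableSpace.comap Y mΞ) P)
    {X : Ω → S} (hX : Measurable[m] X) {A : Ω → V} (hA : Measurable[m] A) (hAL : MemLp A 2 P)
    {N : S → Ξ → V} (hN : Measurable (Function.uncurry N)) (hND : ∀ x, MemLp (N x) 2 D)
    (hmean : ∀ x, ∫ y, N x y ∂D = 0) (hNL : MemLp (fun ω => N (X ω) (Y ω)) 2 P)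
    {ν : Ω → ℝ} (hν : Integrable ν P) (hvar : ∀ ω, ∫ y, ‖N (X ω) y‖ ^ 2 ∂D ≤ ν ω) :
    ∫ ω, ‖A ω + N (X ω) (Y ω)‖ ^ 2 ∂P ≤ ∫ ω, ‖A ω‖ ^ 2 ∂P + ∫ ω, ν ω ∂P := by
  have hX' := hX.mono hm le_rfl
  have hA' := hA.mono hm le_rfl
  have : IsProbabilityMeasure D := hlaw ▸ Measure.isProbabilityMeasure_map hY.aemeasurable
  have hZ : Measurable[m] (fun ω => (A ω, X ω)) := hA.prodMk hX
  have hZ' := hZ.mono hm le_rfl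
  -- Independence makes the joint law a product, so Fubini replaces conditional expectations:
  -- integrating over the sample first kills the cross term and leaves the variance at a fixed
  -- point.
  have hprod : P.map (fun ω => ((A ω, X ω), Y ω)) = (P.map fun ω => (A ω, X ω)).prod D := by
    have : IndepFun (fun ω => (A ω, X ω)) Y P :=
      (IndepFun_iff_Indep _ _ _).2 (indep_of_indep_of_le_left hind hZ.comap_le)
    rw [(indepFun_iff_map_prod_eq_prod_map_map hZ'.aemeasurable hY.aemeasurable).1 this, hlaw]
  have : IsProbabilityMeasure (P.map fun ω => (A ω, X ω)) :=
    Measure.isProbabilityMeasure_map hZ'.aemeasurable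
  have hZY : Measurable fun ω => ((A ω, X ω), Y ω) := hZ'.prodMk hY
  have hNm : Measurable fun z : (V × S) × Ξ => N z.1.2 z.2 :=
    hN.comp (f := fun z : (V × S) × Ξ => (z.1.2, z.2)) (by fun_prop)
  have hcross : ∫ ω, inner ℝ (A ω) (N (X ω) (Y ω)) ∂P = 0 := by
    have hmeas : AEStronglyMeasurable (fun z : (V × S) × Ξ => inner ℝ z.1.1 (N z.1.2 z.2))
        (P.map fun ω => ((A ω, X ω), Y ω)) :=
      ((measurable_fst.comp measurable_fst).inner hNm).aestronglyMeasurable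
    have hint : Integrable (fun ω => inner ℝ (A ω) (N (X ω) (Y ω))) P := integrable_inner_of_memLp hAL hNL
    have hint2 := (integrable_map_measure hmeas hZY.aemeasurable).2 hint
    have e1 := integral_map hZY.aemeasurable hmeas
    rw [hprod] at hint2 e1
    rw [← e1, integral_prod _ hint2]
    refine integral_eq_zero_of_ae (Filter.Eventually.of_forall fun z => ?_)
    simp only [Pi.zero_apply]
    rw [integral_inner ((hND z.2).integrable (by norm_num)), hmean, inner_zero_right]
  have hsq : ∫ ω, ‖N (X ω) (Y ω)‖ ^ 2 ∂P ≤ ∫ ω, ν ω ∂P := by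
    have hmeas : AEStronglyMeasurable (fun z : (V × S) × Ξ => ‖N z.1.2 z.2‖ ^ 2)
        (P.map fun ω => ((A ω, X ω), Y ω)) :=
      (hNm.norm.pow_const 2).aestronglyMeasurable
    have hint : Integrable (fun ω => ‖N (X ω) (Y ω)‖ ^ 2) P := hNL.integrable_norm_pow (by norm_num)
    have hint2 := (integrable_map_measure hmeas hZY.aemeasurable).2 hint
    have e1 := integral_map hZY.aemeasurable hmeas
    rw [hprod] at hint2 e1
    rw [← e1, integral_prod _ hint2, integral_map hZ'.aemeasurable]
    · exact integral_mono_of_nonneg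
        (Filter.Eventually.of_forall fun ω => integral_nonneg fun y => by positivity) hν
        (Filter.Eventually.of_forall hvar)
    · exact hint2.integral_prod_left.aestronglyMeasurable
  have e : ∀ ω, ‖A ω + N (X ω) (Y ω)‖ ^ 2
      = ‖A ω‖ ^ 2 + 2 * inner ℝ (A ω) (N (X ω) (Y ω)) + ‖N (X ω) (Y ω)‖ ^ 2 :=
    fun ω => norm_add_sq_real _ _
  have hint1 : Integrable (fun ω => ‖A ω‖ ^ 2) P := hAL.integrable_norm_pow (by norm_num)
  have hint2 : Integrable (fun ω => 2 * inner ℝ (A ω) (N (X ω) (Y ω))) P :=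
    (integrable_inner_of_memLp hAL hNL).const_mul 2
  have hint3 : Integrable (fun ω => ‖N (X ω) (Y ω)‖ ^ 2) P := hNL.integrable_norm_pow (by norm_num)
  simp_rw [e]
  rw [integral_add (f := fun ω => ‖A ω‖ ^ 2 + 2 * inner ℝ (A ω) (N (X ω) (Y ω)))
    (hint1.add hint2) hint3, integral_add hint1 hint2, integral_const_mul, hcross]
  linarith

/-- The variance is at most the second moment. -/
theorem integral_norm_sub_integral_sq_le [IsProbabilityMeasure D] {Z : Ξ → V} (hZ : MemLp Z 2 D) :
    ∫ y, ‖Z y - ∫ y, Z y ∂D‖ ^ 2 ∂D ≤ ∫ y, ‖Z y‖ ^ 2 ∂D := by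
  set a := ∫ y, Z y ∂D with ha
  have hZ1 : Integrable Z D := hZ.integrable (by norm_num)
  have hint1 : Integrable (fun y => ‖Z y‖ ^ 2) D := hZ.integrable_norm_pow (by norm_num)
  have hint2 : Integrable (fun y => 2 * inner ℝ a (Z y)) D := (hZ1.const_inner a).const_mul 2
  have e : ∀ y, ‖Z y - a‖ ^ 2 = ‖Z y‖ ^ 2 - 2 * inner ℝ a (Z y) + ‖a‖ ^ 2 := fun y => by
    rw [norm_sub_sq_real, real_inner_comm]
  simp_rw [e]
  rw [integral_add (f := fun y => ‖Z y‖ ^ 2 - 2 * inner ℝ a (Z y)) (hint1.sub hint2)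
    (integrable_const _), integral_sub hint1 hint2, integral_const_mul, integral_inner hZ1, ← ha, real_inner_self_eq_norm_sq]
  simp
  nlinarith [sq_nonneg ‖a‖]

/-- The variance of the recursive momentum correction. -/
theorem integral_momentum_sq_le [IsProbabilityMeasure D] {Z Z' : Ξ → V} (hZ : MemLp Z 2 D)
    (hZ' : MemLp Z' 2 D) {η B s : ℝ} (hη0 : 0 ≤ η) (hη1 : η ≤ 1)
    (hB : ∀ y, ‖Z' y - Z y‖ ^ 2 ≤ B) (hs : ∫ y, ‖Z' y - ∫ y, Z' y ∂D‖ ^ 2 ∂D ≤ s) :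
    ∫ y, ‖(1 - η) • (Z y - ∫ y, Z y ∂D) - (Z' y - ∫ y, Z' y ∂D)‖ ^ 2 ∂D
      ≤ 2 * B + 2 * η ^ 2 * s := by
  have hZ1 : Integrable Z D := hZ.integrable (by norm_num)
  have hZ1' : Integrable Z' D := hZ'.integrable (by norm_num)
  set a := ∫ y, Z y ∂D with ha
  set a' := ∫ y, Z' y ∂D with ha'
  have hd := integral_norm_sub_integral_sq_le (hZ'.sub hZ)
  have hmean : ∫ y, (Z' - Z) y ∂D = a' - a := integral_sub hZ1' hZ1
  rw [hmean] at hd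
  have hd2 : ∫ y, ‖(Z' - Z) y‖ ^ 2 ∂D ≤ B := by
    have := integral_mono ((hZ'.sub hZ).integrable_norm_pow (by norm_num)) (integrable_const B)
      (fun y => hB y)
    simpa using this
  have hi1 : Integrable (fun y => ‖(Z' - Z) y - (a' - a)‖ ^ 2) D :=
    ((hZ'.sub hZ).sub (memLp_const _)).integrable_norm_pow (by norm_num)
  have hi2 : Integrable (fun y => ‖Z' y - a'‖ ^ 2) D :=
    (hZ'.sub (memLp_const _)).integrable_norm_pow (by norm_num)
  have hpt : ∀ y, ‖(1 - η) • (Z y - a) - (Z' y - a')‖ ^ 2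
      ≤ 2 * ‖(Z' - Z) y - (a' - a)‖ ^ 2 + 2 * η ^ 2 * ‖Z' y - a'‖ ^ 2 := fun y => by
    -- The recentring behind variance reduction: a small increment `Z' - Z` plus the small factor
    -- `η` times full noise.
    have e : (1 - η) • (Z y - a) - (Z' y - a')
        = -((1 - η) • ((Z' - Z) y - (a' - a)) + η • (Z' y - a')) := by
      simp only [Pi.sub_apply, sub_smul, one_smul, smul_sub]
      abel
    rw [e, norm_neg]
    have h1 := norm_add_le ((1 - η) • ((Z' - Z) y - (a' - a))) (η • (Z' y - a'))
    rw [norm_smul, norm_smul, Real.norm_of_nonneg hη0, Real.norm_of_nonneg (sub_nonneg.2 hη1)]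
      at h1
    have h2 := pow_le_pow_left₀ (norm_nonneg _) h1 2
    have h3 : (1 - η) ^ 2 ≤ 1 := by nlinarith
    generalize ‖(Z' - Z) y - (a' - a)‖ = p at h2 ⊢
    generalize ‖Z' y - a'‖ = q at h2 ⊢
    nlinarith [sq_nonneg ((1 - η) * p - η * q), sq_nonneg p]
  have := integral_mono_of_nonneg (Filter.Eventually.of_forall fun y => by positivity)
    ((hi1.const_mul 2).add (hi2.const_mul (2 * η ^ 2))) (Filter.Eventually.of_forall hpt)
  refine this.trans ?_
  simp only [Pi.add_apply]
  rw [integral_add (hi1.const_mul 2) (hi2.const_mul (2 * η ^ 2)), integral_const_mul,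
    integral_const_mul]
  nlinarith [sq_nonneg η]

end Noise

/-! ### Oracles continuous in the point, evaluated at random points. -/

section Oracle

variable {Ω Ξ S V : Type*} {m : MeasurableSpace Ω} [mΩ : MeasurableSpace Ω] {P : Measure Ω}
  [IsProbabilityMeasure P] [mΞ : MeasurableSpace Ξ] {D : Measure Ξ}
  [NormedAddCommGroup V] [InnerProductSpace ℝ V]

/-- `o y x`, with `y` of law `D`, is a square integrable unbiased estimate of `t x`, and both are
continuous in `x`. -/
structure ContOracle [TopologicalSpace S] (D : Measure Ξ) (o : Ξ → S → V) (t : S → V) : Prop where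
  continuous_oracle : ∀ y, Continuous (o y)
  continuous_target : Continuous t
  stronglyMeasurable : ∀ x, StronglyMeasurable fun y => o y x
  memLp : ∀ x, MemLp (fun y => o y x) 2 D
  unbiased : ∀ x, ∫ y, o y x ∂D = t x

variable [TopologicalSpace S] [TopologicalSpace.MetrizableSpace S] [SecondCountableTopology S]
  [MeasurableSpace S] [BorelSpace S] [MeasurableSpace V] [BorelSpace V]
  {o : Ξ → S → V} {t : S → V}

/-- A Carathéodory function, measurable in the sample and continuous in the point, is jointly
measurable. This is what makes evaluation at random iterates measurable. -/
theorem ContOracle.measurable_uncurry (h : ContOracle D o t) :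
    Measurable (Function.uncurry fun x y => o y x) :=
  (stronglyMeasurable_uncurry_of_continuous_of_stronglyMeasurable (u := fun x y => o y x)
    h.continuous_oracle h.stronglyMeasurable).measurable

theorem ContOracle.measurable (h : ContOracle D o t) {Y : Ω → Ξ} {X : Ω → S}
    (hY : Measurable[m] Y) (hX : Measurable[m] X) : Measurable[m] fun ω => o (Y ω) (X ω) :=
  h.measurable_uncurry.comp (hX.prodMk hY)

theorem ContOracle.measurable_target (h : ContOracle D o t) {X : Ω → S}
    (hX : Measurable[m] X) : Measurable[m] fun ω => t (X ω) :=
  h.continuous_target.measurable.comp hX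

variable [CompleteSpace V] [SecondCountableTopology V]

theorem ContOracle.integral_norm_add_smul_sq_le (h : ContOracle D o t) (hm : m ≤ mΩ)
    {Y : Ω → Ξ} (hY : Measurable Y) (hlaw : P.map Y = D)
    (hind : Indep m (MeasurableSpace.comap Y mΞ) P)
    {X : Ω → S} (hX : Measurable[m] X) {A : Ω → V} (hA : Measurable[m] A) (hAL : MemLp A 2 P)
    (hoL : MemLp (fun ω => o (Y ω) (X ω)) 2 P) (htL : MemLp (fun ω => t (X ω)) 2 P) (a : ℝ) {s : ℝ}
    (hs : ∀ ω, ∫ y, ‖o y (X ω) - t (X ω)‖ ^ 2 ∂D ≤ s) :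
    ∫ ω, ‖A ω + a • (o (Y ω) (X ω) - t (X ω))‖ ^ 2 ∂P ≤ ∫ ω, ‖A ω‖ ^ 2 ∂P + a ^ 2 * s := by
  have : IsProbabilityMeasure D := hlaw ▸ Measure.isProbabilityMeasure_map hY.aemeasurable
  have := integral_norm_add_sq_le hm hY hlaw hind hX hA hAL
    (N := fun x y => a • (o y x - t x)) (ν := fun _ => a ^ 2 * s)
    ((h.measurable_uncurry.sub (h.continuous_target.measurable.comp measurable_fst)).const_smul a)
    (fun x => ((h.memLp x).sub (memLp_const _)).const_smul a)
    (fun x => by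
      rw [integral_smul, integral_sub ((h.memLp x).integrable (by norm_num)) (integrable_const _),
        h.unbiased]
      simp)
    ((hoL.sub htL).const_smul a) (integrable_const _)
    (fun ω => by
      simp_rw [norm_smul, mul_pow, Real.norm_eq_abs, sq_abs]
      rw [integral_const_mul]
      exact mul_le_mul_of_nonneg_left (hs ω) (sq_nonneg a))
  simpa using this

/-- The pair of old and new points serves as one random point, because the same sample is evaluated
at both. -/
theorem ContOracle.integral_norm_add_momentum_sq_le (h : ContOracle D o t) (hm : m ≤ mΩ)
    {Y : Ω → Ξ} (hY : Measurable Y) (hlaw : P.map Y = D)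
    (hind : Indep m (MeasurableSpace.comap Y mΞ) P)
    {X X' : Ω → S} (hX : Measurable[m] X) (hX' : Measurable[m] X') {A : Ω → V}
    (hA : Measurable[m] A) (hAL : MemLp A 2 P)
    (hoL : MemLp (fun ω => o (Y ω) (X ω)) 2 P) (htL : MemLp (fun ω => t (X ω)) 2 P)
    (hoL' : MemLp (fun ω => o (Y ω) (X' ω)) 2 P) (htL' : MemLp (fun ω => t (X' ω)) 2 P)
    {η : ℝ} (hη0 : 0 ≤ η) (hη1 : η ≤ 1) {s : ℝ} {B : Ω → ℝ} (hBi : Integrable B P)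
    (hB : ∀ ω y, ‖o y (X' ω) - o y (X ω)‖ ^ 2 ≤ B ω)
    (hs : ∀ ω, ∫ y, ‖o y (X' ω) - t (X' ω)‖ ^ 2 ∂D ≤ s) :
    ∫ ω, ‖A ω + ((1 - η) • (o (Y ω) (X ω) - t (X ω)) - (o (Y ω) (X' ω) - t (X' ω)))‖ ^ 2 ∂P
      ≤ ∫ ω, ‖A ω‖ ^ 2 ∂P + (2 * ∫ ω, B ω ∂P + 2 * η ^ 2 * s) := by
  have : IsProbabilityMeasure D := hlaw ▸ Measure.isProbabilityMeasure_map hY.aemeasurable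
  have hmeas : Measurable (Function.uncurry fun x y => o y x - t x) :=
    h.measurable_uncurry.sub (h.continuous_target.measurable.comp measurable_fst)
  have hzero : ∀ x, ∫ y, (o y x - t x) ∂D = 0 := fun x => by
    rw [integral_sub ((h.memLp x).integrable (by norm_num)) (integrable_const _), h.unbiased]
    simp
  have hL : ∀ x, MemLp (fun y => o y x - t x) 2 D := fun x => (h.memLp x).sub (memLp_const _)
  have key := integral_norm_add_sq_le hm hY hlaw hind (hX.prodMk hX') hA hAL
    (N := fun x y => (1 - η) • (o y x.1 - t x.1) - (o y x.2 - t x.2))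
    (ν := fun ω => 2 * B ω + 2 * η ^ 2 * s)
    (((hmeas.comp (g := Function.uncurry fun x y => o y x - t x)
        (f := fun z : (S × S) × Ξ => (z.1.1, z.2)) (by fun_prop)).const_smul (1 - η)).sub
      (hmeas.comp (g := Function.uncurry fun x y => o y x - t x)
        (f := fun z : (S × S) × Ξ => (z.1.2, z.2)) (by fun_prop)))
    (fun x => ((hL x.1).const_smul (1 - η)).sub (hL x.2))
    (fun x => by
      rw [integral_sub (f := fun y => (1 - η) • (o y x.1 - t x.1))
        (((hL x.1).const_smul (1 - η)).integrable (by norm_num))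
        ((hL x.2).integrable (by norm_num)), integral_smul, hzero, hzero]
      simp)
    (((hoL.sub htL).const_smul (1 - η)).sub (hoL'.sub htL'))
    ((hBi.const_mul 2).add (integrable_const _))
    (fun ω => by
      have := integral_momentum_sq_le (h.memLp (X ω)) (h.memLp (X' ω)) hη0 hη1 (hB ω) (s := s)
        (by rw [h.unbiased]; exact hs ω)
      rwa [h.unbiased, h.unbiased] at this)
  rw [integral_add (hBi.const_mul 2) (integrable_const _), integral_const_mul] at key
  simpa using key

end Oracle

/-! ### The derivative oracles of the problem. -/

section Problem

variable {E W Ξ : Type*}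
  [NormedAddCommGroup E] [InnerProductSpace ℝ E] [CompleteSpace E]
  [NormedAddCommGroup W] [InnerProductSpace ℝ W] [CompleteSpace W]
  [MeasurableSpace Ξ] {D : Measure Ξ} [IsProbabilityMeasure D]

theorem UnbiasedOracle.contOracle {V : Type*} [NormedAddCommGroup V] [InnerProductSpace ℝ V]
    {σ L : ℝ} {o : Ξ → E → W → V} {t : E → W → V} (h : UnbiasedOracle D σ o t)
    (ho : ∀ y, JointLipschitz L (o y)) (ht : JointLipschitz L t) :
    ContOracle D (fun y (p : E × W) => o y p.1 p.2) (fun p => t p.1 p.2) where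
  continuous_oracle y := (ho y).continuous
  continuous_target := ht.continuous
  stronglyMeasurable x := h.measurable x.1 x.2
  memLp x := h.memLp x.1 x.2
  unbiased x := h.unbiased x.1 x.2

/-- Operators do not form a Hilbert space under the operator norm. Making `v` part of the evaluation
point gives a vector-valued oracle, to which the orthogonality argument applies. -/
theorem UnbiasedOracle.contOracle_apply {V : Type*} [NormedAddCommGroup V] [InnerProductSpace ℝ V]
    [CompleteSpace V] {σ L : ℝ} {o : Ξ → E → W → (W →L[ℝ] V)} {t : E → W → (W →L[ℝ] V)}
    (h : UnbiasedOracle D σ o t) (ho : ∀ y, JointLipschitz L (o y)) (ht : JointLipschitz L t) :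
    ContOracle D (fun y (p : (E × W) × W) => o y p.1.1 p.1.2 p.2)
      (fun p => t p.1.1 p.1.2 p.2) where
  continuous_oracle y := ((ho y).continuous.comp continuous_fst).clm_apply continuous_snd
  continuous_target := (ht.continuous.comp continuous_fst).clm_apply continuous_snd
  stronglyMeasurable x := (ContinuousLinearMap.apply ℝ V x.2).continuous.comp_stronglyMeasurable
    (h.measurable x.1.1 x.1.2)
  memLp x := (ContinuousLinearMap.apply ℝ V x.2).comp_memLp' (h.memLp x.1.1 x.1.2)
  unbiased x := by
    rw [← h.unbiased, ContinuousLinearMap.integral_apply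
      ((h.memLp x.1.1 x.1.2).integrable (by norm_num))]

theorem UnbiasedOracle.variance_apply_le {V : Type*} [NormedAddCommGroup V] [InnerProductSpace ℝ V]
    {σ R : ℝ} {o : Ξ → E → W → (W →L[ℝ] V)} {t : E → W → (W →L[ℝ] V)}
    (h : UnbiasedOracle D σ o t) (l : E) (w : W) {v : W} (hv : ‖v‖ ≤ R) :
    ∫ y, ‖o y l w v - t l w v‖ ^ 2 ∂D ≤ σ ^ 2 * R ^ 2 := by
  have hi : Integrable (fun y => ‖o y l w - t l w‖ ^ 2 * R ^ 2) D :=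
    (((h.memLp l w).sub (memLp_const _)).integrable_norm_pow (by norm_num)).mul_const _
  refine (integral_mono_of_nonneg (Filter.Eventually.of_forall fun y => by positivity) hi
    (Filter.Eventually.of_forall fun y => ?_)).trans ?_
  · simp only
    rw [← sub_apply, ← mul_pow]
    exact pow_le_pow_left₀ (norm_nonneg _) ((o y l w - t l w).le_of_opNorm_le_of_le le_rfl hv) 2
  · rw [integral_mul_const]
    exact mul_le_mul_of_nonneg_right (h.variance l w) (sq_nonneg R)

end Problem

/-! ### Measurability and integrability along one iteration. -/

section Step

variable {E W Ξ : Type*}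
  [NormedAddCommGroup E] [InnerProductSpace ℝ E] [FiniteDimensional ℝ E] [CompleteSpace E]
  [NormedAddCommGroup W] [InnerProductSpace ℝ W] [FiniteDimensional ℝ W] [CompleteSpace W]
  [MeasurableSpace E] [BorelSpace E] [MeasurableSpace W] [BorelSpace W]
  [mΞ : MeasurableSpace Ξ] {D : Measure Ξ} [IsProbabilityMeasure D]

/-- The standing assumptions on the problem and its samples. -/
structure Setting (c : Constants) (D : Measure Ξ) (σ : ℝ) (F G : E → W → ℝ)
    (Fs Gs : Ξ → E → W → ℝ) : Prop where
  pos : c.Positive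
  outer : OuterAssumption c F
  inner : InnerAssumption c G
  outer_sample : ∀ y, OuterAssumption c (Fs y)
  inner_sample : ∀ y, InnerAssumption c (Gs y)
  noise : NoiseAssumption D σ F G Fs Gs

/-- All components of a random state are measurable with respect to `m`. -/
structure MeasurableState {Ω : Type*} (m : MeasurableSpace Ω) (s : Ω → State E W) : Prop where
  lam : Measurable[m] fun ω => (s ω).lam
  om : Measurable[m] fun ω => (s ω).om
  v : Measurable[m] fun ω => (s ω).v
  d : Measurable[m] fun ω => (s ω).d

/-- The random state is square integrable, with `‖v‖ ≤ M`. -/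
structure SquareIntegrableState {Ω : Type*} [MeasurableSpace Ω] (c : Constants) (P : Measure Ω)
    (s : Ω → State E W) : Prop where
  lam : MemLp (fun ω => (s ω).lam) 2 P
  om : MemLp (fun ω => (s ω).om) 2 P
  v : ∀ ω, ‖(s ω).v‖ ≤ c.M
  d : MemLp (fun ω => (s ω).d) 2 P

variable {c : Constants} {σ : ℝ} {F G : E → W → ℝ} {Fs Gs : Ξ → E → W → ℝ}

theorem Setting.contOracle_gradOuter (H : Setting c D σ F G Fs Gs) :
    ContOracle D (fun y (p : E × W) => gradOuter (Fs y) p.1 p.2) (fun p => gradOuter F p.1 p.2) :=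
  H.noise.outerGradF.contOracle (fun y => (H.outer_sample y).lipschitz_outer)
    H.outer.lipschitz_outer

theorem Setting.contOracle_gradInner (H : Setting c D σ F G Fs Gs) :
    ContOracle D (fun y (p : E × W) => gradInner (Fs y) p.1 p.2) (fun p => gradInner F p.1 p.2) :=
  H.noise.innerGradF.contOracle (fun y => (H.outer_sample y).lipschitz_inner)
    H.outer.lipschitz_inner

theorem Setting.contOracle_gradInner_inner (H : Setting c D σ F G Fs Gs) :
    ContOracle D (fun y (p : E × W) => gradInner (Gs y) p.1 p.2) (fun p => gradInner G p.1 p.2) :=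
  H.noise.innerGradG.contOracle (fun y => (H.inner_sample y).lipschitz_grad)
    H.inner.lipschitz_grad

theorem Setting.contOracle_hess (H : Setting c D σ F G Fs Gs) :
    ContOracle D (fun y (p : (E × W) × W) => hessInner (Gs y) p.1.1 p.1.2 p.2)
      (fun p => hessInner G p.1.1 p.1.2 p.2) :=
  H.noise.hessG.contOracle_apply (fun y => (H.inner_sample y).lipschitz_hess)
    H.inner.lipschitz_hess

theorem Setting.contOracle_mixed (H : Setting c D σ F G Fs Gs) :
    ContOracle D (fun y (p : (E × W) × W) => hessMixed (Gs y) p.1.1 p.1.2 p.2)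
      (fun p => hessMixed G p.1.1 p.1.2 p.2) :=
  H.noise.mixedG.contOracle_apply (fun y => (H.inner_sample y).lipschitz_mixed)
    H.inner.lipschitz_mixed

theorem step_om (α : ℝ) (ξ : Fin 5 → Ξ) (s : State E W) :
    (step c Fs Gs α ξ s).om = s.om
      - (c.cτ * α) • gradInner (Gs (ξ 0)) (step c Fs Gs α ξ s).lam s.om := rfl

theorem step_v (α : ℝ) (ξ : Fin 5 → Ξ) (s : State E W) :
    (step c Fs Gs α ξ s).v = s.v
      + (c.cβ * α) • (gradInner (Fs (ξ 1)) (step c Fs Gs α ξ s).lam s.om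
        - hessInner (Gs (ξ 2)) (step c Fs Gs α ξ s).lam s.om s.v) := by
  rw [smul_sub]
  simp only [step]
  abel

section Measurability

variable {Ω : Type*} {m : MeasurableSpace Ω} {s : Ω → State E W} {ζ : Fin 5 → Ω → Ξ} {α : ℝ}

theorem MeasurableState.step_lam (hs : MeasurableState m s) :
    Measurable[m] fun ω => (step c Fs Gs α (fun i => ζ i ω) (s ω)).lam :=
  hs.lam.sub (hs.d.const_smul α)

theorem MeasurableState.step_om (H : Setting c D σ F G Fs Gs) (hs : MeasurableState m s)
    (h0 : Measurable[m] (ζ 0)) :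
    Measurable[m] fun ω => (step c Fs Gs α (fun i => ζ i ω) (s ω)).om := by
  have h1 := H.contOracle_gradInner_inner.measurable h0
    ((hs.step_lam (c := c) (Fs := Fs) (Gs := Gs) (ζ := ζ) (α := α)).prodMk hs.om)
  exact hs.om.sub (h1.const_smul _)

theorem MeasurableState.step_v (H : Setting c D σ F G Fs Gs) (hs : MeasurableState m s)
    (h1 : Measurable[m] (ζ 1)) (h2 : Measurable[m] (ζ 2)) :
    Measurable[m] fun ω => (step c Fs Gs α (fun i => ζ i ω) (s ω)).v := by
  have hx := (hs.step_lam (c := c) (Fs := Fs) (Gs := Gs) (ζ := ζ) (α := α)).prodMk hs.om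
  have h3 := H.contOracle_gradInner.measurable h1 hx
  have h4 := H.contOracle_hess.measurable h2 (hx.prodMk hs.v)
  simp_rw [FSLA.step_v]
  exact hs.v.add ((h3.sub h4).const_smul _)

theorem Setting.measurable_stochHyperGrad (H : Setting c D σ F G Fs Gs) {Y Y' : Ω → Ξ}
    (hY : Measurable[m] Y) (hY' : Measurable[m] Y') {l : Ω → E} {w v : Ω → W}
    (hl : Measurable[m] l) (hw : Measurable[m] w) (hv : Measurable[m] v) :
    Measurable[m] fun ω => stochHyperGrad Fs Gs (Y ω) (Y' ω) (l ω) (w ω) (v ω) := by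
  have h1 :=
    H.contOracle_gradOuter.measurable hY (hl.prodMk hw)
  have h2 :=
    H.contOracle_mixed.measurable hY' ((hl.prodMk hw).prodMk hv)
  exact h1.sub h2

theorem Setting.measurable_hyperGrad (H : Setting c D σ F G Fs Gs) {l : Ω → E} {w v : Ω → W}
    (hl : Measurable[m] l) (hw : Measurable[m] w) (hv : Measurable[m] v) :
    Measurable[m] fun ω => hyperGrad F G (l ω) (w ω) (v ω) := by
  have h1 :=
    H.contOracle_gradOuter.measurable_target (hl.prodMk hw)
  have h2 :=
    H.contOracle_mixed.measurable_target ((hl.prodMk hw).prodMk hv)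
  exact h1.sub h2

theorem MeasurableState.next (H : Setting c D σ F G Fs Gs) (hs : MeasurableState m s)
    (hζ : ∀ i, Measurable[m] (ζ i)) :
    MeasurableState m fun ω => step c Fs Gs α (fun i => ζ i ω) (s ω) where
  lam := hs.step_lam
  om := hs.step_om H (hζ 0)
  v := hs.step_v H (hζ 1) (hζ 2)
  d := by
    have h1 := H.measurable_stochHyperGrad (hζ 3) (hζ 4) (hs.step_lam (c := c) (Fs := Fs) (Gs := Gs) (α := α) (ζ := ζ))
      (hs.step_om (α := α) H (hζ 0)) (hs.step_v (α := α) H (hζ 1) (hζ 2))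
    have h2 := H.measurable_stochHyperGrad (hζ 3) (hζ 4) hs.lam hs.om hs.v
    exact h1.add ((hs.d.sub h2).const_smul _)

end Measurability

section Integrability

variable {Ω : Type*} [mΩ : MeasurableSpace Ω] {P : Measure Ω} [IsProbabilityMeasure P]
  {s : Ω → State E W} {ζ : Fin 5 → Ω → Ξ} {α : ℝ}

theorem memLp_comp_of_lipschitz {X Y : Type*} [NormedAddCommGroup X] [NormedAddCommGroup Y]
    {g : X → Y} {L : ℝ} (hg : ∀ x y, ‖g x - g y‖ ≤ L * ‖x - y‖) {f : Ω → X} (hf : MemLp f 2 P) :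
    MemLp (fun ω => g (f ω)) 2 P := by
  have hcont : Continuous g := (LipschitzWith.of_dist_le_mul (K := L.toNNReal) fun x y => by
    rw [dist_eq_norm, dist_eq_norm]
    exact (hg x y).trans (mul_le_mul_of_nonneg_right (Real.le_coe_toNNReal L)
      (norm_nonneg _))).continuous
  have h0 := (memLp_const (p := 2) (μ := P) ‖g 0‖).add (hf.norm.const_mul L)
  refine MemLp.mono' h0 (hcont.comp_aestronglyMeasurable hf.1)
    (Filter.Eventually.of_forall fun ω => ?_)
  have h1 := hg (f ω) 0
  rw [sub_zero] at h1
  have h2 := norm_add_le (g (f ω) - g 0) (g 0)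
  rw [sub_add_cancel] at h2
  simp only [Pi.add_apply]
  linarith

/-- This is the one oracle without a uniform bound. Its Lipschitz constant is uniform over samples,
so it grows at most linearly from its square integrable value at the origin. -/
theorem Setting.memLp_gradInner_inner (H : Setting c D σ F G Fs Gs) {Y : Ω → Ξ} (hY : Measurable Y)
    (hlaw : P.map Y = D) {l : Ω → E} {w : Ω → W} (hl : Measurable l) (hw : Measurable w)
    (hlL : MemLp l 2 P) (hwL : MemLp w 2 P) :
    MemLp (fun ω => gradInner (Gs (Y ω)) (l ω) (w ω)) 2 P := by
  have h0 : MemLp (fun ω => gradInner (Gs (Y ω)) 0 0) 2 P := by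
    have h1 := H.noise.innerGradG.memLp 0 0
    rw [← hlaw] at h1
    exact (memLp_map_measure_iff h1.1 hY.aemeasurable).1 h1
  refine MemLp.mono' (g := fun ω => ‖gradInner (Gs (Y ω)) 0 0‖ + c.LGw * (‖l ω‖ + ‖w ω‖))
    (h0.norm.add ((hlL.norm.add hwL.norm).const_mul _))
    (H.contOracle_gradInner_inner.measurable hY (hl.prodMk hw)).aestronglyMeasurable
    (Filter.Eventually.of_forall fun ω => ?_)
  have h1 := (H.inner_sample (Y ω)).lipschitz_grad (l ω) 0 (w ω) 0
  rw [sub_zero, sub_zero] at h1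
  have h2 := norm_add_le (gradInner (Gs (Y ω)) (l ω) (w ω) - gradInner (Gs (Y ω)) 0 0)
    (gradInner (Gs (Y ω)) 0 0)
  rw [sub_add_cancel] at h2
  have h3 : √(‖l ω‖ ^ 2 + ‖w ω‖ ^ 2) ≤ ‖l ω‖ + ‖w ω‖ := by
    rw [Real.sqrt_le_left (by positivity)]
    nlinarith [mul_nonneg (norm_nonneg (l ω)) (norm_nonneg (w ω))]
  have h4 := mul_le_mul_of_nonneg_left h3 H.pos.LGw.le
  linarith

theorem norm_stochHyperGrad_le (H : Setting c D σ F G Fs Gs) (y y' : Ξ) (l : E) (w : W) {v : W}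
    (hv : ‖v‖ ≤ c.M) : ‖stochHyperGrad Fs Gs y y' l w v‖ ≤ c.CFl + c.CGwl * c.M :=
  (norm_sub_le _ _).trans (add_le_add ((H.outer_sample y).bound_outer l w)
    ((hessMixed (Gs y') l w).le_of_opNorm_le_of_le ((H.inner_sample y').bound_mixed l w) hv))

theorem SquareIntegrableState.memLp_step_lam (hL : SquareIntegrableState c P s) :
    MemLp (fun ω => (FSLA.step c Fs Gs α (fun i => ζ i ω) (s ω)).lam) 2 P :=
  hL.lam.sub (hL.d.const_smul α)

/-- The bound is pathwise: the gradient and Hessian samples obey the same constants as `F` and `G`,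
even when drawn separately. -/
theorem norm_step_v_le (H : Setting c D σ F G Fs Gs) (hα : c.SmallStep α) (ξ : Fin 5 → Ξ)
    (t : State E W) (ht : ‖t.v‖ ≤ c.M) : ‖(FSLA.step c Fs Gs α ξ t).v‖ ≤ c.M := by
  rw [step_v]
  refine norm_add_residual_le H.pos (H.outer_sample (ξ 1)) (H.inner_sample (ξ 2))
    (mul_pos H.pos.cβ_pos hα.pos).le ?_ (hα.βμ_lt_one H.pos) _ _ ht
  linarith [hα.β_le]

theorem SquareIntegrableState.next (H : Setting c D σ F G Fs Gs) (hα : c.SmallStep α)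
    (hs : MeasurableState mΩ s) (hL : SquareIntegrableState c P s)
    (hζ : ∀ i, Measurable (ζ i)) (hlaw : ∀ i, P.map (ζ i) = D) :
    SquareIntegrableState c P fun ω => step c Fs Gs α (fun i => ζ i ω) (s ω) where
  lam := hL.memLp_step_lam
  om := hL.om.sub ((H.memLp_gradInner_inner (hζ 0) (hlaw 0)
    (hs.step_lam (c := c) (Fs := Fs) (Gs := Gs) (ζ := ζ) (α := α)) hs.om
    hL.memLp_step_lam hL.om).const_smul _)
  v ω := norm_step_v_le H hα _ _ (hL.v ω)
  d := by
    have h1 := H.measurable_stochHyperGrad (hζ 3) (hζ 4) (hs.step_lam (c := c) (Fs := Fs) (Gs := Gs) (α := α) (ζ := ζ))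
      (hs.step_om (α := α) H (hζ 0)) (hs.step_v (α := α) H (hζ 1) (hζ 2))
    have h2 := H.measurable_stochHyperGrad (hζ 3) (hζ 4) hs.lam hs.om hs.v
    have h3 := MemLp.of_bound (p := 2) (μ := P) h1.aestronglyMeasurable (c.CFl + c.CGwl * c.M)
      (Filter.Eventually.of_forall fun ω =>
        norm_stochHyperGrad_le H _ _ _ _ (norm_step_v_le H hα _ _ (hL.v ω)))
    have h4 := MemLp.of_bound (p := 2) (μ := P) h2.aestronglyMeasurable (c.CFl + c.CGwl * c.M)
      (Filter.Eventually.of_forall fun ω => norm_stochHyperGrad_le H _ _ _ _ (hL.v ω))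
    exact h3.add ((hL.d.sub h4).const_smul _)

end Integrability

end Step

/-! ### Replacing samples by their means in each update. -/

section Moments

variable {E W Ξ : Type*}
  [NormedAddCommGroup E] [InnerProductSpace ℝ E] [FiniteDimensional ℝ E] [CompleteSpace E]
  [NormedAddCommGroup W] [InnerProductSpace ℝ W] [FiniteDimensional ℝ W] [CompleteSpace W]
  [MeasurableSpace E] [BorelSpace E] [MeasurableSpace W] [BorelSpace W]
  [mΞ : MeasurableSpace Ξ] {D : Measure Ξ} [IsProbabilityMeasure D]
  {c : Constants} {σ : ℝ} {F G : E → W → ℝ} {Fs Gs : Ξ → E → W → ℝ}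
  {Ω : Type*} {m₀ : MeasurableSpace Ω} [mΩ : MeasurableSpace Ω] {P : Measure Ω} [IsProbabilityMeasure P]

/-- `ζ i` has law `D` and is independent of `m i`, for which the other samples are measurable. -/
structure FreshSamples (P : Measure Ω) (D : Measure Ξ) (m : Fin 5 → MeasurableSpace Ω)
    (ζ : Fin 5 → Ω → Ξ) : Prop where
  le : ∀ i, m i ≤ mΩ
  indep : ∀ i, Indep (m i) (MeasurableSpace.comap (ζ i) mΞ) P
  law : ∀ i, P.map (ζ i) = D
  measurable : ∀ i, Measurable (ζ i)
  measurable_other : ∀ i j, j ≠ i → Measurable[m i] (ζ j)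

theorem Setting.memLp_gradInner_target (H : Setting c D σ F G Fs Gs) {l : Ω → E} {w : Ω → W}
    (hl : Measurable l) (hw : Measurable w) (hlL : MemLp l 2 P) (hwL : MemLp w 2 P) :
    MemLp (fun ω => gradInner G (l ω) (w ω)) 2 P := by
  have h1 := (hwL.sub (memLp_comp_of_lipschitz (H.inner.innerSol_lipschitz H.pos) hlL)).norm.const_mul
    c.LGw
  exact h1.mono' (H.contOracle_gradInner_inner.measurable_target (hl.prodMk hw)).aestronglyMeasurable
    (Filter.Eventually.of_forall fun ω => H.inner.norm_gradInner_le H.pos (l ω) (w ω))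

theorem Setting.memLp_residual (H : Setting c D σ F G Fs Gs) {l : Ω → E} {w v : Ω → W}
    (hl : Measurable l) (hw : Measurable w) (hv : Measurable v) (hvM : ∀ ω, ‖v ω‖ ≤ c.M) :
    MemLp (fun ω => residual F G (l ω) (w ω) (v ω)) 2 P := by
  have h1 := H.contOracle_gradInner.measurable_target (hl.prodMk hw)
  have h2 := H.contOracle_hess.measurable_target ((hl.prodMk hw).prodMk hv)
  exact MemLp.of_bound (h1.sub h2).aestronglyMeasurable (c.CFw + c.LGw * c.M)
    (Filter.Eventually.of_forall fun ω => (norm_sub_le _ _).trans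
      (add_le_add (H.outer.bound_inner _ _)
        ((hessInner G _ _).le_of_opNorm_le_of_le (H.inner.norm_hess_le H.pos _ _) (hvM ω))))

theorem Setting.memLp_hyperGrad (H : Setting c D σ F G Fs Gs) {l : Ω → E} {w v : Ω → W}
    (hl : Measurable l) (hw : Measurable w) (hv : Measurable v) (hvM : ∀ ω, ‖v ω‖ ≤ c.M) :
    MemLp (fun ω => hyperGrad F G (l ω) (w ω) (v ω)) 2 P :=
  MemLp.of_bound (H.measurable_hyperGrad hl hw hv).aestronglyMeasurable (c.CFl + c.CGwl * c.M)
    (Filter.Eventually.of_forall fun ω => norm_hyperGrad_le H.outer H.inner _ _ (hvM ω))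

/-- The offset `A` is left free: the distance to `ω_λ` gives the tracking error, and `A = 0` gives
the increment of `ω`, which disturbs `d`. -/
theorem Setting.integral_inner_step_le (H : Setting c D σ F G Fs Gs)
    (hm : m₀ ≤ mΩ) {Y : Ω → Ξ} (hY : Measurable Y) (hlaw : P.map Y = D)
    (hind : Indep m₀ (MeasurableSpace.comap Y mΞ) P) {l : Ω → E} {w A : Ω → W}
    (hl : Measurable[m₀] l) (hw : Measurable[m₀] w) (hA : Measurable[m₀] A)
    (hlL : MemLp l 2 P) (hwL : MemLp w 2 P) (hAL : MemLp A 2 P) (τ : ℝ) :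
    ∫ ω, ‖A ω - τ • gradInner (Gs (Y ω)) (l ω) (w ω)‖ ^ 2 ∂P
      ≤ ∫ ω, ‖A ω - τ • gradInner G (l ω) (w ω)‖ ^ 2 ∂P + τ ^ 2 * σ ^ 2 := by
  have hl' := hl.mono hm le_rfl
  have hw' := hw.mono hm le_rfl
  have hX : Measurable[m₀] fun ω => (l ω, w ω) := hl.prodMk hw
  have ht := H.contOracle_gradInner_inner.measurable_target hX
  have htL := H.memLp_gradInner_target hl' hw' hlL hwL
  have key := H.contOracle_gradInner_inner.integral_norm_add_smul_sq_le hm hY hlaw hind hX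
    (hA.sub (ht.const_smul τ)) (hAL.sub (htL.const_smul τ))
    (H.memLp_gradInner_inner hY hlaw hl' hw' hlL hwL) htL (-τ)
    (fun ω => H.noise.innerGradG.variance (l ω) (w ω))
  rw [neg_sq] at key
  refine le_of_eq_of_le (integral_congr_ae (Filter.Eventually.of_forall fun ω => ?_)) key
  simp only [Pi.sub_apply, Pi.smul_apply]
  congr 2
  module

/-- The Hessian sample is averaged while the gradient sample counts as known, then the latter is
averaged. The variances `σ²M²` and `σ²` add without a factor two. -/
theorem Setting.integral_residual_step_le (H : Setting c D σ F G Fs Gs)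
    {m : Fin 5 → MeasurableSpace Ω} {ζ : Fin 5 → Ω → Ξ} (hζ : FreshSamples P D m ζ)
    {l : Ω → E} {w v A : Ω → W} (hl : ∀ i, Measurable[m i] l) (hw : ∀ i, Measurable[m i] w)
    (hv : ∀ i, Measurable[m i] v) (hA : ∀ i, Measurable[m i] A) (hvM : ∀ ω, ‖v ω‖ ≤ c.M)
    (hAL : MemLp A 2 P) (β : ℝ) :
    ∫ ω, ‖A ω + β • (gradInner (Fs (ζ 1 ω)) (l ω) (w ω)
        - hessInner (Gs (ζ 2 ω)) (l ω) (w ω) (v ω))‖ ^ 2 ∂P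
      ≤ ∫ ω, ‖A ω + β • residual F G (l ω) (w ω) (v ω)‖ ^ 2 ∂P
        + β ^ 2 * (σ ^ 2 * (1 + c.M ^ 2)) := by
  have hl' := (hl 0).mono (hζ.le 0) le_rfl
  have hw' := (hw 0).mono (hζ.le 0) le_rfl
  have hv' := (hv 0).mono (hζ.le 0) le_rfl
  have hX : ∀ i, Measurable[m i] fun ω => (l ω, w ω) := fun i => (hl i).prodMk (hw i)
  have hZ : ∀ i, Measurable[m i] fun ω => ((l ω, w ω), v ω) := fun i => (hX i).prodMk (hv i)
  have ho1 := H.contOracle_gradInner.measurable (hζ.measurable_other 2 1 (by decide)) (hX 2)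
  have ht2 : ∀ i, Measurable[m i] fun ω => hessInner G (l ω) (w ω) (v ω) := fun i =>
    H.contOracle_hess.measurable_target (hZ i)
  have ht1 := H.contOracle_gradInner.measurable_target (hX 1)
  have ho1L : MemLp (fun ω => gradInner (Fs (ζ 1 ω)) (l ω) (w ω)) 2 P :=
    MemLp.of_bound (ho1.mono (hζ.le 2) le_rfl).aestronglyMeasurable c.CFw
      (Filter.Eventually.of_forall fun ω => (H.outer_sample _).bound_inner _ _)
  have ht1L : MemLp (fun ω => gradInner F (l ω) (w ω)) 2 P :=
    MemLp.of_bound (ht1.mono (hζ.le 1) le_rfl).aestronglyMeasurable c.CFw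
      (Filter.Eventually.of_forall fun ω => H.outer.bound_inner _ _)
  have ho2 := H.contOracle_hess.measurable (hζ.measurable 2) ((hZ 2).mono (hζ.le 2) le_rfl)
  have ho2L : MemLp (fun ω => hessInner (Gs (ζ 2 ω)) (l ω) (w ω) (v ω)) 2 P :=
    MemLp.of_bound ho2.aestronglyMeasurable (c.LGw * c.M)
      (Filter.Eventually.of_forall fun ω => (hessInner (Gs _) _ _).le_of_opNorm_le_of_le
        ((H.inner_sample _).norm_hess_le H.pos _ _) (hvM ω))
  have ht2L : MemLp (fun ω => hessInner G (l ω) (w ω) (v ω)) 2 P :=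
    MemLp.of_bound ((ht2 2).mono (hζ.le 2) le_rfl).aestronglyMeasurable (c.LGw * c.M)
      (Filter.Eventually.of_forall fun ω => (hessInner G _ _).le_of_opNorm_le_of_le
        (H.inner.norm_hess_le H.pos _ _) (hvM ω))
  have key2 := H.contOracle_hess.integral_norm_add_smul_sq_le (hζ.le 2) (hζ.measurable 2)
    (hζ.law 2) (hζ.indep 2) (hZ 2) ((hA 2).add ((ho1.sub (ht2 2)).const_smul β))
    (hAL.add ((ho1L.sub ht2L).const_smul β)) ho2L ht2L (-β)
    (fun ω => H.noise.hessG.variance_apply_le (l ω) (w ω) (hvM ω))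
  have key1 := H.contOracle_gradInner.integral_norm_add_smul_sq_le (hζ.le 1) (hζ.measurable 1)
    (hζ.law 1) (hζ.indep 1) (hX 1) ((hA 1).add ((ht1.sub (ht2 1)).const_smul β))
    (hAL.add ((ht1L.sub ht2L).const_smul β)) ho1L ht1L β
    (fun ω => H.noise.innerGradF.variance (l ω) (w ω))
  have e2 : ∫ ω, ‖A ω + β • (gradInner (Fs (ζ 1 ω)) (l ω) (w ω)
        - hessInner (Gs (ζ 2 ω)) (l ω) (w ω) (v ω))‖ ^ 2 ∂P ≤ _ :=
    le_of_eq_of_le (integral_congr_ae (Filter.Eventually.of_forall fun ω => by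
      simp only [Pi.sub_apply, Pi.smul_apply, Pi.add_apply]
      congr 2
      module)) key2
  have e1 : ∫ ω, ‖A ω + β • (gradInner (Fs (ζ 1 ω)) (l ω) (w ω)
        - hessInner G (l ω) (w ω) (v ω))‖ ^ 2 ∂P ≤ _ :=
    le_of_eq_of_le (integral_congr_ae (Filter.Eventually.of_forall fun ω => by
      simp only [Pi.sub_apply, Pi.smul_apply, Pi.add_apply]
      congr 2
      module)) key1
  simp only [Pi.sub_apply, Pi.smul_apply, Pi.add_apply, neg_sq] at e1 e2
  simp only [residual]
  linarith

/-- The new error is `(1 - η)` times the old one plus two centred terms, one from each sample,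
removed one after the other. The new `ω` and `v` depend on samples `0, 1, 2` of the same iteration,
so they count as known for samples `3` and `4`. -/
theorem Setting.integral_momentum_step_le (H : Setting c D σ F G Fs Gs)
    {m : Fin 5 → MeasurableSpace Ω} {ζ : Fin 5 → Ω → Ξ} (hζ : FreshSamples P D m ζ)
    {l l' d : Ω → E} {w w' v v' : Ω → W}
    (hl : ∀ i, Measurable[m i] l) (hw : ∀ i, Measurable[m i] w) (hv : ∀ i, Measurable[m i] v)
    (hd : ∀ i, Measurable[m i] d) (hl' : ∀ i, Measurable[m i] l')
    (hw'3 : Measurable[m 3] w') (hw'4 : Measurable[m 4] w')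
    (hv'3 : Measurable[m 3] v') (hv'4 : Measurable[m 4] v')
    (hvM : ∀ ω, ‖v ω‖ ≤ c.M) (hvM' : ∀ ω, ‖v' ω‖ ≤ c.M) (hdL : MemLp d 2 P)
    (hlL : MemLp (fun ω => l' ω - l ω) 2 P) (hwL : MemLp (fun ω => w' ω - w ω) 2 P)
    {η : ℝ} (hη0 : 0 ≤ η) (hη1 : η ≤ 1) :
    ∫ ω, ‖hyperGrad F G (l' ω) (w' ω) (v' ω)
        - (stochHyperGrad Fs Gs (ζ 3 ω) (ζ 4 ω) (l' ω) (w' ω) (v' ω)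
          + (1 - η) • (d ω - stochHyperGrad Fs Gs (ζ 3 ω) (ζ 4 ω) (l ω) (w ω) (v ω)))‖ ^ 2 ∂P
      ≤ (1 - η) ^ 2 * ∫ ω, ‖hyperGrad F G (l ω) (w ω) (v ω) - d ω‖ ^ 2 ∂P
        + c.Γ₂sq * (∫ ω, ‖l' ω - l ω‖ ^ 2 ∂P + ∫ ω, ‖w' ω - w ω‖ ^ 2 ∂P)
        + 4 * c.Γ₁sq * ∫ ω, ‖v' ω - v ω‖ ^ 2 ∂P + 2 * η ^ 2 * (σ ^ 2 * (1 + c.M ^ 2)) := by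
  have bl := (hl 3).mono (hζ.le 3) le_rfl
  have bw := (hw 3).mono (hζ.le 3) le_rfl
  have bv := (hv 3).mono (hζ.le 3) le_rfl
  have bl' := (hl' 3).mono (hζ.le 3) le_rfl
  have bw' := hw'3.mono (hζ.le 3) le_rfl
  have bv' := hv'3.mono (hζ.le 3) le_rfl
  have hX : ∀ i, Measurable[m i] fun ω => (l ω, w ω) := fun i => (hl i).prodMk (hw i)
  have hZ : ∀ i, Measurable[m i] fun ω => ((l ω, w ω), v ω) := fun i => (hX i).prodMk (hv i)
  have hX'3 : Measurable[m 3] fun ω => (l' ω, w' ω) := (hl' 3).prodMk hw'3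
  have hX'4 : Measurable[m 4] fun ω => (l' ω, w' ω) := (hl' 4).prodMk hw'4
  have hZ'4 : Measurable[m 4] fun ω => ((l' ω, w' ω), v' ω) := hX'4.prodMk hv'4
  have ho3L : ∀ {a : Ω → E} {b : Ω → W}, Measurable a → Measurable b →
      MemLp (fun ω => gradOuter (Fs (ζ 3 ω)) (a ω) (b ω)) 2 P := fun {a b} ha hb => by
    have h := H.contOracle_gradOuter.measurable (hζ.measurable 3) (ha.prodMk hb)
    exact MemLp.of_bound h.aestronglyMeasurable c.CFl
      (Filter.Eventually.of_forall fun ω => (H.outer_sample _).bound_outer _ _)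
  have ht3L : ∀ {a : Ω → E} {b : Ω → W}, Measurable a → Measurable b →
      MemLp (fun ω => gradOuter F (a ω) (b ω)) 2 P := fun {a b} ha hb => by
    have h := H.contOracle_gradOuter.measurable_target (ha.prodMk hb)
    exact MemLp.of_bound h.aestronglyMeasurable c.CFl
      (Filter.Eventually.of_forall fun ω => H.outer.bound_outer _ _)
  have ho4L : ∀ {a : Ω → E} {b u : Ω → W}, Measurable a → Measurable b → Measurable u →
      (∀ ω, ‖u ω‖ ≤ c.M) → MemLp (fun ω => hessMixed (Gs (ζ 4 ω)) (a ω) (b ω) (u ω)) 2 P :=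
    fun {a b u} ha hb hu huM => by
    have h := H.contOracle_mixed.measurable (hζ.measurable 4) ((ha.prodMk hb).prodMk hu)
    exact MemLp.of_bound h.aestronglyMeasurable (c.CGwl * c.M)
      (Filter.Eventually.of_forall fun ω => (hessMixed (Gs _) _ _).le_of_opNorm_le_of_le
        ((H.inner_sample _).bound_mixed _ _) (huM ω))
  have ht4L : ∀ {a : Ω → E} {b u : Ω → W}, Measurable a → Measurable b → Measurable u →
      (∀ ω, ‖u ω‖ ≤ c.M) → MemLp (fun ω => hessMixed G (a ω) (b ω) (u ω)) 2 P :=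
    fun {a b u} ha hb hu huM => by
    have h := H.contOracle_mixed.measurable_target ((ha.prodMk hb).prodMk hu)
    exact MemLp.of_bound h.aestronglyMeasurable (c.CGwl * c.M)
      (Filter.Eventually.of_forall fun ω => (hessMixed G _ _).le_of_opNorm_le_of_le
        (H.inner.bound_mixed _ _) (huM ω))
  have hvL : MemLp (fun ω => v' ω - v ω) 2 P :=
    (MemLp.of_bound bv'.aestronglyMeasurable c.M (Filter.Eventually.of_forall hvM')).sub
      (MemLp.of_bound bv.aestronglyMeasurable c.M (Filter.Eventually.of_forall hvM))
  have il : Integrable (fun ω => ‖l' ω - l ω‖ ^ 2) P := hlL.integrable_norm_pow (by norm_num)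
  have iw : Integrable (fun ω => ‖w' ω - w ω‖ ^ 2) P := hwL.integrable_norm_pow (by norm_num)
  have iv : Integrable (fun ω => ‖v' ω - v ω‖ ^ 2) P := hvL.integrable_norm_pow (by norm_num)
  have he : ∀ i, Measurable[m i] fun ω => (1 - η) • (hyperGrad F G (l ω) (w ω) (v ω) - d ω) :=
    fun i => ((H.measurable_hyperGrad (hl i) (hw i) (hv i)).sub (hd i)).const_smul (1 - η)
  have heL : MemLp (fun ω => (1 - η) • (hyperGrad F G (l ω) (w ω) (v ω) - d ω)) 2 P :=
    ((H.memLp_hyperGrad bl bw bv hvM).sub hdL).const_smul (1 - η)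
  have key3 := H.contOracle_gradOuter.integral_norm_add_momentum_sq_le (hζ.le 3) (hζ.measurable 3)
    (hζ.law 3) (hζ.indep 3) (hX 3) hX'3 (he 3) heL (ho3L bl bw) (ht3L bl bw) (ho3L bl' bw')
    (ht3L bl' bw') hη0 hη1 (s := σ ^ 2)
    (B := fun ω => c.LFl ^ 2 * (‖l' ω - l ω‖ ^ 2 + ‖w' ω - w ω‖ ^ 2))
    ((il.add iw).const_mul _)
    (fun ω y => (H.outer_sample y).lipschitz_outer.sq_le _ _ _ _)
    (fun ω => H.noise.outerGradF.variance _ _)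
  have hn3 : Measurable[m 4] fun ω => (1 - η) • (hyperGrad F G (l ω) (w ω) (v ω) - d ω)
      + ((1 - η) • (gradOuter (Fs (ζ 3 ω)) (l ω) (w ω) - gradOuter F (l ω) (w ω))
        - (gradOuter (Fs (ζ 3 ω)) (l' ω) (w' ω) - gradOuter F (l' ω) (w' ω))) := by
    have h1 := H.contOracle_gradOuter.measurable (hζ.measurable_other 4 3 (by decide)) (hX 4)
    have h2 := H.contOracle_gradOuter.measurable (hζ.measurable_other 4 3 (by decide)) hX'4
    have h3 := H.contOracle_gradOuter.measurable_target (hX 4)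
    have h4 := H.contOracle_gradOuter.measurable_target hX'4
    exact (he 4).add (((h1.sub h3).const_smul (1 - η)).sub (h2.sub h4))
  have hn3L := heL.add ((((ho3L bl bw).sub (ht3L bl bw)).const_smul (1 - η)).sub
    ((ho3L bl' bw').sub (ht3L bl' bw')))
  -- The mixed derivative enters the estimate with a minus sign, so the lemma is applied to the
  -- negated error.
  have key4 := H.contOracle_mixed.integral_norm_add_momentum_sq_le (hζ.le 4) (hζ.measurable 4)
    (hζ.law 4) (hζ.indep 4) (hZ 4) hZ'4 hn3.neg hn3L.neg (ho4L bl bw bv hvM) (ht4L bl bw bv hvM)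
    (ho4L bl' bw' bv' hvM') (ht4L bl' bw' bv' hvM') hη0 hη1 (s := σ ^ 2 * c.M ^ 2)
    (B := fun ω => 2 * c.LGwl ^ 2 * c.M ^ 2 * (‖l' ω - l ω‖ ^ 2 + ‖w' ω - w ω‖ ^ 2)
      + 2 * c.Γ₁sq * ‖v' ω - v ω‖ ^ 2)
    (((il.add iw).const_mul _).add (iv.const_mul _))
    (fun ω y => by
      have e : hessMixed (Gs y) (l' ω) (w' ω) (v' ω) - hessMixed (Gs y) (l ω) (w ω) (v ω)
          = (hessMixed (Gs y) (l' ω) (w' ω) - hessMixed (Gs y) (l ω) (w ω)) (v ω)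
            + hessMixed (Gs y) (l' ω) (w' ω) (v' ω - v ω) := by
        simp only [sub_apply, map_sub]
        abel
      have h1 := (hessMixed (Gs y) (l' ω) (w' ω) - hessMixed (Gs y) (l ω) (w ω)).le_of_opNorm_le_of_le
        le_rfl (hvM ω)
      have h2 := (hessMixed (Gs y) (l' ω) (w' ω)).le_of_opNorm_le
        ((H.inner_sample y).bound_mixed _ _) (v' ω - v ω)
      have h3 := (H.inner_sample y).lipschitz_mixed.sq_le (l' ω) (l ω) (w' ω) (w ω)
      have h4 := pow_le_pow_left₀ (norm_nonneg _)
        ((norm_add_le _ _).trans (add_le_add h1 h2)) 2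
      rw [e]
      refine h4.trans ?_
      rw [Constants.Γ₁sq]
      nlinarith [sq_nonneg (‖hessMixed (Gs y) (l' ω) (w' ω) - hessMixed (Gs y) (l ω) (w ω)‖ * c.M
        - c.CGwl * ‖v' ω - v ω‖), mul_le_mul_of_nonneg_right h3 (sq_nonneg c.M)])
    (fun ω => H.noise.mixedG.variance_apply_le _ _ (hvM' ω))
  have e4 : ∫ ω, ‖hyperGrad F G (l' ω) (w' ω) (v' ω)
        - (stochHyperGrad Fs Gs (ζ 3 ω) (ζ 4 ω) (l' ω) (w' ω) (v' ω)
          + (1 - η) • (d ω - stochHyperGrad Fs Gs (ζ 3 ω) (ζ 4 ω) (l ω) (w ω) (v ω)))‖ ^ 2 ∂P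
      ≤ _ :=
    le_of_eq_of_le (integral_congr_ae (Filter.Eventually.of_forall fun ω => by
      simp only [Pi.neg_apply]
      rw [← norm_neg (hyperGrad F G (l' ω) (w' ω) (v' ω) - _)]
      congr 2
      simp only [hyperGrad, stochHyperGrad]
      module)) key4
  simp only [Pi.neg_apply, norm_neg] at e4
  have i1 : ∫ ω, ‖(1 - η) • (hyperGrad F G (l ω) (w ω) (v ω) - d ω)‖ ^ 2 ∂P
      = (1 - η) ^ 2 * ∫ ω, ‖hyperGrad F G (l ω) (w ω) (v ω) - d ω‖ ^ 2 ∂P := by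
    rw [← integral_const_mul]
    simp_rw [norm_smul, mul_pow, Real.norm_eq_abs, sq_abs]
  have i2 : ∫ ω, c.LFl ^ 2 * (‖l' ω - l ω‖ ^ 2 + ‖w' ω - w ω‖ ^ 2) ∂P
      = c.LFl ^ 2 * (∫ ω, ‖l' ω - l ω‖ ^ 2 ∂P + ∫ ω, ‖w' ω - w ω‖ ^ 2 ∂P) := by
    rw [integral_const_mul, integral_add il iw]
  have i3 : ∫ ω, (2 * c.LGwl ^ 2 * c.M ^ 2 * (‖l' ω - l ω‖ ^ 2 + ‖w' ω - w ω‖ ^ 2)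
      + 2 * c.Γ₁sq * ‖v' ω - v ω‖ ^ 2) ∂P
      = 2 * c.LGwl ^ 2 * c.M ^ 2 * (∫ ω, ‖l' ω - l ω‖ ^ 2 ∂P + ∫ ω, ‖w' ω - w ω‖ ^ 2 ∂P)
        + 2 * c.Γ₁sq * ∫ ω, ‖v' ω - v ω‖ ^ 2 ∂P := by
    have iD : Integrable (fun ω => ‖l' ω - l ω‖ ^ 2 + ‖w' ω - w ω‖ ^ 2) P := il.add iw
    rw [integral_add (iD.const_mul _) (iv.const_mul _), integral_const_mul,
      integral_const_mul, integral_add il iw]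
  rw [i1, i2] at key3
  rw [i3] at e4
  -- `Γ₂²` is twice the coefficient `L_{F,λ}²` of one sample plus twice the coefficient
  -- `2L_{G,ωλ}²M²` of the other; `4Γ₁²` arises likewise.
  rw [Constants.Γ₂sq]
  linarith

end Moments

/-! ### The decrease in expectation. -/

section Expectation

variable {E W Ξ : Type*}
  [NormedAddCommGroup E] [InnerProductSpace ℝ E] [FiniteDimensional ℝ E] [CompleteSpace E]
  [NormedAddCommGroup W] [InnerProductSpace ℝ W] [FiniteDimensional ℝ W] [CompleteSpace W]
  [MeasurableSpace E] [BorelSpace E] [MeasurableSpace W] [BorelSpace W]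
  [mΞ : MeasurableSpace Ξ] {D : Measure Ξ} [IsProbabilityMeasure D]
  {c : Constants} {σ : ℝ} {F G : E → W → ℝ} {Fs Gs : Ξ → E → W → ℝ}
  {Ω : Type*} [mΩ : MeasurableSpace Ω] {P : Measure Ω} [IsProbabilityMeasure P]
  {s : Ω → State E W}

theorem Setting.integrable_hyperObj (H : Setting c D σ F G Fs Gs) {l : Ω → E} (hl : MemLp l 2 P) :
    Integrable (fun ω => hyperObj F G (l ω)) P :=
  (memLp_comp_of_lipschitz (norm_hyperObj_sub_le H.pos H.outer H.inner) hl).integrable (by norm_num)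

theorem Setting.memLp_innerSol (H : Setting c D σ F G Fs Gs) {l : Ω → E} (hl : MemLp l 2 P) :
    MemLp (fun ω => innerSol G (l ω)) 2 P :=
  memLp_comp_of_lipschitz (H.inner.innerSol_lipschitz H.pos) hl

theorem Setting.memLp_linSol (H : Setting c D σ F G Fs Gs) {l : Ω → E} (hl : MemLp l 2 P) :
    MemLp (fun ω => linSol F G (l ω)) 2 P :=
  memLp_comp_of_lipschitz (norm_linSol_sub_le H.pos H.outer H.inner) hl

theorem Setting.measurable_innerSol (H : Setting c D σ F G Fs Gs) : Measurable (innerSol G) := by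
  have h := H.inner.hasFDerivAt_innerSol H.pos
  exact (continuous_iff_continuousAt.2 fun l => (h l).continuousAt).measurable

theorem Setting.measurable_linSol (H : Setting c D σ F G Fs Gs) : Measurable (linSol F G) :=
  (LipschitzWith.of_dist_le_mul (K := ⟨c.Cv, H.pos.Cv_pos.le⟩) fun x y => by
    rw [dist_eq_norm, dist_eq_norm]
    exact norm_linSol_sub_le H.pos H.outer H.inner x y).continuous.measurable

theorem Setting.memLp_gradient_hyperObj (H : Setting c D σ F G Fs Gs) {l : Ω → E}
    (hl : MemLp l 2 P) : MemLp (fun ω => gradient (hyperObj F G) (l ω)) 2 P :=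
  memLp_comp_of_lipschitz (norm_gradient_hyperObj_sub_le H.pos H.outer H.inner) hl

theorem SquareIntegrableState.memLp_v (hs : MeasurableState mΩ s)
    (hL : SquareIntegrableState c P s) : MemLp (fun ω => (s ω).v) 2 P :=
  MemLp.of_bound hs.v.aestronglyMeasurable c.M (Filter.Eventually.of_forall hL.v)

theorem Setting.memLp_error (H : Setting c D σ F G Fs Gs) (hs : MeasurableState mΩ s)
    (hL : SquareIntegrableState c P s) :
    MemLp (fun ω => hyperGrad F G (s ω).lam (s ω).om (s ω).v - (s ω).d) 2 P :=
  (H.memLp_hyperGrad hs.lam hs.om hs.v hL.v).sub hL.d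

theorem integral_weighted_sum {a x y e : Ω → ℝ} (ha : Integrable a P) (hx : Integrable x P)
    (hy : Integrable y P) (he : Integrable e P) (p q r : ℝ) :
    Integrable (fun ω => a ω + p * x ω + q * y ω + e ω / r) P ∧
    ∫ ω, (a ω + p * x ω + q * y ω + e ω / r) ∂P
      = ∫ ω, a ω ∂P + p * ∫ ω, x ω ∂P + q * ∫ ω, y ω ∂P + (∫ ω, e ω ∂P) / r := by
  have h1 : Integrable (fun ω => a ω + p * x ω) P := ha.add (hx.const_mul p)
  have h2 : Integrable (fun ω => a ω + p * x ω + q * y ω) P := h1.add (hy.const_mul q)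
  refine ⟨h2.add (he.div_const r), ?_⟩
  rw [integral_add h2 (he.div_const r), integral_add h1 (hy.const_mul q),
    integral_add ha (hx.const_mul p), integral_const_mul, integral_const_mul, integral_div]

theorem Setting.integral_lyapunov (H : Setting c D σ F G Fs Gs) (hs : MeasurableState mΩ s)
    (hL : SquareIntegrableState c P s) :
    Integrable (fun ω => lyapunov c F G (s ω)) P ∧
    ∫ ω, lyapunov c F G (s ω) ∂P = ∫ ω, hyperObj F G (s ω).lam ∂P
      + c.Γ₂sq / 2 * ∫ ω, ‖(s ω).om - innerSol G (s ω).lam‖ ^ 2 ∂P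
      + 2 * c.Γ₁sq * ∫ ω, ‖(s ω).v - linSol F G (s ω).lam‖ ^ 2 ∂P
      + (∫ ω, ‖hyperGrad F G (s ω).lam (s ω).om (s ω).v - (s ω).d‖ ^ 2 ∂P) / (2 * c.cη) :=
  integral_weighted_sum (H.integrable_hyperObj hL.lam)
    ((hL.om.sub (H.memLp_innerSol hL.lam)).integrable_norm_pow (by norm_num))
    (((hL.memLp_v hs).sub (H.memLp_linSol hL.lam)).integrable_norm_pow (by norm_num))
    ((H.memLp_error hs hL).integrable_norm_pow (by norm_num)) _ _ _

theorem Setting.integrable_potential (H : Setting c D σ F G Fs Gs) (hs : MeasurableState mΩ s)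
    (hL : SquareIntegrableState c P s) : Integrable (fun ω => potential c F G (s ω)) P :=
  (integral_weighted_sum (H.integrable_hyperObj hL.lam)
    ((hL.om.sub (H.memLp_innerSol hL.lam)).integrable_norm_pow (by norm_num))
    (((hL.memLp_v hs).sub (H.memLp_linSol hL.lam)).integrable_norm_pow (by norm_num))
    ((H.memLp_error hs hL).integrable_norm_pow (by norm_num)) _ _ _).1

/-- The noise of `ω` and `v` counts twice: in their own errors and, through the increments, in the
error of `d`. The direct parts match half of `C̄` exactly; `C_{d,n}` has a spare factor two in its
first two summands. -/
theorem Constants.Positive.noise_le (hc : c.Positive) :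
    c.Γ₂sq / 2 * c.cτ ^ 2 + 2 * c.Γ₁sq * (c.cβ ^ 2 * (1 + c.M ^ 2))
      + (c.Γ₂sq * c.cτ ^ 2 + 4 * c.Γ₁sq * (c.cβ ^ 2 * (1 + c.M ^ 2))
        + 2 * c.cη ^ 2 * (1 + c.M ^ 2)) / (2 * c.cη) ≤ c.Cbar / 2 := by
  have hη := hc.cη_pos
  have g1 := hc.Γ₁sq_pos
  have g2 := hc.Γ₂sq_pos
  have h1 : (c.Γ₂sq * c.cτ ^ 2 + 4 * c.Γ₁sq * (c.cβ ^ 2 * (1 + c.M ^ 2))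
        + 2 * c.cη ^ 2 * (1 + c.M ^ 2)) / (2 * c.cη) ≤ c.Cdn / (2 * c.cη) := by
    refine div_le_div_of_nonneg_right ?_ (by positivity)
    rw [Constants.Cdn]
    have h2 : 0 ≤ c.Γ₂sq * c.cτ ^ 2 := by positivity
    have h3 : 0 ≤ c.Γ₁sq * (c.cβ ^ 2 * (1 + c.M ^ 2)) := by positivity
    linarith
  have h4 : c.Cdn / (2 * c.cη) = c.Cdn / c.cη / 2 := by field_simp
  rw [Constants.Cbar, Constants.Cvn, Constants.Cωn]
  linarith

theorem Constants.Positive.Cbar_nonneg (hc : c.Positive) : 0 ≤ c.Cbar := by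
  have hη := hc.cη_pos
  have g1 := hc.Γ₁sq_pos
  have g2 := hc.Γ₂sq_pos
  have : 0 ≤ c.Γ₂sq / 2 * c.cτ ^ 2 + 2 * c.Γ₁sq * (c.cβ ^ 2 * (1 + c.M ^ 2))
      + (c.Γ₂sq * c.cτ ^ 2 + 4 * c.Γ₁sq * (c.cβ ^ 2 * (1 + c.M ^ 2))
        + 2 * c.cη ^ 2 * (1 + c.M ^ 2)) / (2 * c.cη) := by positivity
  linarith [hc.noise_le]

/-- The expected decrease of the Lyapunov function in one iteration. -/
theorem Setting.expected_decrease (H : Setting c D σ F G Fs Gs) {α : ℝ} (hα : c.SmallStep α)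
    {m : Fin 5 → MeasurableSpace Ω} {ζ : Fin 5 → Ω → Ξ} (hζ : FreshSamples P D m ζ)
    (hs : ∀ i, MeasurableState (m i) s) (hsΩ : MeasurableState mΩ s)
    (hL : SquareIntegrableState c P s) :
    ∫ ω, lyapunov c F G (step c Fs Gs α (fun i => ζ i ω) (s ω)) ∂P
      ≤ ∫ ω, lyapunov c F G (s ω) ∂P
        - α / 2 * ∫ ω, ‖gradient (hyperObj F G) (s ω).lam‖ ^ 2 ∂P
        + α ^ 2 * (σ ^ 2 * (c.Cbar / 2)) := by
  have hc := H.pos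
  have g1 := hc.Γ₁sq_pos
  have g2 := hc.Γ₂sq_pos
  have hη := hc.cη_pos
  have hα0 := hα.pos
  have hsΩ' := hsΩ.next (α := α) H hζ.measurable
  have hL' := hL.next H hα hsΩ hζ.measurable hζ.law
  have hlm : ∀ i, Measurable[m i] fun ω => (s ω).lam - α • (s ω).d := fun i =>
    (hs i).lam.sub ((hs i).d.const_smul α)
  have hlL : MemLp (fun ω => (s ω).lam - α • (s ω).d) 2 P := hL'.lam
  have hvL := hL.memLp_v hsΩ
  have hωm : ∀ i, Measurable[m i] fun ω => innerSol G ((s ω).lam - α • (s ω).d) := fun i =>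
    H.measurable_innerSol.comp (hlm i)
  have hvm : ∀ i, Measurable[m i] fun ω => linSol F G ((s ω).lam - α • (s ω).d) := fun i =>
    H.measurable_linSol.comp (hlm i)
  have hωL := H.memLp_innerSol hlL
  have hvsL := H.memLp_linSol hlL
  have hom := H.integral_inner_step_le (hζ.le 0) (hζ.measurable 0) (hζ.law 0) (hζ.indep 0) (hlm 0)
    (hs 0).om ((hs 0).om.sub (hωm 0)) hlL hL.om (hL.om.sub hωL) (c.cτ * α)
  -- With zero offset these bound the expected squared increments, which drive the error of `d`.
  have hdom := H.integral_inner_step_le (A := fun _ => 0) (hζ.le 0) (hζ.measurable 0) (hζ.law 0)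
    (hζ.indep 0) (hlm 0) (hs 0).om measurable_const hlL hL.om (memLp_const 0) (c.cτ * α)
  have hv := H.integral_residual_step_le hζ hlm (fun i => (hs i).om) (fun i => (hs i).v)
    (fun i => (hs i).v.sub (hvm i)) hL.v (hvL.sub hvsL) (c.cβ * α)
  have hdv := H.integral_residual_step_le (A := fun _ => 0) hζ hlm (fun i => (hs i).om)
    (fun i => (hs i).v) (fun i => measurable_const) hL.v (memLp_const 0) (c.cβ * α)
  have hd := H.integral_momentum_step_le hζ (fun i => (hs i).lam) (fun i => (hs i).om)
    (fun i => (hs i).v) (fun i => (hs i).d) hlm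
    ((hs 3).step_om (α := α) H (hζ.measurable_other 3 0 (by decide)))
    ((hs 4).step_om (α := α) H (hζ.measurable_other 4 0 (by decide)))
    ((hs 3).step_v (α := α) H (hζ.measurable_other 3 1 (by decide))
      (hζ.measurable_other 3 2 (by decide)))
    ((hs 4).step_v (α := α) H (hζ.measurable_other 4 1 (by decide))
      (hζ.measurable_other 4 2 (by decide)))
    hL.v hL'.v hL.d (hlL.sub hL.lam) (hL'.om.sub hL.om) (η := c.cη * α)
    (mul_pos hη hα0).le (by linarith [hα.η_le])
  have edl : ∀ ω, ‖(s ω).lam - α • (s ω).d - (s ω).lam‖ = ‖α • (s ω).d‖ := fun ω => by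
    rw [sub_sub_cancel_left, norm_neg]
  have edw : ∀ ω, ‖(step c Fs Gs α (fun i => ζ i ω) (s ω)).om - (s ω).om‖
      = ‖0 - (c.cτ * α) • gradInner (Gs (ζ 0 ω)) ((s ω).lam - α • (s ω).d) (s ω).om‖ := fun ω => by
    rw [step_om, sub_sub_cancel_left, zero_sub]
    rfl
  have edv : ∀ ω, ‖(step c Fs Gs α (fun i => ζ i ω) (s ω)).v - (s ω).v‖
      = ‖0 + (c.cβ * α) • (gradInner (Fs (ζ 1 ω)) ((s ω).lam - α • (s ω).d) (s ω).om
        - hessInner (Gs (ζ 2 ω)) ((s ω).lam - α • (s ω).d) (s ω).om (s ω).v)‖ := fun ω => by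
    rw [step_v, add_sub_cancel_left, zero_add]
    rfl
  simp_rw [edl, edw, edv] at hd
  have eom : ∀ ω, ‖(step c Fs Gs α (fun i => ζ i ω) (s ω)).om
        - innerSol G (step c Fs Gs α (fun i => ζ i ω) (s ω)).lam‖
      = ‖((s ω).om - innerSol G ((s ω).lam - α • (s ω).d))
        - (c.cτ * α) • gradInner (Gs (ζ 0 ω)) ((s ω).lam - α • (s ω).d) (s ω).om‖ := fun ω => by
    rw [step_om, sub_right_comm]
    rfl
  have ev : ∀ ω, ‖(step c Fs Gs α (fun i => ζ i ω) (s ω)).v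
        - linSol F G (step c Fs Gs α (fun i => ζ i ω) (s ω)).lam‖
      = ‖((s ω).v - linSol F G ((s ω).lam - α • (s ω).d))
        + (c.cβ * α) • (gradInner (Fs (ζ 1 ω)) ((s ω).lam - α • (s ω).d) (s ω).om
        - hessInner (Gs (ζ 2 ω)) ((s ω).lam - α • (s ω).d) (s ω).om (s ω).v)‖ := fun ω => by
    rw [step_v, add_sub_right_comm]
    rfl
  have hsplit := (H.integral_lyapunov hsΩ' hL').2
  simp_rw [eom, ev] at hsplit
  have hgL := H.memLp_gradInner_target ((hlm 0).mono (hζ.le 0) le_rfl) hsΩ.om hlL hL.om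
  have hRL := H.memLp_residual (P := P) ((hlm 0).mono (hζ.le 0) le_rfl) hsΩ.om hsΩ.v hL.v
  have i1 := (H.memLp_error hsΩ hL).integrable_norm_pow (p := 2) (by norm_num)
  have i2 := (hL.d.const_smul α).integrable_norm_pow (p := 2) (by norm_num)
  have i3 := hgL.integrable_norm_pow (p := 2) (by norm_num)
  have i4 := hRL.integrable_norm_pow (p := 2) (by norm_num)
  have i5 := ((hL.om.sub hωL).sub (hgL.const_smul (c.cτ * α))).integrable_norm_pow (p := 2)
    (by norm_num)
  have i6 := ((hvL.sub hvsL).add (hRL.const_smul (c.cβ * α))).integrable_norm_pow (p := 2)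
    (by norm_num)
  have i7 := (H.memLp_gradient_hyperObj hL.lam).integrable_norm_pow (p := 2) (by norm_num)
  simp only [Pi.sub_apply, Pi.add_apply, Pi.smul_apply] at i1 i2 i3 i4 i5 i6 i7
  have j1 : Integrable (fun ω => c.Γ₂sq * (‖α • (s ω).d‖ ^ 2 + (c.cτ * α) ^ 2
      * ‖gradInner G ((s ω).lam - α • (s ω).d) (s ω).om‖ ^ 2)) P :=
    (i2.add (i3.const_mul _)).const_mul _
  have j2 : Integrable (fun ω => 4 * c.Γ₁sq * ((c.cβ * α) ^ 2
      * ‖residual F G ((s ω).lam - α • (s ω).d) (s ω).om (s ω).v‖ ^ 2)) P :=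
    (i4.const_mul _).const_mul _
  have j3 : Integrable (fun ω => (1 - c.cη * α) ^ 2
      * ‖hyperGrad F G (s ω).lam (s ω).om (s ω).v - (s ω).d‖ ^ 2
      + c.Γ₂sq * (‖α • (s ω).d‖ ^ 2 + (c.cτ * α) ^ 2
        * ‖gradInner G ((s ω).lam - α • (s ω).d) (s ω).om‖ ^ 2)) P := (i1.const_mul _).add j1
  have hmean := integral_weighted_sum (H.integrable_hyperObj hlL) i5 i6 (j3.add j2)
    (c.Γ₂sq / 2) (2 * c.Γ₁sq) (2 * c.cη)
  simp only [Pi.add_apply] at hmean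
  have hlyap := H.integral_lyapunov hsΩ hL
  have hmono := integral_mono hmean.1 (hlyap.1.sub (i7.const_mul (α / 2))) (fun ω => by
    have := mean_decrease hc H.outer H.inner hα (s ω).lam (s ω).d (s ω).om (hL.v ω)
    simpa only [Pi.sub_apply, sub_right_comm (s ω).om, add_sub_right_comm (s ω).v] using this)
  simp only [Pi.sub_apply] at hmono
  have j4 : Integrable (fun ω => ‖α • (s ω).d‖ ^ 2 + (c.cτ * α) ^ 2
      * ‖gradInner G ((s ω).lam - α • (s ω).d) (s ω).om‖ ^ 2) P := i2.add (i3.const_mul _)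
  rw [hmean.2, integral_add j3 j2, integral_add (i1.const_mul _) j1, integral_const_mul,
    integral_const_mul, integral_const_mul, integral_const_mul, integral_add i2 (i3.const_mul _),
    integral_const_mul, integral_sub hlyap.1 (i7.const_mul _), integral_const_mul] at hmono
  have z1 : ∫ ω, ‖(0 : W) - (c.cτ * α) • gradInner G ((s ω).lam - α • (s ω).d) (s ω).om‖ ^ 2 ∂P
      = (c.cτ * α) ^ 2 * ∫ ω, ‖gradInner G ((s ω).lam - α • (s ω).d) (s ω).om‖ ^ 2 ∂P := by
    rw [← integral_const_mul]
    simp_rw [zero_sub, norm_neg, norm_smul, mul_pow, Real.norm_eq_abs, sq_abs, mul_pow]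
  have z2 : ∫ ω, ‖(0 : W)
        + (c.cβ * α) • residual F G ((s ω).lam - α • (s ω).d) (s ω).om (s ω).v‖ ^ 2 ∂P
      = (c.cβ * α) ^ 2
        * ∫ ω, ‖residual F G ((s ω).lam - α • (s ω).d) (s ω).om (s ω).v‖ ^ 2 ∂P := by
    rw [← integral_const_mul]
    simp_rw [zero_add, norm_smul, mul_pow, Real.norm_eq_abs, sq_abs, mul_pow]
  rw [z1] at hdom
  rw [z2] at hdv
  simp only [Pi.sub_apply] at hom hv
  have hd' := div_le_div_of_nonneg_right (hd.trans (add_le_add_left (add_le_add (add_le_add_right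
    (mul_le_mul_of_nonneg_left (add_le_add_right hdom _) g2.le) _)
    (mul_le_mul_of_nonneg_left hdv (show 0 ≤ 4 * c.Γ₁sq by positivity))) _))
    (show 0 ≤ 2 * c.cη by positivity)
  have hom' := mul_le_mul_of_nonneg_left hom (show 0 ≤ c.Γ₂sq / 2 by positivity)
  have hv' := mul_le_mul_of_nonneg_left hv (show 0 ≤ 2 * c.Γ₁sq by positivity)
  have hnoise := mul_le_mul_of_nonneg_left hc.noise_le (show 0 ≤ α ^ 2 * σ ^ 2 by positivity)
  rw [hsplit]
  have hfin := add_le_add (add_le_add hom' hv') hd'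
  have hlam : ∫ ω, hyperObj F G (step c Fs Gs α (fun i => ζ i ω) (s ω)).lam ∂P
    = ∫ ω, hyperObj F G ((s ω).lam - α • (s ω).d) ∂P := rfl
  rw [hlam]
  have hstep_d : ∫ ω, ‖hyperGrad F G (step c Fs Gs α (fun i => ζ i ω) (s ω)).lam
        (step c Fs Gs α (fun i => ζ i ω) (s ω)).om (step c Fs Gs α (fun i => ζ i ω) (s ω)).v
        - (step c Fs Gs α (fun i => ζ i ω) (s ω)).d‖ ^ 2 ∂P
      = ∫ ω, ‖hyperGrad F G ((s ω).lam - α • (s ω).d)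
        (step c Fs Gs α (fun i => ζ i ω) (s ω)).om (step c Fs Gs α (fun i => ζ i ω) (s ω)).v
        - (stochHyperGrad Fs Gs (ζ 3 ω) (ζ 4 ω) ((s ω).lam - α • (s ω).d)
          (step c Fs Gs α (fun i => ζ i ω) (s ω)).om (step c Fs Gs α (fun i => ζ i ω) (s ω)).v
          + (1 - c.cη * α) • ((s ω).d - stochHyperGrad Fs Gs (ζ 3 ω) (ζ 4 ω) (s ω).lam (s ω).om
            (s ω).v))‖ ^ 2 ∂P := rfl
  rw [hstep_d]
  rw [div_eq_mul_inv _ (2 * c.cη)] at hmono hnoise ⊢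
  simp only [div_eq_mul_inv _ (2 * c.cη)] at hfin
  generalize (2 * c.cη)⁻¹ = t at hfin hmono hnoise ⊢
  linarith only [hfin, hmono, hnoise]

end Expectation

/-! ### The iterates, telescoping and averaging. -/

theorem sum_inv_le_two_mul_log (K : ℕ) :
    ∑ k ∈ Finset.range K, 1 / ((k : ℝ) + 1) ≤ 2 * Real.log ((K : ℝ) + 1) := by
  induction K with
  | zero => simp
  | succ K ih =>
    rw [Finset.sum_range_succ]
    -- The increment of the logarithm is at least `1/(K+2)` by `log x ≥ 1 - 1/x`, and `1/(K+1) ≤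
    -- 2/(K+2)`.
    have hK : (0 : ℝ) < (K : ℝ) + 1 := by positivity
    have h1 := Real.one_sub_inv_le_log_of_pos (show 0 < ((K : ℝ) + 1 + 1) / ((K : ℝ) + 1) by
      positivity)
    rw [Real.log_div (by positivity) hK.ne', inv_div] at h1
    have h2 : 1 / ((K : ℝ) + 1) ≤ 2 * (1 - ((K : ℝ) + 1) / ((K : ℝ) + 1 + 1)) := by
      have h3 : 1 - ((K : ℝ) + 1) / ((K : ℝ) + 1 + 1) = 1 / ((K : ℝ) + 1 + 1) := by
        field_simp
        ring
      rw [h3, mul_one_div, div_le_div_iff₀ hK (by positivity)]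
      have : (0 : ℝ) ≤ K := K.cast_nonneg
      linarith
    push_cast
    linarith

section Iteration

variable {E W Ξ : Type*}
  [NormedAddCommGroup E] [InnerProductSpace ℝ E] [FiniteDimensional ℝ E] [CompleteSpace E]
  [NormedAddCommGroup W] [InnerProductSpace ℝ W] [FiniteDimensional ℝ W] [CompleteSpace W]
  [MeasurableSpace E] [BorelSpace E] [MeasurableSpace W] [BorelSpace W]
  [mΞ : MeasurableSpace Ξ] {D : Measure Ξ} [IsProbabilityMeasure D]
  {c : Constants} {σ δ : ℝ} {F G : E → W → ℝ} {Fs Gs : Ξ → E → W → ℝ}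
  {Ω : Type*} {ξ : ℕ × Fin 5 → Ω → Ξ} {lam₀ : E} {om₀ v₀ : W} {d₀ : Ω → E}

/-- The σ-algebra is arbitrary, so that this serves both the ambient one and those omitting a sample
of iteration `k`. -/
theorem Setting.measurableState_iterate (H : Setting c D σ F G Fs Gs) {m : MeasurableSpace Ω}
    (hd₀ : Measurable[m] d₀) (k : ℕ) (hξ : ∀ q : ℕ × Fin 5, q.1 < k → Measurable[m] (ξ q)) :
    MeasurableState m fun x => iterate c Fs Gs δ (fun p => ξ p x) ⟨lam₀, om₀, v₀, d₀ x⟩ k := by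
  induction k with
  | zero => exact ⟨measurable_const, measurable_const, measurable_const, hd₀⟩
  | succ k ih =>
    exact (ih fun q hq => hξ q (hq.trans k.lt_succ_self)).next H
      (fun i => hξ (k, i) k.lt_succ_self)

variable [mΩ : MeasurableSpace Ω] {P : Measure Ω} [IsProbabilityMeasure P]

theorem stepSize_pos (hδ : 0 < δ) (k : ℕ) : 0 < stepSize δ k := by
  unfold stepSize
  positivity

theorem stepSize_le (hδ : 0 < δ) (k : ℕ) : stepSize δ k ≤ δ :=
  div_le_self hδ.le (Real.one_le_sqrt.2 (by have : (0 : ℝ) ≤ k := k.cast_nonneg; linarith))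

theorem Setting.squareIntegrableState_iterate (H : Setting c D σ F G Fs Gs)
    (hα : ∀ k, c.SmallStep (stepSize δ k)) (hξ : ∀ p, Measurable (ξ p))
    (hlaw : ∀ p, P.map (ξ p) = D) (hv₀ : ‖v₀‖ ≤ c.M) (hd₀ : Measurable d₀) (hd₀L : MemLp d₀ 2 P)
    (k : ℕ) : SquareIntegrableState c P fun x =>
      iterate c Fs Gs δ (fun p => ξ p x) ⟨lam₀, om₀, v₀, d₀ x⟩ k := by
  induction k with
  | zero => exact ⟨memLp_const _, memLp_const _, fun _ => hv₀, hd₀L⟩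
  | succ k ih =>
    exact ih.next H (hα k) (H.measurableState_iterate hd₀ k fun q _ => hξ q)
      (fun i => hξ (k, i)) (fun i => hlaw (k, i))

theorem freshSamples_of_iIndepFun (hξ : ∀ p, Measurable (ξ p)) (hlaw : ∀ p, P.map (ξ p) = D)
    (hind : iIndepFun ξ P) (hd₀ : Measurable d₀) (hdξ : IndepFun d₀ (fun x p => ξ p x) P) (k : ℕ) :
    FreshSamples P D (fun i => othersAlgebra d₀ ξ (k, i)) (fun i => ξ (k, i)) where
  le i := othersAlgebra_le hd₀ hξ (k, i)
  indep i := indep_othersAlgebra hd₀ hξ hind hdξ (k, i)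
  law i := hlaw (k, i)
  measurable i := hξ (k, i)
  measurable_other i j h := measurable_sample_othersAlgebra d₀ ξ (by simpa using h)

theorem Setting.sum_expected_gradient_le (H : Setting c D σ F G Fs Gs)
    (hα : ∀ k, c.SmallStep (stepSize δ k)) (hξ : ∀ p, Measurable (ξ p))
    (hlaw : ∀ p, P.map (ξ p) = D) (hind : iIndepFun ξ P) (hv₀ : ‖v₀‖ ≤ c.M)
    (hd₀ : Measurable d₀) (hd₀L : MemLp d₀ 2 P) (hdξ : IndepFun d₀ (fun x p => ξ p x) P) (K : ℕ) :
    ∫ x, lyapunov c F G (iterate c Fs Gs δ (fun p => ξ p x) ⟨lam₀, om₀, v₀, d₀ x⟩ K) ∂P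
      + ∑ k ∈ Finset.range K, stepSize δ k / 2 * ∫ x, ‖gradient (hyperObj F G)
          (iterate c Fs Gs δ (fun p => ξ p x) ⟨lam₀, om₀, v₀, d₀ x⟩ k).lam‖ ^ 2 ∂P
      ≤ ∫ x, lyapunov c F G ⟨lam₀, om₀, v₀, d₀ x⟩ ∂P
        + (∑ k ∈ Finset.range K, stepSize δ k ^ 2) * (σ ^ 2 * (c.Cbar / 2)) := by
  induction K with
  | zero => simp [iterate]
  | succ K ih =>
    have h := H.expected_decrease (hα K)
      (freshSamples_of_iIndepFun hξ hlaw hind hd₀ hdξ K)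
      (s := fun x => iterate c Fs Gs δ (fun p => ξ p x) ⟨lam₀, om₀, v₀, d₀ x⟩ K)
      -- State `K` uses only samples with first index below `K`, so the omitted sample `(K, i)` is
      -- not among them.
      (fun i => H.measurableState_iterate (measurable_init_othersAlgebra d₀ ξ (K, i)) K
        fun q hq => measurable_sample_othersAlgebra d₀ ξ fun h => by simp [h] at hq)
      (H.measurableState_iterate hd₀ K fun q _ => hξ q)
      (H.squareIntegrableState_iterate hα hξ hlaw hv₀ hd₀ hd₀L K)
    rw [Finset.sum_range_succ, Finset.sum_range_succ, add_mul]
    have e : ∫ x, lyapunov c F G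
          (iterate c Fs Gs δ (fun p => ξ p x) ⟨lam₀, om₀, v₀, d₀ x⟩ (K + 1)) ∂P
        = ∫ x, lyapunov c F G (step c Fs Gs (stepSize δ K) (fun i => ξ (K, i) x)
          (iterate c Fs Gs δ (fun p => ξ p x) ⟨lam₀, om₀, v₀, d₀ x⟩ K)) ∂P := rfl
    rw [e]
    linarith

/-- For `k < K` every step size is at least `δ/√K`, while the squared step sizes sum to at most `2δ²
ln(K+1)`. -/
theorem average_le_of_weighted_sum_le {δ A C : ℝ} {g : ℕ → ℝ} (hδ : 0 < δ) (hC : 0 ≤ C)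
    (hg : ∀ k, 0 ≤ g k) {K : ℕ} (hK : 1 ≤ K)
    (h : ∑ k ∈ Finset.range K, stepSize δ k / 2 * g k
      ≤ A + (∑ k ∈ Finset.range K, stepSize δ k ^ 2) * (C / 2)) :
    1 / (K : ℝ) * ∑ k ∈ Finset.range K, g k
      ≤ 2 * A / (δ * √(K : ℝ)) + 2 * δ * C * Real.log ((K : ℝ) + 1) / √(K : ℝ) := by
  have hK0 : (0 : ℝ) < K := by exact_mod_cast hK
  have hs : 0 < √(K : ℝ) := Real.sqrt_pos.2 hK0
  have hss : √(K : ℝ) * √(K : ℝ) = K := Real.mul_self_sqrt hK0.le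
  have h1 : δ / √(K : ℝ) / 2 * ∑ k ∈ Finset.range K, g k
      ≤ ∑ k ∈ Finset.range K, stepSize δ k / 2 * g k := by
    rw [Finset.mul_sum]
    refine Finset.sum_le_sum fun k hk => mul_le_mul_of_nonneg_right ?_ (hg k)
    have hk' : (k : ℝ) + 1 ≤ K := by exact_mod_cast Finset.mem_range.1 hk
    unfold stepSize
    gcongr
  have h2 : ∑ k ∈ Finset.range K, stepSize δ k ^ 2 ≤ δ ^ 2 * (2 * Real.log ((K : ℝ) + 1)) := by
    refine le_trans (le_of_eq ?_) (mul_le_mul_of_nonneg_left (sum_inv_le_two_mul_log K)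
      (sq_nonneg δ))
    rw [Finset.mul_sum]
    refine Finset.sum_congr rfl fun k _ => ?_
    rw [stepSize, div_pow, Real.sq_sqrt (by positivity), mul_one_div]
  have h3 := h1.trans (h.trans (add_le_add_right
    (mul_le_mul_of_nonneg_right h2 (show 0 ≤ C / 2 by positivity)) _))
  have h4 := mul_le_mul_of_nonneg_left h3 (show 0 ≤ 2 / (δ * √(K : ℝ)) by positivity)
  calc 1 / (K : ℝ) * ∑ k ∈ Finset.range K, g k
      = 2 / (δ * √(K : ℝ)) * (δ / √(K : ℝ) / 2 * ∑ k ∈ Finset.range K, g k) := by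
        have hinv : 1 / (K : ℝ) = 2 / (δ * √(K : ℝ)) * (δ / √(K : ℝ) / 2) := by
          field_simp
          rw [sq, hss]
        rw [hinv, mul_assoc]
    _ ≤ _ := h4
    _ = _ := by
        field_simp

end Iteration

end FSLA

end

/-! ### The convergence theorem. -/

theorem theorem5 (c : FSLA.Constants) (hc : c.Positive) :
    ∃ δ₀ : ℝ, 0 < δ₀ ∧
      ∀ (m n : ℕ)
        (F G : EuclideanSpace ℝ (Fin m) → EuclideanSpace ℝ (Fin n) → ℝ)
        (Ξ : Type*) [MeasurableSpace Ξ] (D : Measure Ξ)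
        (Fs Gs : Ξ → EuclideanSpace ℝ (Fin m) → EuclideanSpace ℝ (Fin n) → ℝ)
        (σ : ℝ)
        (_ : FSLA.OuterAssumption c F) (_ : FSLA.InnerAssumption c G)
        (_ : ∀ ξ, FSLA.OuterAssumption c (Fs ξ)) (_ : ∀ ξ, FSLA.InnerAssumption c (Gs ξ))
        (_ : FSLA.NoiseAssumption D σ F G Fs Gs)
        (fLow : ℝ) (_ : ∀ l, fLow ≤ FSLA.hyperObj F G l)
        (Ω : Type*) [MeasurableSpace Ω] (P : Measure Ω) [IsProbabilityMeasure P]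
        (ξ : ℕ × Fin 5 → Ω → Ξ) (_ : ∀ p, Measurable (ξ p)) (_ : ∀ p, P.map (ξ p) = D)
        (_ : iIndepFun ξ P)
        (lam₀ : EuclideanSpace ℝ (Fin m)) (om₀ v₀ : EuclideanSpace ℝ (Fin n))
        (_ : ‖v₀‖ ≤ c.M)
        (d₀ : Ω → EuclideanSpace ℝ (Fin m)) (_ : Measurable d₀) (_ : MemLp d₀ 2 P)
        (_ : IndepFun d₀ (fun x p => ξ p x) P)
        (δ : ℝ) (_ : 0 < δ) (_ : δ ≤ δ₀),
        let s : ℕ → Ω → FSLA.State (EuclideanSpace ℝ (Fin m)) (EuclideanSpace ℝ (Fin n)) :=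
          fun k x => FSLA.iterate c Fs Gs δ (fun p => ξ p x) ⟨lam₀, om₀, v₀, d₀ x⟩ k
        let f := FSLA.hyperObj F G
        let Φ₀ := ∫ x, FSLA.potential c F G (s 0 x) ∂P
        Differentiable ℝ f ∧
        (∀ k, Integrable (fun x => ‖gradient f (s k x).lam‖ ^ 2) P) ∧
        ∀ K : ℕ, 1 ≤ K →
          1 / (K : ℝ) * ∑ k ∈ Finset.range K, ∫ x, ‖gradient f (s k x).lam‖ ^ 2 ∂P
            ≤ 2 * (Φ₀ - fLow) / (δ * √(K : ℝ))
              + 2 * δ * c.Cbar * σ ^ 2 * Real.log ((K : ℝ) + 1) / √(K : ℝ) := by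
  obtain ⟨δ₀, hδ₀, hsmall⟩ := hc.exists_smallStep
  refine ⟨δ₀, hδ₀, ?_⟩
  intro m n F G Ξ _ D Fs Gs σ hF hG hFs hGs hN fLow hlow Ω _ P _ ξ hξ hlaw hind lam₀ om₀ v₀ hv₀ d₀
    hd₀ hd₀L hdξ δ hδ hδle s f Φ₀
  have : IsProbabilityMeasure D :=
    hlaw (0, 0) ▸ Measure.isProbabilityMeasure_map (hξ (0, 0)).aemeasurable
  have H : FSLA.Setting c D σ F G Fs Gs := ⟨hc, hF, hG, hFs, hGs, hN⟩
  have hα : ∀ k, c.SmallStep (FSLA.stepSize δ k) := fun k =>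
    hsmall _ (FSLA.stepSize_pos hδ k) ((FSLA.stepSize_le hδ k).trans hδle)
  have hms : ∀ k, FSLA.MeasurableState _ (s k) := fun k =>
    H.measurableState_iterate hd₀ k fun q _ => hξ q
  have hLs : ∀ k, FSLA.SquareIntegrableState c P (s k) := fun k =>
    H.squareIntegrableState_iterate hα hξ hlaw hv₀ hd₀ hd₀L k
  refine ⟨fun l => (FSLA.hasGradientAt_hyperObj hc hF hG l).differentiableAt, fun k =>
    (H.memLp_gradient_hyperObj (hLs k).lam).integrable_norm_pow (by norm_num), fun K hK => ?_⟩
  have hsum := H.sum_expected_gradient_le (lam₀ := lam₀) (om₀ := om₀) hα hξ hlaw hind hv₀ hd₀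
    hd₀L hdξ K
  have h0 : ∫ x, FSLA.lyapunov c F G (s 0 x) ∂P ≤ Φ₀ :=
    integral_mono (H.integral_lyapunov (hms 0) (hLs 0)).1
      (H.integrable_potential (hms 0) (hLs 0)) fun x => FSLA.lyapunov_le_potential hc _
  -- The error terms are nonnegative, so the final Lyapunov value can be discarded against the lower
  -- bound of `f`.
  have hK' : fLow ≤ ∫ x, FSLA.lyapunov c F G (s K x) ∂P := by
    have h1 := integral_mono (integrable_const fLow) (H.integral_lyapunov (hms K) (hLs K)).1
      fun x => (hlow _).trans (FSLA.hyperObj_le_lyapunov hc (s K x))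
    simpa using h1
  have key := FSLA.average_le_of_weighted_sum_le (A := Φ₀ - fLow) (C := σ ^ 2 * c.Cbar)
    (g := fun k => ∫ x, ‖gradient f (s k x).lam‖ ^ 2 ∂P) hδ
    (mul_nonneg (sq_nonneg σ) hc.Cbar_nonneg)
    (fun k => integral_nonneg fun x => by positivity) hK
    (by
      have h0' : ∫ x, FSLA.lyapunov c F G ⟨lam₀, om₀, v₀, d₀ x⟩ ∂P ≤ Φ₀ := h0
      rw [mul_div_assoc]
      linarith)
  refine key.trans (le_of_eq ?_)
  ring
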